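/- **Setting.** Let $X$ be a Banach space and let $(S(t))_{t\ge 0}$ be a semigroup of bounded, injective linear operators on $X$ (not necessarily strongly continuous at $0$), with generator $A:D(A)\subset X\to X$, i.e. $(\lambda-A)^{-1}u=\int_0^\infty e^{-\lambda t}S(t)u\,dt$ for all $u\in X$ and all large $\lambda$. Let $(X_\lambda)_{\lambda\in[0,2)}$ be Banach spaces with $X_0=X$ and $X_1=D(A)$, such that $X_\lambda$ is continuously embedded in $X_\beta$ whenever $\beta<\lambda$, and such that for every $T>0$ there are constants with $$\|S(t)\|_{\mathscr L(X_\zeta,X_\lambda)}\le L_{\zeta,\lambda,T}\,t^{-\lambda+\zeta}\quad(0\le\zeta\le\lambda<2),\qquad \|S(t)-I\|_{\mathscr L(X_\mu,X_\nu)}\le C_{\mu,\nu,T}\,t^{\mu-\nu}\quad(0\le\nu<\mu\le1)$$ for every $t\in(0,T]$. Let $\eta\in(1/2,1)$ and $x\in C^\eta([0,1];\mathbb R)$. Let $\sigma:X\to X$ be Gâteaux differentiable, with Gâteaux derivative $\sigma':X\to\mathscr L(X)$ bounded on $X$ and Lipschitz continuous on every ball of $X$. Let $\alpha\in(0,1)$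 be such that $\eta+\alpha>1$ and $\sigma(X_\alpha)\subset X_\alpha$, and let $\mathrm{Lip}_\sigma^\alpha,L_\sigma^\alpha,\omega>0$ be such that $$\|\sigma(u)-\sigma(v)\|_{X_\alpha}\le \mathrm{Lip}^\alpha_\sigma(1+R)^\omega\|u-v\|_{X_\alpha}\ \text{ if } R>0,\ \|u\|_{X_\alpha},\|v\|_{X_\alpha}\le R,\qquad \|\sigma(u)\|_{X_\alpha}\le L^\alpha_\sigma(1+\|u\|_{X_\alpha})\ \text{ for all } u\in X_\alpha.$$ **Function spaces.** For a Banach space $E\subset X$ and $a<b$: $\mathscr C_{-\gamma}((a,b];E)$ is the set of continuous $f:(a,b]\to E$ with $\sup_t (t-a)^\gamma\|f(t)\|_E<\infty$; $\mathscr C^{\beta}_{-\gamma}((a,b]^2_<;E)$ is the set of functions $f(s,t)$, continuous from $\{a<s\le t\le b\}$ to $E$, with $f(s,s)=0$ and $\sup_{a<s<t\le b}(s-a)^\gamma (t-s)^{-\beta}\|f(s,t)\|_E<\infty$; $\mathscr C^\beta([a,b]^2_<;E)$ is defined in the same way with $\gamma=0$ and $a\le s\le t\le b$. Put $(\hat\delta_1f)(s,t)=f(t)-S(t-s)f(s)$.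 For $\alpha>0$, $\gamma\ge0$, $Y^\alpha_{-\gamma}(0,1)$ is the set of $f:[0,1]\to X$ such that $f\in\mathscr C_{-\gamma}((0,1];X_\alpha)$, $f$ is bounded and continuous from $(0,1]$ to $X$, and $\hat\delta_1f\in\mathscr C^\alpha([0,1]^2_<;X_\alpha)$. **Convolution integral.** Let $\varphi:[a,b]\to X$ be such that $\varphi\in\mathscr C_{-\gamma'}((a,b];X_{\alpha'})$ and $\hat\delta_1\varphi\in\mathscr C^\rho_{-\gamma'}((a,b]^2_<;X_{\beta'})$ for some $0\le\beta'\le\alpha'<2$ with $\alpha'-\beta'<1$, $\rho\in(1-\eta,1)$ and $0\le\gamma'<\min\{\eta,\rho+\eta+\beta'-\alpha'\}$. Set $g(s,t)=(x(t)-x(s))\varphi(s)$. Let $M$ be the unique function on $\{a<s\le t\le b\}$ which belongs to $\mathscr C^{\eta+\rho-\varepsilon}([a+\tau,b]^2_<;X_{\beta'+\varepsilon})$ for all $\tau\in(0,b-a)$ and all $\varepsilon\in[0,1)$ with $\beta'+\varepsilon<2$, and satisfies, for all $a<r\le s\le t\le b$, $$M(r,t)-M(s,t)-S(t-s)M(r,s)=S(t-s)\big[-g(s,t)+S(s-r)(g(r,t)-g(r,s))\big].$$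 Then $\mathscr I_{S,\varphi}(s,t)=\int_s^tS(t-r)\varphi(r)\,dx(r)$ is said to be well defined: it equals $S(t-s)g(s,t)-M(s,t)$ for $a<s\le t\le b$, it is extended to $s=a<t$ by its limit in $X_{\alpha'}$ as $s\to a^+$, and it is $0$ at $(a,a)$. A *mild solution* of $dy(t)=Ay(t)\,dt+\sigma(y(t))\,dx(t)$, $t\in(0,1]$, $y(0)=\psi$, is a function $y:[0,1]\to X$ such that $\mathscr I_{S,\sigma\circ y}$ is well defined on $\{0\le s\le t\le 1\}$ and $y(t)=S(t)\psi+\mathscr I_{S,\sigma\circ y}(0,t)$ for every $t\in[0,1]$. **Theorem.** For every $\theta\in[0,\alpha]$ with $\eta>\alpha+(1+\omega)(\alpha-\theta)$ and every $\psi\in X_\theta$, there exists a unique mild solution in $Y^\alpha_{\theta-\alpha}(0,1)$. -/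

import Mathlib

open Set Filter Topology MeasureTheory

noncomputable section

variable {X : Type*} [NormedAddCommGroup X] [NormedSpace ℝ X]

/-- A linear subspace of `X` which is a Banach space for a norm `nrm` of its own. Only the values
of `nrm` on `carrier` are meaningful. -/
structure BanachSubspace (X : Type*) [NormedAddCommGroup X] [NormedSpace ℝ X] where
  carrier : Submodule ℝ X
  nrm : X → ℝ
  nrm_nonneg : ∀ u ∈ carrier, 0 ≤ nrm u
  nrm_eq_zero : ∀ u ∈ carrier, nrm u = 0 → u = 0
  nrm_smul : ∀ (c : ℝ), ∀ u ∈ carrier, nrm (c • u) = |c| * nrm u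
  nrm_add_le : ∀ u ∈ carrier, ∀ v ∈ carrier, nrm (u + v) ≤ nrm u + nrm v
  complete : ∀ u : ℕ → X, (∀ n, u n ∈ carrier) →
    (∀ ε > 0, ∃ N, ∀ m ≥ N, ∀ n ≥ N, nrm (u m - u n) < ε) →
    ∃ v ∈ carrier, Tendsto (fun n => nrm (u n - v)) atTop (𝓝 0)

/-- `A` is the generator of the (possibly not strongly continuous) semigroup `S`: for all large
real `l` the operator `l - A` is a bijection of `D(A)` onto `X`, and its inverse is the Laplace
transform `u ↦ ∫₀^∞ e^{-lt} S(t)u dt` of the semigroup. -/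
def IsGenerator (A : X →ₗ.[ℝ] X) (S : ℝ → X →L[ℝ] X) : Prop :=
  ∃ l₀ : ℝ, ∀ l > l₀,
    (∀ u : X, IntegrableOn (fun t : ℝ => Real.exp (-l * t) • S t u) (Ioi 0)) ∧
    (∀ u : X, ∃ v : A.domain,
      (v : X) = ∫ t in Ioi (0 : ℝ), Real.exp (-l * t) • S t u ∧ l • (v : X) - A v = u) ∧
    (∀ v : A.domain,
      ∫ t in Ioi (0 : ℝ), Real.exp (-l * t) • S t (l • (v : X) - A v) = v)

/-- Standing assumptions on the operator `A`, the semigroup `S(t)`, `t ≥ 0`, and the scale of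
Banach spaces `X_l = V l`, `0 ≤ l < 2` (the values of `S` at negative times and of `V` outside
`[0, 2)` play no role). The Banach norm of `X_1 = D(A)` is automatically equivalent to the graph
norm, by the closed graph theorem. -/
structure SemigroupScale (A : X →ₗ.[ℝ] X) (S : ℝ → X →L[ℝ] X) (V : ℝ → BanachSubspace X) :
    Prop where
  semigroup_zero : S 0 = ContinuousLinearMap.id ℝ X
  semigroup_add : ∀ s t : ℝ, 0 ≤ s → 0 ≤ t → S (s + t) = (S s).comp (S t)
  generator : IsGenerator A S
  carrier_zero : (V 0).carrier = ⊤
  nrm_zero : ∀ u : X, (V 0).nrm u = ‖u‖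
  carrier_one : (V 1).carrier = A.domain
  embedding : ∀ b l : ℝ, 0 ≤ b → b < l → l < 2 →
    (V l).carrier ≤ (V b).carrier ∧
    ∃ K : ℝ, 0 < K ∧ ∀ u ∈ (V l).carrier, (V b).nrm u ≤ K * (V l).nrm u
  smoothing : ∀ z l T : ℝ, 0 ≤ z → z ≤ l → l < 2 → 0 < T →
    ∃ L : ℝ, 0 < L ∧ ∀ t : ℝ, 0 < t → t ≤ T → ∀ u ∈ (V z).carrier,
      S t u ∈ (V l).carrier ∧ (V l).nrm (S t u) ≤ L * t ^ (-l + z) * (V z).nrm u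
  approximation : ∀ m n T : ℝ, 0 ≤ n → n < m → m ≤ 1 → 0 < T →
    ∃ C : ℝ, 0 < C ∧ ∀ t : ℝ, 0 < t → t ≤ T → ∀ u ∈ (V m).carrier,
      S t u - u ∈ (V n).carrier ∧ (V n).nrm (S t u - u) ≤ C * t ^ (m - n) * (V m).nrm u
  injective : ∀ t : ℝ, 0 ≤ t → Function.Injective (S t)

/-- `f` takes values in `E` on `D` and is continuous there for the norm of `E`. -/
def BanachSubspace.ContOn (E : BanachSubspace X) {Q : Type*} [TopologicalSpace Q]
    (f : Q → X) (D : Set Q) : Prop :=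
  (∀ p ∈ D, f p ∈ E.carrier) ∧
  ∀ p ∈ D, Tendsto (fun q => E.nrm (f q - f p)) (𝓝[D] p) (𝓝 0)

/-- `f ∈ 𝒞_{-γ}((a,b]; E)`. -/
def MemSing (E : BanachSubspace X) (γ a b : ℝ) (f : ℝ → X) : Prop :=
  E.ContOn f (Ioc a b) ∧ ∃ C : ℝ, ∀ t ∈ Ioc a b, (t - a) ^ γ * E.nrm (f t) ≤ C

/-- `f ∈ 𝒞^β([a,b]²_<; E)`, where `[a,b]²_< = {(s,t) : a ≤ s ≤ t ≤ b}`. -/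
def MemIncr (E : BanachSubspace X) (β a b : ℝ) (f : ℝ → ℝ → X) : Prop :=
  E.ContOn (fun p : ℝ × ℝ => f p.1 p.2) {p | a ≤ p.1 ∧ p.1 ≤ p.2 ∧ p.2 ≤ b} ∧
  (∀ s, a ≤ s → s ≤ b → f s s = 0) ∧
  ∃ C : ℝ, ∀ s t, a ≤ s → s < t → t ≤ b → E.nrm (f s t) / (t - s) ^ β ≤ C

/-- `f ∈ 𝒞^β_{-γ}((a,b]²_<; E)`, where `(a,b]²_< = {(s,t) : a < s ≤ t ≤ b}`. -/
def MemIncrSing (E : BanachSubspace X) (β γ a b : ℝ) (f : ℝ → ℝ → X) : Prop :=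
  E.ContOn (fun p : ℝ × ℝ => f p.1 p.2) {p | a < p.1 ∧ p.1 ≤ p.2 ∧ p.2 ≤ b} ∧
  (∀ s, a < s → s ≤ b → f s s = 0) ∧
  ∃ C : ℝ, ∀ s t, a < s → s < t → t ≤ b →
    (s - a) ^ γ * (E.nrm (f s t) / (t - s) ^ β) ≤ C

/-- The real path `x` belongs to `C^η([a,b])`. -/
def IsHolderPath (η a b : ℝ) (x : ℝ → ℝ) : Prop :=
  ∃ C : ℝ, ∀ s ∈ Icc a b, ∀ t ∈ Icc a b, |x t - x s| ≤ C * |t - s| ^ η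

/-- `(δ̂₁ f)(s,t) = f(t) - S(t-s) f(s)`. -/
def hatDelta₁ (S : ℝ → X →L[ℝ] X) (f : ℝ → X) (s t : ℝ) : X :=
  f t - S (t - s) (f s)

/-- `(δ̂₂ f)(r,s,t) = f(r,t) - f(s,t) - S(t-s) f(r,s)`. -/
def hatDelta₂ (S : ℝ → X →L[ℝ] X) (f : ℝ → ℝ → X) (r s t : ℝ) : X :=
  f r t - f s t - S (t - s) (f r s)

/-- `(δ_{S,2} g)(r,s,t) = -g(s,t) + S(s-r)[g(r,t) - g(r,s)]`. -/
def deltaS₂ (S : ℝ → X →L[ℝ] X) (g : ℝ → ℝ → X) (r s t : ℝ) : X :=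
  -g s t + S (s - r) (g r t - g r s)

/-- `M` is the function associated with `g` by the sewing lemma: it belongs to
`𝒞^{μ-ε}([a+τ,b]²_<; X_{β+ε})` for all `τ ∈ (0,b-a)` and `ε ∈ [0,1)` (as long as the space
`X_{β+ε}` is available, i.e. `β + ε < 2`), and `(δ̂₂ M)(r,s,t) = S(t-s) (δ_{S,2} g)(r,s,t)` for
`a < r ≤ s ≤ t ≤ b`. -/
def IsSewing (S : ℝ → X →L[ℝ] X) (V : ℝ → BanachSubspace X) (μ β a b : ℝ)
    (g M : ℝ → ℝ → X) : Prop :=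
  (∀ τ ε : ℝ, 0 < τ → τ < b - a → 0 ≤ ε → ε < 1 → β + ε < 2 →
    MemIncr (V (β + ε)) (μ - ε) (a + τ) b M) ∧
  ∀ r s t : ℝ, a < r → r ≤ s → s ≤ t → t ≤ b →
    hatDelta₂ S M r s t = S (t - s) (deltaS₂ S g r s t)

/-- The convolution integral `∫_s^t S(t-r) φ(r) dx(r)`, `a ≤ s ≤ t ≤ b`, driven by a path
`x ∈ C^η([a,b])`, is well defined and equal to `J s t`.

Well-definedness: `φ ∈ 𝒞_{-γ}((a,b]; X_α)` and `δ̂₁φ ∈ 𝒞^ρ_{-γ}((a,b]²_<; X_β)` for some admissible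
`α, β, ρ, γ`. Value: with `g(s,t) = (x(t) - x(s)) φ(s)` and `M` the sewing function of `g`
(`μ = η + ρ > 1`), `J s t = S(t-s) g(s,t) - M(s,t)` for `a < s`, and `J` is extended to `s = a`
by taking the limit in `X_α` as `s → a⁺`, and by zero at `(a,a)`. -/
def IsConvIntegral (S : ℝ → X →L[ℝ] X) (V : ℝ → BanachSubspace X) (η a b : ℝ)
    (x : ℝ → ℝ) (φ : ℝ → X) (J : ℝ → ℝ → X) : Prop :=
  IsHolderPath η a b x ∧
  ∃ α β ρ γ : ℝ, 0 ≤ β ∧ β ≤ α ∧ α < 2 ∧ α - β < 1 ∧ 1 - η < ρ ∧ ρ < 1 ∧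
    0 ≤ γ ∧ γ < min η (ρ + η + β - α) ∧
    MemSing (V α) γ a b φ ∧
    MemIncrSing (V β) ρ γ a b (hatDelta₁ S φ) ∧
    ∃ M : ℝ → ℝ → X,
      IsSewing S V (η + ρ) β a b (fun s t => (x t - x s) • φ s) M ∧
      (∀ s t, a < s → s ≤ t → t ≤ b →
        J s t = S (t - s) ((x t - x s) • φ s) - M s t) ∧
      (∀ t, a < t → t ≤ b → J a t ∈ (V α).carrier ∧
        Tendsto (fun s => (V α).nrm (J s t - J a t)) (𝓝[>] a) (𝓝 0)) ∧
      J a a = 0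

/-- `y : [0,T] → X` is a mild solution to `dy = A y dt + σ(y) dx`, `y(0) = ψ`: the convolution
integral `J` of the semigroup with `σ ∘ y` is well defined and `y(t) = S(t)ψ + J(0,t)`. -/
def IsMildSolution (S : ℝ → X →L[ℝ] X) (V : ℝ → BanachSubspace X) (η T : ℝ)
    (x : ℝ → ℝ) (σ : X → X) (ψ : X) (y : ℝ → X) : Prop :=
  ∃ J : ℝ → ℝ → X, IsConvIntegral S V η 0 T x (σ ∘ y) J ∧
    ∀ t ∈ Icc 0 T, y t = S t ψ + J 0 t

/-- `f ∈ Y^α_{-γ}(0,T)`: `f ∈ 𝒞_{-γ}((0,T]; X_α) ∩ C_b((0,T]; X)` and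
`δ̂₁ f ∈ 𝒞^α([0,T]²_<; X_α)`. -/
def MemY (S : ℝ → X →L[ℝ] X) (V : ℝ → BanachSubspace X) (α γ T : ℝ) (f : ℝ → X) : Prop :=
  MemSing (V α) γ 0 T f ∧ MemSing (V 0) 0 0 T f ∧ MemIncr (V α) α 0 T (hatDelta₁ S f)

end

/-! Write y = S(·)ψ + z with z(0) = 0. Since δ̂₁ annihilates orbits, the equation says that
δ̂₁z(s,t) is the convolution integral of φ = σ∘y over [s,t]. For fixed t this is the Young integral
of r ↦ S(t-r)φ(r) against x. The proof works with it as a limit of dyadic sums (`SolvesConv`), a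
description visibly linear in φ; `isSewing_of_solvesConv` and `fixedPoint_of_isMildSolution`
translate to and from the sewing definition.

One estimate carries the theorem. Suppose φ blows up like s^(-γ) in X_α, while δ̂₁φ has order α in X
only. Halving [u,v] at m changes a dyadic sum by (x(v)-x(m)) S(t-m) δ̂₁φ(u,m). Smoothing places this
in X_e at the price (t-m)^(-e), which is integrable for e < 1, so the corrections are summable
(`exists_bd_remainder`). For e = α and t ≤ 2s, the factor s^(-γ) is absorbed by a power of t-s, and
α+γ ≤ η leaves (t-s)^α. The cocycle relation, used on dyadic blocks shrinking to 0, extends this to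
all s (`exists_bd_of_bd_near_diagonal`, `exists_bd_convolution`): integration removes the
singularity at 0. A spare exponent κ > 0, spent on the weight exp(lt), yields a small factor l^(-κ)
(`exists_incrBd_of_solvesConv`).

For the nonlinearity, σ∘y is an admissible integrand with a bound linear in that of z
(`exists_isForcing_comp`). On bounded sets, differences of σ∘y are linear in differences of z, with
γ = (1+ω)(α-θ) (`exists_isForcing_comp_sub`). A large l therefore gives an invariant ball, and
another one a contraction among functions with a common bound. Picard iteration gives existence; two
solutions in Y always have a common bound, which gives uniqueness. -/

namespace BanachSubspace

/-! ### Bounds and limits in a Banach subspace -/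

variable {X : Type*} [NormedAddCommGroup X] [NormedSpace ℝ X] {E : BanachSubspace X} {u v : X}
  {c d : ℝ}

/-- `u` belongs to the subspace and has norm at most `c` there. -/
def Bd (E : BanachSubspace X) (u : X) (c : ℝ) : Prop := u ∈ E.carrier ∧ E.nrm u ≤ c

lemma Bd.nonneg (h : E.Bd u c) : 0 ≤ c := (E.nrm_nonneg u h.1).trans h.2

lemma Bd.mono (h : E.Bd u c) (hcd : c ≤ d) : E.Bd u d := ⟨h.1, h.2.trans hcd⟩

lemma Bd.add (hu : E.Bd u c) (hv : E.Bd v d) : E.Bd (u + v) (c + d) :=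
  ⟨E.carrier.add_mem hu.1 hv.1, (E.nrm_add_le u hu.1 v hv.1).trans (add_le_add hu.2 hv.2)⟩

lemma Bd.smul (hu : E.Bd u c) (a : ℝ) : E.Bd (a • u) (|a| * c) :=
  ⟨E.carrier.smul_mem a hu.1, by
    rw [E.nrm_smul a u hu.1]; exact mul_le_mul_of_nonneg_left hu.2 (abs_nonneg a)⟩

lemma Bd.smul_le (hu : E.Bd u c) {a b : ℝ} (hab : |a| ≤ b) : E.Bd (a • u) (b * c) :=
  (hu.smul a).mono (mul_le_mul_of_nonneg_right hab hu.nonneg)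

lemma Bd.neg (hu : E.Bd u c) : E.Bd (-u) c := by
  simpa using hu.smul (-1)

lemma Bd.sub (hu : E.Bd u c) (hv : E.Bd v d) : E.Bd (u - v) (c + d) := by
  rw [sub_eq_add_neg]; exact hu.add hv.neg

lemma Bd.sub_comm (h : E.Bd (u - v) c) : E.Bd (v - u) c := by
  simpa using h.neg

lemma nrm_zero_eq (E : BanachSubspace X) : E.nrm 0 = 0 := by
  simpa using E.nrm_smul 0 0 E.carrier.zero_mem

lemma bd_zero (E : BanachSubspace X) (hc : 0 ≤ c) : E.Bd 0 c :=
  ⟨E.carrier.zero_mem, by rwa [E.nrm_zero_eq]⟩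

lemma bd_nrm (hu : u ∈ E.carrier) : E.Bd u (E.nrm u) := ⟨hu, le_rfl⟩

/-- A Cauchy sequence with modulus `b` has a limit with the same modulus. -/
lemma exists_limit (E : BanachSubspace X) {w : ℕ → X} {b : ℕ → ℝ}
    (hb : Tendsto b atTop (𝓝 0)) (h : ∀ m n, m ≤ n → E.Bd (w n - w m) (b m)) :
    ∃ v, ∀ m, E.Bd (v - w m) (b m) := by
  -- The terms themselves need not lie in E, only their differences; completeness is applied to w n
  -- - w 0 and the limit is shifted back.
  have hmem : ∀ n, w n - w 0 ∈ E.carrier := fun n => (h 0 n (Nat.zero_le n)).1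
  obtain ⟨v, hv, hlim⟩ := E.complete (fun n => w n - w 0) hmem (by
    intro ε hε
    obtain ⟨N, hN⟩ := (hb.eventually (gt_mem_nhds hε)).exists_forall_of_atTop
    refine ⟨N, fun m hm n hn => ?_⟩
    have : (w m - w 0) - (w n - w 0) = w m - w n := by abel
    rw [this]
    rcases le_total m n with hmn | hmn
    · exact ((h m n hmn).sub_comm.2).trans_lt (hN m hm)
    · exact ((h n m hmn).2).trans_lt (hN n hn))
  refine ⟨v + w 0, fun m => ?_⟩
  have hmem' : ∀ n, w n - w 0 - v ∈ E.carrier := fun n => E.carrier.sub_mem (hmem n) hv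
  have hle : ∀ n, m ≤ n → E.Bd (v + w 0 - w m) (E.nrm (w n - w 0 - v) + b m) := by
    intro n hn
    have := (bd_nrm (hmem' n)).neg.add (h m n hn)
    convert this using 1
    abel
  refine ⟨(hle m le_rfl).1, ?_⟩
  have ht : Tendsto (fun n => E.nrm (w n - w 0 - v) + b m) atTop (𝓝 (0 + b m)) :=
    hlim.add_const _
  rw [zero_add] at ht
  exact ge_of_tendsto ht (eventually_atTop.2 ⟨m, fun n hn => (hle n hn).2⟩)

lemma bd_sub_of_geometric {w : ℕ → X} {C q : ℝ} (hq₀ : 0 ≤ q) (hq₁ : q < 1)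
    (h : ∀ n, E.Bd (w (n + 1) - w n) (C * q ^ n)) (m n : ℕ) (hmn : m ≤ n) :
    E.Bd (w n - w m) (C / (1 - q) * q ^ m) := by
  have h1q : 0 < 1 - q := by linarith
  have hC : 0 ≤ C := by simpa using (h 0).nonneg
  obtain ⟨k, rfl⟩ := Nat.exists_eq_add_of_le hmn
  have key : ∀ k, E.Bd (w (m + k) - w m) (C / (1 - q) * q ^ m * (1 - q ^ k)) := by
    intro k
    induction k with
    | zero => simpa using E.bd_zero le_rfl
    | succ k ih =>
      have := (h (m + k)).add ih
      rw [sub_add_sub_cancel] at this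
      refine this.mono (le_of_eq ?_)
      field_simp
      ring
  refine (key k).mono ?_
  have : 0 ≤ C / (1 - q) * q ^ m := by positivity
  nlinarith [pow_nonneg hq₀ k]

/-- The limit is taken in X, whereas completeness of E produces a limit in the norm of E; the
embedding of E into X identifies the two, so geometric estimates in E survive a limit known only in
X. -/
lemma bd_of_tendsto_geometric {K : ℝ} (hK : ∀ u c, E.Bd u c → ‖u‖ ≤ K * c) {w : ℕ → X}
    {C q : ℝ} (hq₀ : 0 ≤ q) (hq₁ : q < 1)
    (h : ∀ n, E.Bd (w (n + 1) - w n) (C * q ^ n)) {l : X} (hl : Tendsto w atTop (𝓝 l)) (m : ℕ) :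
    E.Bd (l - w m) (C / (1 - q) * q ^ m) := by
  have hb : Tendsto (fun m : ℕ => C / (1 - q) * q ^ m) atTop (𝓝 0) := by
    simpa using (tendsto_pow_atTop_nhds_zero_of_lt_one hq₀ hq₁).const_mul (C / (1 - q))
  obtain ⟨v, hv⟩ := E.exists_limit hb (bd_sub_of_geometric hq₀ hq₁ h)
  have : Tendsto w atTop (𝓝 v) := by
    rw [tendsto_iff_norm_sub_tendsto_zero]
    have h0 : Tendsto (fun m : ℕ => K * (C / (1 - q) * q ^ m)) atTop (𝓝 0) := by
      simpa using hb.const_mul K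
    exact squeeze_zero (fun _ => norm_nonneg _) (fun n => hK _ _ (hv n).sub_comm) h0
  rw [tendsto_nhds_unique hl this]
  exact hv m

end BanachSubspace

/-! ### Consequences of the smoothing and approximation estimates -/

namespace SemigroupScale

variable {X : Type*} [NormedAddCommGroup X] [NormedSpace ℝ X] {A : X →ₗ.[ℝ] X}
  {S : ℝ → X →L[ℝ] X} {V : ℝ → BanachSubspace X}

lemma bd_zero_iff (h : SemigroupScale A S V) {u : X} {c : ℝ} : (V 0).Bd u c ↔ ‖u‖ ≤ c := by
  simp [BanachSubspace.Bd, h.carrier_zero, h.nrm_zero]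

lemma zero_apply (h : SemigroupScale A S V) (u : X) : S 0 u = u := by
  simp [h.semigroup_zero]

lemma add_apply (h : SemigroupScale A S V) {s t : ℝ} (hs : 0 ≤ s) (ht : 0 ≤ t) (u : X) :
    S s (S t u) = S (s + t) u := by
  rw [h.semigroup_add s t hs ht]; rfl

lemma sub_apply (h : SemigroupScale A S V) {r s t : ℝ} (hrs : r ≤ s) (hst : s ≤ t) (u : X) :
    S (t - s) (S (s - r) u) = S (t - r) u := by
  rw [h.add_apply (sub_nonneg.2 hst) (sub_nonneg.2 hrs)]
  congr 2
  ring

lemma bd_smoothing (h : SemigroupScale A S V) {z l : ℝ} (hz : 0 ≤ z) (hzl : z ≤ l) (hl : l < 2) :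
    ∃ L : ℝ, 0 < L ∧ ∀ t u c, 0 < t → t ≤ 1 → (V z).Bd u c →
      (V l).Bd (S t u) (L * t ^ (-l + z) * c) := by
  obtain ⟨L, hL, H⟩ := h.smoothing z l 1 hz hzl hl one_pos
  refine ⟨L, hL, fun t u c ht ht1 hu => ?_⟩
  obtain ⟨h1, h2⟩ := H t ht ht1 u hu.1
  refine ⟨h1, h2.trans ?_⟩
  have : 0 ≤ L * t ^ (-l + z) := by positivity
  exact mul_le_mul_of_nonneg_left hu.2 this

lemma bd_apply (h : SemigroupScale A S V) {l : ℝ} (hl₀ : 0 ≤ l) (hl : l < 2) :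
    ∃ L : ℝ, 1 ≤ L ∧ ∀ t u c, 0 ≤ t → t ≤ 1 → (V l).Bd u c → (V l).Bd (S t u) (L * c) := by
  obtain ⟨L, hL, H⟩ := h.bd_smoothing hl₀ le_rfl hl
  refine ⟨max L 1, le_max_right _ _, fun t u c ht ht1 hu => ?_⟩
  rcases ht.eq_or_lt with rfl | ht
  · rw [h.zero_apply]
    exact hu.mono (le_mul_of_one_le_left hu.nonneg (le_max_right _ _))
  · refine (H t u c ht ht1 hu).mono ?_
    rw [neg_add_cancel, Real.rpow_zero, mul_one]
    exact mul_le_mul_of_nonneg_right (le_max_left _ _) hu.nonneg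

lemma norm_apply_le (h : SemigroupScale A S V) :
    ∃ L : ℝ, 1 ≤ L ∧ ∀ t u, 0 ≤ t → t ≤ 1 → ‖S t u‖ ≤ L * ‖u‖ := by
  obtain ⟨L, hL, H⟩ := h.bd_apply le_rfl two_pos
  exact ⟨L, hL, fun t u ht ht1 => h.bd_zero_iff.1 (H t u _ ht ht1 (h.bd_zero_iff.2 le_rfl))⟩

lemma bd_embedding (h : SemigroupScale A S V) {b l : ℝ} (hb : 0 ≤ b) (hbl : b ≤ l) (hl : l < 2) :
    ∃ K : ℝ, 0 < K ∧ ∀ u c, (V l).Bd u c → (V b).Bd u (K * c) := by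
  rcases hbl.eq_or_lt with rfl | hbl
  · exact ⟨1, one_pos, fun u c hu => by rwa [one_mul]⟩
  · obtain ⟨h1, K, hK, H⟩ := h.embedding b l hb hbl hl
    exact ⟨K, hK, fun u c hu => ⟨h1 hu.1, (H u hu.1).trans (mul_le_mul_of_nonneg_left hu.2 hK.le)⟩⟩

lemma norm_le_of_bd (h : SemigroupScale A S V) {l : ℝ} (hl₀ : 0 ≤ l) (hl : l < 2) :
    ∃ K : ℝ, 0 < K ∧ ∀ u c, (V l).Bd u c → ‖u‖ ≤ K * c := by
  obtain ⟨K, hK, H⟩ := h.bd_embedding le_rfl hl₀ hl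
  exact ⟨K, hK, fun u c hu => h.bd_zero_iff.1 (H u c hu)⟩

lemma bd_approximation (h : SemigroupScale A S V) {m n : ℝ} (hn : 0 ≤ n) (hnm : n < m)
    (hm : m ≤ 1) :
    ∃ C : ℝ, 0 < C ∧ ∀ t u c, 0 ≤ t → t ≤ 1 → (V m).Bd u c →
      (V n).Bd (S t u - u) (C * t ^ (m - n) * c) := by
  obtain ⟨C, hC, H⟩ := h.approximation m n 1 hn hnm hm one_pos
  refine ⟨C, hC, fun t u c ht ht1 hu => ?_⟩
  rcases ht.eq_or_lt with rfl | ht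
  · rw [h.zero_apply, sub_self, Real.zero_rpow (by linarith)]
    exact (V n).bd_zero (by simp)
  · obtain ⟨h1, h2⟩ := H t ht ht1 u hu.1
    refine ⟨h1, h2.trans ?_⟩
    have : 0 ≤ C * t ^ (m - n) := by positivity
    exact mul_le_mul_of_nonneg_left hu.2 this

lemma norm_apply_sub_le (h : SemigroupScale A S V) {m : ℝ} (hm₀ : 0 < m) (hm : m ≤ 1) :
    ∃ C : ℝ, 0 < C ∧ ∀ t u c, 0 ≤ t → t ≤ 1 → (V m).Bd u c → ‖S t u - u‖ ≤ C * t ^ m * c := by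
  obtain ⟨C, hC, H⟩ := h.bd_approximation le_rfl hm₀ hm
  refine ⟨C, hC, fun t u c ht ht1 hu => ?_⟩
  simpa using h.bd_zero_iff.1 (H t u c ht ht1 hu)

/-- Hölder continuity of the orbits away from `t = 0`. -/
lemma bd_apply_sub_apply (h : SemigroupScale A S V) {l : ℝ} (hl₀ : 0 ≤ l) (hl : l < 1) :
    ∃ C : ℝ, 0 < C ∧ ∀ r t u, 0 < r → r ≤ t → t ≤ 1 →
      (V l).Bd (S t u - S r u) (C * (t - r) ^ (1 - l) * r⁻¹ * ‖u‖) := by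
  -- S(t)u - S(r)u = (S(t-r) - I)S(r)u: the factor r⁻¹ is the cost of putting S(r)u into X_1, from
  -- which the approximation estimate reaches X_l for l < 1.
  obtain ⟨C, hC, H⟩ := h.bd_approximation hl₀ hl le_rfl
  obtain ⟨L, hL, H'⟩ := h.bd_smoothing le_rfl zero_le_one one_lt_two
  refine ⟨C * L, by positivity, fun r t u hr hrt ht => ?_⟩
  have := H (t - r) _ _ (by linarith) (by linarith)
    (H' r u ‖u‖ hr (hrt.trans ht) (h.bd_zero_iff.2 le_rfl))
  rw [h.add_apply (by linarith) hr.le, sub_add_cancel, add_zero, Real.rpow_neg_one] at this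
  refine this.mono (le_of_eq (by ring))

/-- Joint continuity of `(t, u) ↦ S(t)u`, `t > 0`, into the smaller spaces. -/
lemma tendsto_nrm_apply (h : SemigroupScale A S V) {l : ℝ} (hl₀ : 0 ≤ l) (hl : l < 1)
    {ι : Type*} {F : Filter ι} {τ : ι → ℝ} {f : ι → X} {t : ℝ} {u : X} (ht : 0 < t) (ht1 : t ≤ 1)
    (hτ : Tendsto τ F (𝓝 t)) (hτ1 : ∀ᶠ i in F, τ i ≤ 1) (hf : Tendsto f F (𝓝 u)) :
    (∀ᶠ i in F, S (τ i) (f i) - S t u ∈ (V l).carrier) ∧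
      Tendsto (fun i => (V l).nrm (S (τ i) (f i) - S t u)) F (𝓝 0) := by
  obtain ⟨C, hC, H⟩ := h.bd_apply_sub_apply hl₀ hl
  obtain ⟨L, hL, H'⟩ := h.bd_smoothing le_rfl hl₀ (by linarith)
  -- Eventually τ > t/2, so the inverse of the smaller of the two times is at most 2/t, whichever it
  -- is.
  have key : ∀ᶠ i in F, (V l).Bd (S (τ i) (f i) - S t u)
      (L * (τ i) ^ (-l + 0) * ‖f i - u‖ + C * |τ i - t| ^ (1 - l) * (2 * t⁻¹) * ‖u‖) := by
    filter_upwards [hτ1, hτ.eventually (lt_mem_nhds (half_lt_self ht))] with i hi1 hi2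
    have hi0 : 0 < τ i := by linarith
    have e : S (τ i) (f i) - S t u = S (τ i) (f i - u) + (S (τ i) u - S t u) := by
      rw [map_sub]; abel
    rw [e]
    refine (H' _ _ _ hi0 hi1 (h.bd_zero_iff.2 le_rfl)).add ?_
    have hinv : (τ i)⁻¹ ≤ 2 * t⁻¹ := by
      rw [inv_le_comm₀ hi0 (by positivity), mul_inv, inv_inv]; linarith
    have hti : t⁻¹ ≤ 2 * t⁻¹ := by linarith [inv_pos.2 ht]
    rcases le_total (τ i) t with hle | hle
    · refine (H _ _ u hi0 hle ht1).sub_comm.mono ?_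
      rw [abs_of_nonpos (by linarith), neg_sub]
      have := Real.rpow_nonneg (sub_nonneg.2 hle) (1 - l)
      gcongr
    · refine (H _ _ u ht hle hi1).mono ?_
      rw [abs_of_nonneg (by linarith)]
      have := Real.rpow_nonneg (sub_nonneg.2 hle) (1 - l)
      gcongr
  have lim : Tendsto (fun i => L * (τ i) ^ (-l + 0) * ‖f i - u‖ +
      C * |τ i - t| ^ (1 - l) * (2 * t⁻¹) * ‖u‖) F (𝓝 0) := by
    have h1 : Tendsto (fun i => (τ i) ^ (-l + 0)) F (𝓝 (t ^ (-l + 0))) :=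
      hτ.rpow_const (Or.inl ht.ne')
    have h2 := tendsto_iff_norm_sub_tendsto_zero.1 hf
    have h3 : Tendsto (fun i => |τ i - t|) F (𝓝 0) := by
      simpa using tendsto_iff_norm_sub_tendsto_zero.1 hτ
    have h4 : Tendsto (fun i => |τ i - t| ^ (1 - l)) F (𝓝 (0 ^ (1 - l))) :=
      h3.rpow_const (Or.inr (by linarith))
    rw [Real.zero_rpow (by linarith)] at h4
    have := ((h1.const_mul L).mul h2).add (((h4.const_mul C).mul_const (2 * t⁻¹)).mul_const ‖u‖)
    simpa using this
  refine ⟨key.mono fun i hi => hi.1, ?_⟩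
  exact squeeze_zero' (key.mono fun i hi => (V l).nrm_nonneg _ hi.1) (key.mono fun i hi => hi.2) lim

end SemigroupScale

/-! ### Dyadic Riemann–Stieltjes sums -/

section Dyadic

variable {X : Type*} [NormedAddCommGroup X] [NormedSpace ℝ X]

/-- Left-point Riemann–Stieltjes sum of `h` against `x` over `2 ^ n` equal pieces of `[s, t]`. -/
noncomputable def dyadicSum (x : ℝ → ℝ) (h : ℝ → X) : ℕ → ℝ → ℝ → X
  | 0, s, t => (x t - x s) • h s
  | n + 1, s, t => dyadicSum x h n s ((s + t) / 2) + dyadicSum x h n ((s + t) / 2) t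

variable {x y : ℝ → ℝ} {h k : ℝ → X}

lemma dyadicSum_congr {a b : ℝ} (hx : ∀ u ∈ Icc a b, x u = y u) (hh : ∀ u ∈ Icc a b, h u = k u)
    (n : ℕ) : ∀ s t, a ≤ s → s ≤ t → t ≤ b → dyadicSum x h n s t = dyadicSum y k n s t := by
  induction n with
  | zero =>
    intro s t hs hst ht
    simp only [dyadicSum]
    rw [hx t ⟨by linarith, ht⟩, hx s ⟨hs, by linarith⟩, hh s ⟨hs, by linarith⟩]
  | succ n ih =>
    intro s t hs hst ht
    simp only [dyadicSum]
    rw [ih _ _ hs (by linarith) (by linarith), ih _ _ (by linarith) (by linarith) ht]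

lemma dyadicSum_map (T : X →L[ℝ] X) {a b : ℝ} (hh : ∀ u ∈ Icc a b, k u = T (h u)) (n : ℕ) :
    ∀ s t, a ≤ s → s ≤ t → t ≤ b → dyadicSum x k n s t = T (dyadicSum x h n s t) := by
  induction n with
  | zero =>
    intro s t hs hst ht
    simp only [dyadicSum]
    rw [hh s ⟨hs, by linarith⟩, map_smul]
  | succ n ih =>
    intro s t hs hst ht
    simp only [dyadicSum, map_add]
    rw [ih _ _ hs (by linarith) (by linarith), ih _ _ (by linarith) (by linarith) ht]

lemma dyadicSum_sub (n : ℕ) : ∀ s t, dyadicSum x (fun r => h r - k r) n s t =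
    dyadicSum x h n s t - dyadicSum x k n s t := by
  induction n with
  | zero => intro s t; simp only [dyadicSum, smul_sub]
  | succ n ih => intro s t; simp only [dyadicSum, ih]; abel

lemma tendsto_dyadicSum {ι : Type*} {F : Filter ι} {w : ι → ℝ → ℝ}
    (hw : ∀ s t, Tendsto (fun i => w i t - w i s) F (𝓝 (x t - x s))) (n : ℕ) :
    ∀ s t, Tendsto (fun i => dyadicSum (w i) h n s t) F (𝓝 (dyadicSum x h n s t)) := by
  induction n with
  | zero => intro s t; exact (hw s t).smul_const _
  | succ n ih => intro s t; exact (ih _ _).add (ih _ _)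

lemma half_sub_rpow {s t : ℝ} (hst : s ≤ t) (ν : ℝ) :
    ((s + t) / 2 - s) ^ ν = (t - s) ^ ν * (1 / 2) ^ ν ∧
      (t - (s + t) / 2) ^ ν = (t - s) ^ ν * (1 / 2) ^ ν := by
  constructor <;>
  · rw [← Real.mul_rpow (sub_nonneg.2 hst) (by norm_num)]
    congr 1
    ring

/-- Refining the dyadic sums: a superadditive bound for one halving propagates to all levels. -/
lemma bd_dyadicSum_succ_sub {E : BanachSubspace X} {Ψ : ℝ → ℝ} {K ν a b : ℝ}
    (H : ∀ u v, a ≤ u → u ≤ v → v ≤ b →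
      E.Bd ((x v - x ((u + v) / 2)) • (h ((u + v) / 2) - h u)) (K * (v - u) ^ ν * (Ψ v - Ψ u)))
    (n : ℕ) : ∀ s t, a ≤ s → s ≤ t → t ≤ b →
      E.Bd (dyadicSum x h (n + 1) s t - dyadicSum x h n s t)
        (K * (t - s) ^ ν * (Ψ t - Ψ s) * ((1 / 2) ^ ν) ^ n) := by
  induction n with
  | zero =>
    intro s t hs hst ht
    have := H s t hs hst ht
    rw [pow_zero, mul_one]
    convert this using 1
    simp only [dyadicSum]
    module
  | succ n ih =>
    intro s t hs hst ht
    -- On the two halves the increments of Ψ add up to the whole increment, while the power ν of the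
    -- length gains a factor 2^(-ν).
    have h1 := ih s ((s + t) / 2) hs (by linarith) (by linarith)
    have h2 := ih ((s + t) / 2) t (by linarith) (by linarith) ht
    rw [(half_sub_rpow hst ν).1] at h1
    rw [(half_sub_rpow hst ν).2] at h2
    have h3 := h1.add h2
    have e : dyadicSum x h (n + 1 + 1) s t - dyadicSum x h (n + 1) s t =
        dyadicSum x h (n + 1) s ((s + t) / 2) - dyadicSum x h n s ((s + t) / 2) +
        (dyadicSum x h (n + 1) ((s + t) / 2) t - dyadicSum x h n ((s + t) / 2) t) := by
      rw [show dyadicSum x h (n + 1 + 1) s t = dyadicSum x h (n + 1) s ((s + t) / 2) +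
        dyadicSum x h (n + 1) ((s + t) / 2) t from rfl,
        show dyadicSum x h (n + 1) s t = dyadicSum x h n s ((s + t) / 2) +
        dyadicSum x h n ((s + t) / 2) t from rfl]
      abel
    rw [e]
    refine h3.mono (le_of_eq ?_)
    rw [pow_succ]
    ring

lemma two_mul_half_rpow_lt_one {μ : ℝ} (hμ : 1 < μ) : 2 * (1 / 2 : ℝ) ^ μ < 1 := by
  have : (1 / 2 : ℝ) ^ μ < (1 / 2) ^ (1 : ℝ) :=
    Real.rpow_lt_rpow_of_exponent_gt (by norm_num) (by norm_num) hμ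
  rw [Real.rpow_one] at this
  linarith

/-- An additive functional which differs from the germ `(x t - x s) • h s` by a quantity of order
larger than one is the limit of the dyadic sums. -/
lemma tendsto_dyadicSum_of_additive {I : ℝ → ℝ → X} {a b C μ : ℝ} (hμ : 1 < μ)
    (hadd : ∀ r s t, a ≤ r → r ≤ s → s ≤ t → t ≤ b → I r t = I r s + I s t)
    (hgerm : ∀ s t, a ≤ s → s ≤ t → t ≤ b → ‖I s t - (x t - x s) • h s‖ ≤ C * (t - s) ^ μ)
    {s t : ℝ} (hs : a ≤ s) (hst : s ≤ t) (ht : t ≤ b) :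
    Tendsto (fun n => dyadicSum x h n s t) atTop (𝓝 (I s t)) := by
  -- Halving replaces one error by two, each smaller by 2^(-μ); the ratio 2·2^(-μ) is below 1
  -- because μ > 1.
  have key : ∀ n s t, a ≤ s → s ≤ t → t ≤ b →
      ‖I s t - dyadicSum x h n s t‖ ≤ C * (t - s) ^ μ * (2 * (1 / 2) ^ μ) ^ n := by
    intro n
    induction n with
    | zero => intro s t hs hst ht; simpa [dyadicSum] using hgerm s t hs hst ht
    | succ n ih =>
      intro s t hs hst ht
      have h1 := ih s ((s + t) / 2) hs (by linarith) (by linarith)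
      have h2 := ih ((s + t) / 2) t (by linarith) (by linarith) ht
      rw [(half_sub_rpow hst μ).1] at h1
      rw [(half_sub_rpow hst μ).2] at h2
      have e : I s t - dyadicSum x h (n + 1) s t = I s ((s + t) / 2) -
          dyadicSum x h n s ((s + t) / 2) + (I ((s + t) / 2) t -
          dyadicSum x h n ((s + t) / 2) t) := by
        rw [dyadicSum, hadd s ((s + t) / 2) t hs (by linarith) (by linarith) ht]; abel
      rw [e]
      refine (norm_add_le_of_le h1 h2).trans (le_of_eq ?_)
      rw [pow_succ]
      ring
  rw [tendsto_iff_norm_sub_tendsto_zero]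
  have h0 : Tendsto (fun n : ℕ => C * (t - s) ^ μ * (2 * (1 / 2) ^ μ) ^ n) atTop (𝓝 0) := by
    simpa using (tendsto_pow_atTop_nhds_zero_of_lt_one (by positivity)
      (two_mul_half_rpow_lt_one hμ)).const_mul (C * (t - s) ^ μ)
  refine squeeze_zero (fun _ => norm_nonneg _) (fun n => ?_) h0
  rw [norm_sub_rev]
  exact key n s t hs hst ht

end Dyadic

/-! ### Smoothing a Hölder path -/

section Mollify

lemma continuous_of_holder {X : Type*} [NormedAddCommGroup X] {f : ℝ → X} {K ρ : ℝ} (hρ : 0 < ρ)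
    (hf : ∀ u v, ‖f v - f u‖ ≤ K * |v - u| ^ ρ) : Continuous f := by
  rw [continuous_iff_continuousAt]
  intro u
  rw [ContinuousAt, tendsto_iff_norm_sub_tendsto_zero]
  have h3 : Tendsto (fun v : ℝ => |v - u|) (𝓝 u) (𝓝 0) := by
    have : Continuous fun v : ℝ => |v - u| := by fun_prop
    simpa using this.tendsto u
  have h4 : Tendsto (fun v => K * |v - u| ^ ρ) (𝓝 u) (𝓝 0) := by
    have := (h3.rpow_const (p := ρ) (Or.inr hρ.le)).const_mul K
    rwa [Real.zero_rpow hρ.ne', mul_zero] at this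
  exact squeeze_zero (fun _ => norm_nonneg _) (fun v => hf u v) h4

/-- Mollification of a Hölder path, with the Hölder constant preserved. -/
lemma exists_mollification {x : ℝ → ℝ} {H η : ℝ} (hη : 0 < η)
    (hx : ∀ u v, |x v - x u| ≤ H * |v - u| ^ η) {ε : ℝ} (hε : 0 < ε) :
    ∃ (d y : ℝ → ℝ) (D : ℝ), Continuous d ∧ (∀ r, |d r| ≤ D) ∧
      (∀ s t, y t - y s = ∫ r in s..t, d r) ∧
      (∀ s t, |y t - y s| ≤ H * |t - s| ^ η) ∧
      (∀ s t, |y t - y s - (x t - x s)| ≤ 2 * H * ε ^ η) := by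
  have hH : 0 ≤ H := by simpa using (abs_nonneg _).trans (hx 0 1)
  have hc : Continuous x := continuous_of_holder hη hx
  have hi : ∀ a b, IntervalIntegrable x volume a b := fun a b => hc.intervalIntegrable a b
  have hi' : ∀ t : ℝ, IntervalIntegrable (fun z => x (t + ε * z)) volume 0 1 := fun t =>
    (hc.comp (by fun_prop)).intervalIntegrable _ _
  -- The Steklov average over [t, t+ε]: its derivative is a difference quotient, and averaging
  -- translates of x preserves the Hölder constant.
  refine ⟨fun r => ε⁻¹ * (x (r + ε) - x r), fun t => ∫ z in (0:ℝ)..1, x (t + ε * z),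
    ε⁻¹ * (H * ε ^ η), by fun_prop, ?_, ?_, ?_, ?_⟩
  · intro r
    rw [abs_mul, abs_of_pos (inv_pos.2 hε)]
    have := hx r (r + ε)
    rw [add_sub_cancel_left, abs_of_pos hε] at this
    gcongr
  · intro s t
    simp only
    rw [intervalIntegral.integral_comp_add_mul (fun r => x r) hε.ne',
      intervalIntegral.integral_comp_add_mul (fun r => x r) hε.ne',
      intervalIntegral.integral_const_mul, intervalIntegral.integral_sub
        ((by fun_prop : Continuous fun r => x (r + ε)).intervalIntegrable _ _) (hi _ _),
      intervalIntegral.integral_comp_add_right (fun r => x r)]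
    simp only [mul_zero, add_zero, mul_one, smul_eq_mul]
    have h1 := intervalIntegral.integral_add_adjacent_intervals (hi s t) (hi t (t + ε))
    have h2 := intervalIntegral.integral_add_adjacent_intervals (hi s (s + ε)) (hi (s + ε) (t + ε))
    rw [← mul_sub]
    congr 1
    linarith
  · intro s t
    simp only
    rw [← intervalIntegral.integral_sub (hi' t) (hi' s)]
    have := intervalIntegral.norm_integral_le_of_norm_le_const (a := (0:ℝ)) (b := 1)
      (f := fun z => x (t + ε * z) - x (s + ε * z)) (C := H * |t - s| ^ η) (by
        intro z _
        have := hx (s + ε * z) (t + ε * z)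
        rwa [add_sub_add_right_eq_sub] at this)
    simpa using this
  · intro s t
    have e : (∫ z in (0:ℝ)..1, x (t + ε * z)) - (∫ z in (0:ℝ)..1, x (s + ε * z)) - (x t - x s) =
        ∫ z in (0:ℝ)..1, ((x (t + ε * z) - x (s + ε * z)) - (x t - x s)) := by
      rw [intervalIntegral.integral_sub ((hi' t).sub (hi' s)) (by simp),
        intervalIntegral.integral_sub (hi' t) (hi' s)]
      simp
    simp only
    rw [e]
    have := intervalIntegral.norm_integral_le_of_norm_le_const (a := (0:ℝ)) (b := 1)
      (f := fun z => (x (t + ε * z) - x (s + ε * z)) - (x t - x s)) (C := 2 * H * ε ^ η) (by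
        intro z hz
        rw [uIoc_of_le zero_le_one] at hz
        have hb : ∀ r, |x (r + ε * z) - x r| ≤ H * ε ^ η := by
          intro r
          refine (hx r (r + ε * z)).trans ?_
          rw [add_sub_cancel_left, abs_of_pos (mul_pos hε hz.1)]
          have : ε * z ≤ ε := mul_le_of_le_one_right hε.le hz.2
          have := mul_pos hε hz.1
          gcongr
        have e2 : (x (t + ε * z) - x (s + ε * z)) - (x t - x s) =
          (x (t + ε * z) - x t) - (x (s + ε * z) - x s) := by ring
        rw [Real.norm_eq_abs, e2]
        refine (abs_sub _ _).trans ?_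
        linarith [hb t, hb s])
    simpa using this

end Mollify

/-! ### The Young integral and its additivity -/

section Young

variable {X : Type*} [NormedAddCommGroup X] [NormedSpace ℝ X] [CompleteSpace X]

/-- The whole space, as a Banach subspace of itself. -/
def BanachSubspace.whole (X : Type*) [NormedAddCommGroup X] [NormedSpace ℝ X] [CompleteSpace X] :
    BanachSubspace X where
  carrier := ⊤
  nrm u := ‖u‖
  nrm_nonneg u _ := norm_nonneg u
  nrm_eq_zero u _ h := norm_eq_zero.1 h
  nrm_smul c u _ := by rw [norm_smul, Real.norm_eq_abs]
  nrm_add_le u _ v _ := norm_add_le u v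
  complete u _ hu := by
    have : CauchySeq u := Metric.cauchySeq_iff.2 fun ε hε => by
      simpa only [dist_eq_norm] using hu ε hε
    obtain ⟨v, hv⟩ := cauchySeq_tendsto_of_complete this
    exact ⟨v, trivial, tendsto_iff_norm_sub_tendsto_zero.1 hv⟩

lemma BanachSubspace.bd_whole {u : X} {c : ℝ} : (BanachSubspace.whole X).Bd u c ↔ ‖u‖ ≤ c := by
  simp [BanachSubspace.Bd, BanachSubspace.whole]

lemma dyadicSum_increment {x : ℝ → ℝ} {h : ℝ → X} {ρ η K H : ℝ} (hρ : 0 < ρ) (hη : 0 < η)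
    (hh : ∀ u v, ‖h v - h u‖ ≤ K * |v - u| ^ ρ) (hx : ∀ u v, |x v - x u| ≤ H * |v - u| ^ η)
    (n : ℕ) {s t : ℝ} (hst : s ≤ t) :
    (BanachSubspace.whole X).Bd (dyadicSum x h (n + 1) s t - dyadicSum x h n s t)
      (H * K * (t - s) ^ (ρ + η - 1) * (t - s) * ((1 / 2) ^ (ρ + η - 1)) ^ n) := by
  have hK : 0 ≤ K := by simpa using (norm_nonneg _).trans (hh 0 1)
  have hH : 0 ≤ H := by simpa using (abs_nonneg _).trans (hx 0 1)
  refine bd_dyadicSum_succ_sub (Ψ := id) (a := s) (b := t) (fun u v _ huv _ => ?_) n s t le_rfl hst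
    le_rfl
  rw [BanachSubspace.bd_whole, norm_smul, Real.norm_eq_abs]
  have hm : |v - (u + v) / 2| ≤ v - u := by rw [abs_le]; constructor <;> linarith
  have hm' : |(u + v) / 2 - u| ≤ v - u := by rw [abs_le]; constructor <;> linarith
  have h1 : |x v - x ((u + v) / 2)| ≤ H * (v - u) ^ η := (hx _ _).trans (by gcongr)
  have h2 : ‖h ((u + v) / 2) - h u‖ ≤ K * (v - u) ^ ρ := (hh _ _).trans (by gcongr)
  refine (mul_le_mul h1 h2 (norm_nonneg _) ((abs_nonneg _).trans h1)).trans (le_of_eq ?_)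
  rcases huv.eq_or_lt with rfl | huv
  · simp [Real.zero_rpow hη.ne']
  · have hp : 0 < v - u := by linarith
    rw [Real.rpow_sub hp, Real.rpow_one, Real.rpow_add hp]
    simp only [id]
    field_simp

/-- The Young integral: the dyadic sums converge, and their limit is additive. -/
lemma exists_additive_of_holder {x : ℝ → ℝ} {h : ℝ → X} {ρ η K H : ℝ} (hρ : 0 < ρ) (hη : 0 < η)
    (hμ : 1 < ρ + η)
    (hh : ∀ u v, ‖h v - h u‖ ≤ K * |v - u| ^ ρ) (hx : ∀ u v, |x v - x u| ≤ H * |v - u| ^ η) :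
    ∃ I : ℝ → ℝ → X, (∀ r s t, r ≤ s → s ≤ t → I r t = I r s + I s t) ∧
      ∀ s t, s ≤ t → Tendsto (fun n => dyadicSum x h n s t) atTop (𝓝 (I s t)) := by
  have hK : 0 ≤ K := by simpa using (norm_nonneg _).trans (hh 0 1)
  have hH : 0 ≤ H := by simpa using (abs_nonneg _).trans (hx 0 1)
  have hq₀ : (0 : ℝ) ≤ (1 / 2) ^ (ρ + η - 1) := by positivity
  have hq₁ : (1 / 2 : ℝ) ^ (ρ + η - 1) < 1 :=
    Real.rpow_lt_one (by norm_num) (by norm_num) (by linarith)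
  have hW : ∀ u c, (BanachSubspace.whole X).Bd u c → ‖u‖ ≤ 1 * c := fun u c hu => by
    rw [one_mul]; exact BanachSubspace.bd_whole.1 hu
  set B : ℝ → ℝ → ℕ → ℝ := fun s t n => H * K * (t - s) ^ (ρ + η - 1) * (t - s) /
    (1 - (1 / 2) ^ (ρ + η - 1)) * ((1 / 2) ^ (ρ + η - 1)) ^ n with hB
  have hBlim : ∀ s t, Tendsto (B s t) atTop (𝓝 0) := fun s t => by
    have := (tendsto_pow_atTop_nhds_zero_of_lt_one hq₀ hq₁).const_mul
      (H * K * (t - s) ^ (ρ + η - 1) * (t - s) / (1 - (1 / 2) ^ (ρ + η - 1)))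
    rwa [mul_zero] at this
  -- The tail bound sees the path only through H, so it is uniform over all mollifications of x.
  have tail : ∀ w : ℝ → ℝ, (∀ u v, |w v - w u| ≤ H * |v - u| ^ η) → ∀ s t, s ≤ t → ∀ l : X,
      Tendsto (fun n => dyadicSum w h n s t) atTop (𝓝 l) →
      ∀ n, ‖l - dyadicSum w h n s t‖ ≤ B s t n := fun w hw s t hst l hl n =>
    BanachSubspace.bd_whole.1 (BanachSubspace.bd_of_tendsto_geometric hW hq₀ hq₁
      (fun n => dyadicSum_increment hρ hη hh hw n hst) hl n)
  have hlim : ∀ s t, ∃ l : X, s ≤ t → Tendsto (fun n => dyadicSum x h n s t) atTop (𝓝 l) := by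
    intro s t
    by_cases hst : s ≤ t
    · obtain ⟨v, hv⟩ := (BanachSubspace.whole X).exists_limit (hBlim s t)
        (BanachSubspace.bd_sub_of_geometric (w := fun n => dyadicSum x h n s t) hq₀ hq₁
          (fun n => dyadicSum_increment hρ hη hh hx n hst))
      refine ⟨v, fun _ => ?_⟩
      rw [tendsto_iff_norm_sub_tendsto_zero]
      exact squeeze_zero (fun _ => norm_nonneg _)
        (fun n => BanachSubspace.bd_whole.1 (hv n).sub_comm) (hBlim s t)
    · exact ⟨0, fun h => absurd h hst⟩
  choose I hI using hlim
  refine ⟨I, ?_, hI⟩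
  -- For a general s in [r,t], the dyadic points of [r,t] are unrelated to those of [r,s] and [s,t],
  -- so additivity cannot be read off the sums. For a mollified path the limit is an ordinary
  -- integral, hence additive, and the uniform tail bound permits the mollification to be removed.
  have hc : Continuous h := continuous_of_holder hρ hh
  have hε : ∀ N : ℕ, (0 : ℝ) < 1 / (N + 1) := fun N => by positivity
  choose d y D hd hdD hy hyH hyx using fun N => exists_mollification hη hx (hε N)
  have hint : ∀ N a b, IntervalIntegrable (fun r => d N r • h r) volume a b := fun N a b =>
    ((hd N).smul hc).intervalIntegrable a b
  set J : ℕ → ℝ → ℝ → X := fun N s t => ∫ r in s..t, d N r • h r with hJ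
  have hJadd : ∀ N r s t, J N r t = J N r s + J N s t := fun N r s t =>
    (intervalIntegral.integral_add_adjacent_intervals (hint N r s) (hint N s t)).symm
  have hJgerm : ∀ N s t, s ≤ t →
      ‖J N s t - (y N t - y N s) • h s‖ ≤ D N * K * (t - s) ^ (ρ + 1) := by
    intro N s t hst
    rw [hy, ← intervalIntegral.integral_smul_const, hJ]
    simp only
    rw [← intervalIntegral.integral_sub (hint N s t)
      ((by have := hd N; fun_prop : Continuous fun r => d N r • h s).intervalIntegrable s t)]
    have hD : 0 ≤ D N := (abs_nonneg _).trans (hdD N 0)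
    have := intervalIntegral.norm_integral_le_of_norm_le_const (a := s) (b := t)
      (f := fun r => d N r • h r - d N r • h s) (C := D N * (K * (t - s) ^ ρ)) (by
        intro r hr
        rw [uIoc_of_le hst] at hr
        rw [← smul_sub, norm_smul, Real.norm_eq_abs]
        refine mul_le_mul (hdD N r) ((hh s r).trans ?_) (norm_nonneg _) hD
        rw [abs_of_nonneg (by linarith [hr.1])]
        have : 0 ≤ r - s := by linarith [hr.1]
        have : r - s ≤ t - s := by linarith [hr.2]
        gcongr)
    rw [abs_of_nonneg (by linarith)] at this
    refine this.trans (le_of_eq ?_)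
    rcases hst.eq_or_lt with rfl | hst
    · rw [sub_self, Real.zero_rpow (by linarith : ρ + 1 ≠ 0)]; ring
    · rw [Real.rpow_add (by linarith), Real.rpow_one]; ring
  have hJdy : ∀ N s t, s ≤ t → Tendsto (fun n => dyadicSum (y N) h n s t) atTop (𝓝 (J N s t)) :=
    fun N s t hst => tendsto_dyadicSum_of_additive (a := s) (b := t) (μ := ρ + 1) (by linarith)
      (fun r s t _ _ _ _ => hJadd N r s t) (fun s t _ hst _ => hJgerm N s t hst) le_rfl hst le_rfl
  have hyconv : ∀ s t, Tendsto (fun N => y N t - y N s) atTop (𝓝 (x t - x s)) := by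
    intro s t
    rw [tendsto_iff_norm_sub_tendsto_zero]
    have h1 : Tendsto (fun N : ℕ => 2 * H * (1 / ((N : ℝ) + 1)) ^ η) atTop (𝓝 0) := by
      have := (tendsto_one_div_add_atTop_nhds_zero_nat (𝕜 := ℝ)).rpow_const
        (p := η) (Or.inr hη.le)
      rw [Real.zero_rpow hη.ne'] at this
      simpa using this.const_mul (2 * H)
    exact squeeze_zero (fun _ => norm_nonneg _) (fun N => hyx N s t) h1
  have hJI : ∀ s t, s ≤ t → Tendsto (fun N => J N s t) atTop (𝓝 (I s t)) := by
    intro s t hst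
    rw [Metric.tendsto_atTop]
    intro ε hε
    obtain ⟨n, hn⟩ := ((hBlim s t).eventually (gt_mem_nhds (by positivity : 0 < ε / 3))).exists
    obtain ⟨N₀, hN₀⟩ := Metric.tendsto_atTop.1 (tendsto_dyadicSum (h := h) hyconv n s t) (ε / 3)
      (by positivity)
    refine ⟨N₀, fun N hN => ?_⟩
    have h1 := tail (y N) (fun u v => hyH N u v) s t hst _ (hJdy N s t hst) n
    have h2 := tail x hx s t hst _ (hI s t hst) n
    have h3 := hN₀ N hN
    rw [dist_eq_norm] at h3 ⊢
    have e : J N s t - I s t = (J N s t - dyadicSum (y N) h n s t) +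
      (dyadicSum (y N) h n s t - dyadicSum x h n s t) - (I s t - dyadicSum x h n s t) := by abel
    rw [e]
    refine (norm_sub_le _ _).trans_lt ?_
    have := norm_add_le (J N s t - dyadicSum (y N) h n s t)
      (dyadicSum (y N) h n s t - dyadicSum x h n s t)
    linarith
  intro r s t hrs hst
  refine tendsto_nhds_unique (hJI r t (hrs.trans hst)) ?_
  simp only [hJadd _ r s t]
  exact (hJI r s hrs).add (hJI s t hst)

/-- Projection onto [a,b] is 1-Lipschitz, so composing with it extends a Hölder function to the line
with the same constant. -/
lemma holder_clamp {Y : Type*} [NormedAddCommGroup Y] {f : ℝ → Y} {a b K ρ : ℝ} (hab : a ≤ b)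
    (hK : 0 ≤ K) (hρ : 0 < ρ)
    (hf : ∀ u v, a ≤ u → u ≤ v → v ≤ b → ‖f v - f u‖ ≤ K * (v - u) ^ ρ) (u v : ℝ) :
    ‖f (max a (min v b)) - f (max a (min u b))‖ ≤ K * |v - u| ^ ρ := by
  wlog huv : u ≤ v generalizing u v
  · rw [norm_sub_rev, abs_sub_comm]
    exact this v u (le_of_not_ge huv)
  have hmono : max a (min u b) ≤ max a (min v b) := max_le_max le_rfl (min_le_min huv le_rfl)
  refine (hf _ _ (le_max_left _ _) hmono (max_le hab (min_le_right _ _))).trans ?_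
  have : max a (min v b) - max a (min u b) ≤ |v - u| := by
    rw [abs_of_nonneg (by linarith)]
    rcases max_cases a (min v b) with h1 | h1 <;> rcases max_cases a (min u b) with h2 | h2 <;>
    rcases min_cases v b with h3 | h3 <;> rcases min_cases u b with h4 | h4 <;> linarith
  have h0 : 0 ≤ max a (min v b) - max a (min u b) := by linarith
  gcongr

/-- The Young integral on a compact interval. -/
lemma exists_additive_of_holderOn {x : ℝ → ℝ} {h : ℝ → X} {a b ρ η K H : ℝ} (hab : a ≤ b)
    (hρ : 0 < ρ) (hη : 0 < η) (hμ : 1 < ρ + η) (hK : 0 ≤ K) (hH : 0 ≤ H)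
    (hh : ∀ u v, a ≤ u → u ≤ v → v ≤ b → ‖h v - h u‖ ≤ K * (v - u) ^ ρ)
    (hx : ∀ u v, a ≤ u → u ≤ v → v ≤ b → |x v - x u| ≤ H * (v - u) ^ η) :
    ∃ I : ℝ → ℝ → X, (∀ r s t, r ≤ s → s ≤ t → I r t = I r s + I s t) ∧
      ∀ s t, a ≤ s → s ≤ t → t ≤ b →
        Tendsto (fun n => dyadicSum x h n s t) atTop (𝓝 (I s t)) := by
  obtain ⟨I, hadd, hI⟩ := exists_additive_of_holder hρ hη hμ (holder_clamp hab hK hρ hh)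
    (holder_clamp (f := x) hab hH hη hx)
  refine ⟨I, hadd, fun s t hs hst ht => (hI s t hst).congr fun n => ?_⟩
  have hcl : ∀ u ∈ Icc a b, max a (min u b) = u := fun u hu => by
    rw [min_eq_left hu.2, max_eq_right hu.1]
  exact dyadicSum_congr (fun u hu => by rw [hcl u hu]) (fun u hu => by rw [hcl u hu]) n s t hs hst ht

end Young

/-! ### The convolution integral and its estimates -/

section Convolution

variable {X : Type*} [NormedAddCommGroup X] [NormedSpace ℝ X]

/-- An integrand of the convolution integral: it may blow up like `s ^ (-γ)` at `0` and grow
like `exp (l * t)`. -/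
def IsForcing (S : ℝ → X →L[ℝ] X) (E : BanachSubspace X) (α γ l P : ℝ) (φ : ℝ → X) : Prop :=
  (∀ s, 0 < s → s ≤ 1 → E.Bd (φ s) (P * Real.exp (l * s) * s ^ (-γ))) ∧
  ∀ s t, 0 < s → s ≤ t → t ≤ 1 →
    ‖hatDelta₁ S φ s t‖ ≤ P * Real.exp (l * t) * s ^ (-γ) * (t - s) ^ α

/-- The `E`-valued Hölder bound of order `α`, with weight `exp (l * t)`, for `δ̂₁ z`. -/
def IncrBd (S : ℝ → X →L[ℝ] X) (E : BanachSubspace X) (α l R : ℝ) (z : ℝ → X) : Prop :=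
  ∀ s t, 0 ≤ s → s ≤ t → t ≤ 1 →
    E.Bd (hatDelta₁ S z s t) (R * Real.exp (l * t) * (t - s) ^ α)

/-- `δ̂₁ z` is the convolution integral of `φ` against `x`, as a limit of dyadic sums. -/
def SolvesConv (S : ℝ → X →L[ℝ] X) (x : ℝ → ℝ) (φ z : ℝ → X) : Prop :=
  ∀ s t, 0 < s → s ≤ t → t ≤ 1 →
    Tendsto (fun n => dyadicSum x (fun r => S (t - r) (φ r)) n s t) atTop
      (𝓝 (hatDelta₁ S z s t))

/-- `F(r,t) = F(s,t) + S(t-s)F(r,s)` for `0 < r ≤ s ≤ t ≤ 1`. -/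
def IsCocycle (S : ℝ → X →L[ℝ] X) (F : ℝ → ℝ → X) : Prop :=
  ∀ r s t, 0 < r → r ≤ s → s ≤ t → t ≤ 1 → F r t = F s t + S (t - s) (F r s)

/-- Bernoulli's inequality expresses the concavity of p ↦ p^(1-a), and the midpoint is at least p/2,
which costs a factor 2^a ≤ 2. An integrable singularity thus becomes an increment, which adds up
over subdivisions. -/
lemma midpoint_rpow_mul_le {a p q : ℝ} (ha₀ : 0 ≤ a) (ha₁ : a < 1) (hq : 0 ≤ q) (hqp : q < p) :
    ((p + q) / 2) ^ (-a) * (p - q) ≤ 2 / (1 - a) * (p ^ (1 - a) - q ^ (1 - a)) := by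
  have hp : 0 < p := by linarith
  have h1a : 0 < 1 - a := by linarith
  have hx : (1 + (q / p - 1)) ^ (1 - a) ≤ 1 + (1 - a) * (q / p - 1) :=
    rpow_one_add_le_one_add_mul_self (by linarith [div_nonneg hq hp.le]) h1a.le (by linarith)
  rw [add_sub_cancel, Real.div_rpow hq hp.le, div_le_iff₀ (by positivity)] at hx
  have hpa : p ^ (1 - a) = p ^ (-a) * p := by
    rw [sub_eq_neg_add, Real.rpow_add hp, Real.rpow_one]
  have h1 : ((p + q) / 2) ^ (-a) ≤ 2 * p ^ (-a) := by
    calc ((p + q) / 2) ^ (-a) ≤ (p / 2) ^ (-a) :=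
          Real.rpow_le_rpow_of_nonpos (by positivity) (by linarith) (by linarith)
      _ = (2 : ℝ) ^ a * p ^ (-a) := by
          rw [Real.div_rpow hp.le (by norm_num), Real.rpow_neg (by norm_num : (0 : ℝ) ≤ 2),
            div_inv_eq_mul, mul_comm]
      _ ≤ 2 * p ^ (-a) := by
          gcongr
          calc (2 : ℝ) ^ a ≤ 2 ^ (1 : ℝ) :=
                Real.rpow_le_rpow_of_exponent_le (by norm_num) ha₁.le
            _ = 2 := Real.rpow_one 2
  have h2 : (1 - a) * (p ^ (-a) * (p - q)) ≤ p ^ (1 - a) - q ^ (1 - a) := by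
    have : (1 + (1 - a) * (q / p - 1)) * p ^ (1 - a) =
        p ^ (1 - a) - (1 - a) * (p ^ (-a) * (p - q)) := by
      rw [hpa]; field_simp; ring
    linarith
  calc ((p + q) / 2) ^ (-a) * (p - q) ≤ 2 * p ^ (-a) * (p - q) := by
        have : 0 ≤ p - q := by linarith
        gcongr
    _ = 2 / (1 - a) * ((1 - a) * (p ^ (-a) * (p - q))) := by field_simp
    _ ≤ _ := by gcongr

lemma IsForcing.congr_exp {S : ℝ → X →L[ℝ] X} {E : BanachSubspace X} {α γ l P : ℝ} {φ : ℝ → X}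
    (hl : 0 ≤ l) (hP : 0 ≤ P) (hφ : IsForcing S E α γ l P φ) :
    IsForcing S E α γ 0 (P * Real.exp l) φ := by
  have hexp : ∀ s : ℝ, s ≤ 1 → Real.exp (l * s) ≤ Real.exp l := fun s hs =>
    Real.exp_le_exp.2 (mul_le_of_le_one_right hl hs)
  refine ⟨fun s hs hs1 => (hφ.1 s hs hs1).mono ?_, fun s t hs hst ht => (hφ.2 s t hs hst ht).trans ?_⟩
  · rw [zero_mul, Real.exp_zero, mul_one]
    have := hexp s hs1
    gcongr
  · rw [zero_mul, Real.exp_zero, mul_one]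
    have := hexp t ht
    have : 0 ≤ t - s := by linarith
    gcongr

variable {A : X →ₗ.[ℝ] X} {S : ℝ → X →L[ℝ] X} {V : ℝ → BanachSubspace X} {x : ℝ → ℝ}
  {H η α : ℝ}

lemma isCocycle_hatDelta₁ (hS : SemigroupScale A S V) (z : ℝ → X) :
    IsCocycle S (hatDelta₁ S z) := by
  intro r s t _ hrs hst _
  simp only [hatDelta₁, map_sub]
  rw [hS.sub_apply hrs hst]
  abel

/-- The increments of r ↦ S(t-r)φ(r) involve φ only through δ̂₁φ, so Young integration needs no
Hölder continuity of φ itself. -/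
lemma orbit_sub (hS : SemigroupScale A S V) (φ : ℝ → X) {u v t : ℝ} (huv : u ≤ v) (hvt : v ≤ t) :
    S (t - v) (φ v) - S (t - u) (φ u) = S (t - v) (hatDelta₁ S φ u v) := by
  rw [hatDelta₁, map_sub, hS.sub_apply huv hvt]

/-- Smoothing estimate for the remainder of the convolution integral. -/
lemma exists_bd_remainder (hS : SemigroupScale A S V) (hη : 0 < η) (hα : 0 < α)
    (hηα : 1 < η + α) (hH : 0 ≤ H)
    (hx : ∀ u v, 0 ≤ u → u ≤ v → v ≤ 1 → |x v - x u| ≤ H * (v - u) ^ η)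
    {e κ : ℝ} (he : 0 ≤ e) (hκ : 0 ≤ κ) (heκ : e + κ < 1) :
    ∃ C, 0 ≤ C ∧ ∀ (E : BanachSubspace X) (γ l w P : ℝ) (φ : ℝ → X), 0 ≤ γ → 0 ≤ w → 0 ≤ P →
      (∀ u, 0 < u → u ≤ 1 → Real.exp (-(l * u)) ≤ w * u ^ (-κ)) → IsForcing S E α γ l P φ →
      ∀ (s t : ℝ) (j : X), 0 < s → s ≤ t → t ≤ 1 →
      Tendsto (fun n => dyadicSum x (fun r => S (t - r) (φ r)) n s t) atTop (𝓝 j) →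
      (V e).Bd (j - (x t - x s) • S (t - s) (φ s))
        (C * w * P * Real.exp (l * t) * s ^ (-γ) * (t - s) ^ (η + α - e - κ)) := by
  obtain ⟨L, hL, hsm⟩ := hS.bd_smoothing le_rfl he (by linarith)
  obtain ⟨K, hK, hemb⟩ := hS.norm_le_of_bd he (by linarith)
  have hq₀ : (0 : ℝ) ≤ (1 / 2) ^ (η + α - 1) := by positivity
  have hq₁ : (1 / 2 : ℝ) ^ (η + α - 1) < 1 :=
    Real.rpow_lt_one (by norm_num) (by norm_num) (by linarith)
  have hq₂ : 0 < 1 - (1 / 2 : ℝ) ^ (η + α - 1) := by linarith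
  have hek : 0 < 1 - (e + κ) := by linarith
  refine ⟨H * L * (2 / (1 - (e + κ))) / (1 - (1 / 2) ^ (η + α - 1)), by positivity,
    fun E γ l w P φ hγ hw hP hexp hφ s t j hs hst ht hj => ?_⟩
  set G := H * L * (2 / (1 - (e + κ))) * w * P * Real.exp (l * t) * s ^ (-γ) with hG
  -- Smoothing from X to X_e costs (t-m)^(-e) at the midpoint m, and replacing exp(lm) by exp(lt)
  -- costs w(t-m)^(-κ). As e+κ < 1, the product with v-u is controlled by an increment of
  -- -(t-·)^(1-(e+κ)), which serves as Ψ.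
  have step : ∀ u v, s ≤ u → u ≤ v → v ≤ t → (V e).Bd ((x v - x ((u + v) / 2)) •
      (S (t - (u + v) / 2) (φ ((u + v) / 2)) - S (t - u) (φ u)))
      (G * (v - u) ^ (η + α - 1) *
        (-(t - v) ^ (1 - (e + κ)) - -(t - u) ^ (1 - (e + κ)))) := by
    intro u v hsu huv hvt
    rcases huv.eq_or_lt with rfl | huv
    · have hb : 0 ≤ G * (u - u) ^ (η + α - 1) *
        (-(t - u) ^ (1 - (e + κ)) - -(t - u) ^ (1 - (e + κ))) := by simp
      have h0 : (u + u) / 2 = u := by ring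
      rw [h0, sub_self (x u), zero_smul]
      exact (V e).bd_zero hb
    · set m := (u + v) / 2 with hm
      have hum : u < m := by rw [hm]; linarith
      have hmv : m < v := by rw [hm]; linarith
      have hu0 : 0 < u := by linarith
      have htm : 0 < t - m := by linarith
      have hvu : 0 < v - u := by linarith
      rw [orbit_sub hS φ hum.le (by linarith)]
      have h1 := hφ.2 u m hu0 hum.le (by linarith)
      have h2 : ‖hatDelta₁ S φ u m‖ ≤
          P * (Real.exp (l * t) * (w * (t - m) ^ (-κ))) * s ^ (-γ) * (v - u) ^ α := by
        refine h1.trans ?_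
        have h3 : Real.exp (l * m) ≤ Real.exp (l * t) * (w * (t - m) ^ (-κ)) := by
          have := hexp (t - m) htm (by linarith)
          calc Real.exp (l * m) = Real.exp (l * t) * Real.exp (-(l * (t - m))) := by
                rw [← Real.exp_add]; ring_nf
            _ ≤ _ := by gcongr
        have h4 : u ^ (-γ) ≤ s ^ (-γ) :=
          Real.rpow_le_rpow_of_nonpos hs hsu (by linarith)
        have h5 : (m - u) ^ α ≤ (v - u) ^ α :=
          Real.rpow_le_rpow (by linarith) (by linarith) hα.le
        have : 0 ≤ (m - u) ^ α := Real.rpow_nonneg (by linarith) _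
        gcongr
      have h6 := hsm (t - m) _ _ htm (by linarith) (hS.bd_zero_iff.2 h2)
      have h7 : |x v - x m| ≤ H * (v - u) ^ η := by
        refine (hx m v (by linarith) hmv.le (by linarith)).trans ?_
        have : (v - m) ^ η ≤ (v - u) ^ η :=
          Real.rpow_le_rpow (by linarith) (by linarith) hη.le
        gcongr
      refine (h6.smul_le h7).mono ?_
      have h8 := midpoint_rpow_mul_le (a := e + κ) (p := t - u) (q := t - v) (by linarith) heκ
        (by linarith) (by linarith)
      have h9 : (t - u + (t - v)) / 2 = t - m := by rw [hm]; ring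
      have h10 : t - u - (t - v) = v - u := by ring
      rw [h9, h10] at h8
      have h11 : (t - m) ^ (-(e + κ)) = (t - m) ^ (-e) * (t - m) ^ (-κ) := by
        rw [← Real.rpow_add htm]; ring_nf
      have h12 : (v - u) ^ (η + α - 1) * (v - u) = (v - u) ^ η * (v - u) ^ α := by
        rw [← Real.rpow_add hvu, ← Real.rpow_add_one hvu.ne']; ring_nf
      calc H * (v - u) ^ η * (L * (t - m) ^ (-e + 0) *
            (P * (Real.exp (l * t) * (w * (t - m) ^ (-κ))) * s ^ (-γ) * (v - u) ^ α))
          = H * L * w * P * Real.exp (l * t) * s ^ (-γ) *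
            ((v - u) ^ η * (v - u) ^ α) * ((t - m) ^ (-e) * (t - m) ^ (-κ)) := by
              rw [add_zero]; ring
        _ = H * L * w * P * Real.exp (l * t) * s ^ (-γ) * (v - u) ^ (η + α - 1) *
            ((t - m) ^ (-(e + κ)) * (v - u)) := by rw [← h12, h11]; ring
        _ ≤ H * L * w * P * Real.exp (l * t) * s ^ (-γ) * (v - u) ^ (η + α - 1) *
            (2 / (1 - (e + κ)) * ((t - u) ^ (1 - (e + κ)) - (t - v) ^ (1 - (e + κ)))) := by
              gcongr
        _ = _ := by rw [hG]; ring
  have hinc := fun n => bd_dyadicSum_succ_sub (E := V e) (x := x)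
    (h := fun r => S (t - r) (φ r)) (Ψ := fun z => -(t - z) ^ (1 - (e + κ))) step n s t le_rfl hst
    le_rfl
  -- Level 0 of the dyadic sums is the germ itself, so the tail bound from level 0 estimates the
  -- remainder.
  have hfin := BanachSubspace.bd_of_tendsto_geometric hemb hq₀ hq₁ hinc hj 0
  simp only [dyadicSum] at hfin
  refine hfin.mono (le_of_eq ?_)
  have h13 : (t - s) ^ (η + α - 1) * (t - s) ^ (1 - (e + κ)) = (t - s) ^ (η + α - e - κ) := by
    rw [← Real.rpow_add_of_nonneg (by linarith) (by linarith) hek.le]; ring_nf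
  rw [sub_self t, Real.zero_rpow hek.ne', ← h13, hG]
  field_simp
  ring

/-- A bound for a cocycle on intervals `[s, t]` with `t ≤ 2 s` extends to all intervals. -/
lemma exists_bd_of_bd_near_diagonal (hS : SemigroupScale A S V) {m q : ℝ} (hm₀ : 0 ≤ m)
    (hm : m < 2) (hq : 0 < q) :
    ∃ C, 0 ≤ C ∧ ∀ (F : ℝ → ℝ → X) (l B : ℝ), 0 ≤ l → 0 ≤ B → IsCocycle S F →
      (∀ s t, 0 < s → s ≤ t → t ≤ 1 → t ≤ 2 * s →
        (V m).Bd (F s t) (B * Real.exp (l * t) * (t - s) ^ q)) →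
      ∀ s t, 0 < s → s ≤ t → t ≤ 1 → (V m).Bd (F s t) (C * B * Real.exp (l * t) * (t - s) ^ q) := by
  obtain ⟨L, hL, hb⟩ := hS.bd_apply hm₀ hm
  have hp₀ : 0 < (1 / 2 : ℝ) ^ q := by positivity
  have hp₁ : (1 / 2 : ℝ) ^ q < 1 := Real.rpow_lt_one (by norm_num) (by norm_num) hq
  set p := (1 / 2 : ℝ) ^ q with hp
  have h1p : 0 < 1 - p := by linarith
  set C₁ := L / (1 - p) with hC₁
  have hLC : L ≤ C₁ := by
    rw [hC₁, le_div_iff₀ h1p]; nlinarith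
  have hC0 : 0 ≤ C₁ := by linarith
  have h2q : (1 : ℝ) ≤ 2 ^ q := Real.one_le_rpow (by norm_num) hq.le
  refine ⟨C₁ * 2 ^ q, by positivity, fun F l B hl hB hF hbase => ?_⟩
  -- F(s,t) = F(t/2,t) + S(t/2)F(s,t/2). Bounding S(r)F for all r at once prevents the constant L
  -- from being multiplied at every halving. The choice C₁ = L/(1-p) closes the induction through
  -- (L+C₁)p ≤ C₁, with no dependence on k.
  have key : ∀ k : ℕ, ∀ s t r, 0 < s → s ≤ t → t ≤ 2 ^ k * s → 0 ≤ r → r + t ≤ 1 →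
      (V m).Bd (S r (F s t)) (C₁ * B * Real.exp (l * t) * t ^ q) := by
    have near : ∀ s t r, 0 < s → s ≤ t → t ≤ 2 * s → 0 ≤ r → r + t ≤ 1 →
        (V m).Bd (S r (F s t)) (L * (B * Real.exp (l * t) * (t - s) ^ q)) := fun s t r hs hst hts hr hrt =>
      hb r _ _ hr (by linarith) (hbase s t hs hst (by linarith) hts)
    have near' : ∀ s t r, 0 < s → s ≤ t → t ≤ 2 * s → 0 ≤ r → r + t ≤ 1 →
        (V m).Bd (S r (F s t)) (C₁ * B * Real.exp (l * t) * t ^ q) := by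
      intro s t r hs hst hts hr hrt
      refine (near s t r hs hst hts hr hrt).mono ?_
      have : (t - s) ^ q ≤ t ^ q := Real.rpow_le_rpow (by linarith) (by linarith) hq.le
      have h0 : 0 ≤ t ^ q := Real.rpow_nonneg (by linarith) q
      calc L * (B * Real.exp (l * t) * (t - s) ^ q) ≤ C₁ * (B * Real.exp (l * t) * t ^ q) := by
            gcongr
        _ = _ := by ring
    intro k
    induction k with
    | zero =>
      intro s t r hs hst hts
      exact near' s t r hs hst (by rw [pow_zero] at hts; linarith)
    | succ k ih =>
      intro s t r hs hst hts hr hrt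
      rcases le_total t (2 * s) with h | h
      · exact near' s t r hs hst h hr hrt
      have e : S r (F s t) = S r (F (t / 2) t) + S (r + t / 2) (F s (t / 2)) := by
        rw [hF s (t / 2) t hs (by linarith) (by linarith) (by linarith), map_add,
          hS.add_apply hr (by linarith)]
        congr 4
        ring
      rw [e]
      have h1 := near (t / 2) t r (by linarith) (by linarith) (by linarith) hr hrt
      have h2 := ih s (t / 2) (r + t / 2) hs (by linarith) (by rw [pow_succ] at hts; linarith)
        (by linarith) (by linarith)
      refine (h1.add h2).mono ?_
      have h3 : t - t / 2 = t * (1 / 2) := by ring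
      have h4 : t / 2 = t * (1 / 2) := by ring
      have h5 : Real.exp (l * (t * (1 / 2))) ≤ Real.exp (l * t) := by
        refine Real.exp_le_exp.2 ?_
        have : 0 ≤ l * t := mul_nonneg hl (by linarith)
        linarith
      rw [h3, h4, Real.mul_rpow (by linarith) (by norm_num), ← hp]
      have h6 : (L + C₁) * p = C₁ - (1 - p) * C₁ + L * p := by ring
      have h7 : (1 - p) * C₁ = L := by rw [hC₁]; field_simp
      have h8 : (L + C₁) * p ≤ C₁ := by rw [h6, h7]; nlinarith
      have h0 : 0 ≤ t ^ q := Real.rpow_nonneg (by linarith) q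
      calc L * (B * Real.exp (l * t) * (t ^ q * p)) +
            C₁ * B * Real.exp (l * (t * (1 / 2))) * (t ^ q * p)
          ≤ L * (B * Real.exp (l * t) * (t ^ q * p)) + C₁ * B * Real.exp (l * t) * (t ^ q * p) := by
            gcongr
        _ = (L + C₁) * p * (B * Real.exp (l * t) * t ^ q) := by ring
        _ ≤ C₁ * (B * Real.exp (l * t) * t ^ q) := by gcongr
        _ = _ := by ring
  intro s t hs hst ht
  have hpow : 0 ≤ (t - s) ^ q := Real.rpow_nonneg (by linarith) q
  rcases le_total t (2 * s) with h | h
  · refine (hbase s t hs hst ht h).mono ?_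
    have : 1 ≤ C₁ * 2 ^ q := one_le_mul_of_one_le_of_one_le (by linarith) h2q
    calc B * Real.exp (l * t) * (t - s) ^ q = 1 * (B * Real.exp (l * t) * (t - s) ^ q) := by ring
      _ ≤ C₁ * 2 ^ q * (B * Real.exp (l * t) * (t - s) ^ q) := by gcongr
      _ = _ := by ring
  · obtain ⟨k, hk⟩ := pow_unbounded_of_one_lt (t / s) (by norm_num : (1 : ℝ) < 2)
    rw [div_lt_iff₀ hs] at hk
    have := key k s t 0 hs hst hk.le le_rfl (by linarith)
    rw [hS.zero_apply] at this
    refine this.mono ?_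
    have h1 : t ^ q ≤ 2 ^ q * (t - s) ^ q := by
      rw [← Real.mul_rpow (by norm_num) (by linarith)]
      exact Real.rpow_le_rpow (by linarith) (by linarith) hq.le
    calc C₁ * B * Real.exp (l * t) * t ^ q ≤ C₁ * B * Real.exp (l * t) * (2 ^ q * (t - s) ^ q) := by
          gcongr
      _ = _ := by ring

/-- Bound of the convolution integral in `X_α`. -/
lemma exists_bd_convolution (hS : SemigroupScale A S V) (hη : 0 < η) (hα : 0 < α)
    (hηα : 1 < η + α) (hH : 0 ≤ H)
    (hx : ∀ u v, 0 ≤ u → u ≤ v → v ≤ 1 → |x v - x u| ≤ H * (v - u) ^ η)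
    {γ κ : ℝ} (hγ : 0 ≤ γ) (hκ : 0 ≤ κ) (hακ : α + κ < 1) (hγκ : α + γ + κ ≤ η) :
    ∃ C, 0 ≤ C ∧ ∀ (l w P : ℝ) (φ : ℝ → X) (J : ℝ → ℝ → X), 0 ≤ l → 0 ≤ w → 0 ≤ P →
      (∀ u, 0 < u → u ≤ 1 → Real.exp (-(l * u)) ≤ w * u ^ (-κ)) → IsForcing S (V α) α γ l P φ →
      IsCocycle S J → (∀ s t, 0 < s → s ≤ t → t ≤ 1 →
        Tendsto (fun n => dyadicSum x (fun r => S (t - r) (φ r)) n s t) atTop (𝓝 (J s t))) →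
      ∀ s t, 0 < s → s ≤ t → t ≤ 1 →
        (V α).Bd (J s t) (C * w * P * Real.exp (l * t) * (t - s) ^ α) := by
  obtain ⟨C₁, hC₁, hrem⟩ := exists_bd_remainder hS hη hα hηα hH hx hα.le hκ hακ
  obtain ⟨C₂, hC₂, hdiag⟩ := exists_bd_of_bd_near_diagonal hS hα.le (by linarith : α < 2) hα
  obtain ⟨L, hL, hb⟩ := hS.bd_apply hα.le (by linarith : α < 2)
  refine ⟨C₂ * (C₁ + H * L), by positivity, fun l w P φ J hl hw hP hexp hφ hJ hlim => ?_⟩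
  have := hdiag J l ((C₁ + H * L) * w * P) hl (by positivity) hJ (fun s t hs hst ht hts => ?_)
  · intro s t hs hst ht
    refine (this s t hs hst ht).mono (le_of_eq (by ring))
  rcases hst.eq_or_lt with rfl | hst'
  · have h0 : J s s = 0 := by
      have := hJ s s s hs le_rfl le_rfl ht
      rw [sub_self, hS.zero_apply] at this
      exact (add_eq_left.1 this.symm)
    rw [h0]
    exact (V α).bd_zero (by simp [Real.zero_rpow hα.ne'])
  have hts0 : 0 < t - s := by linarith
  have h1 := hrem (V α) γ l w P φ hγ hw hP hexp hφ s t (J s t) hs hst ht (hlim s t hs hst ht)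
  have h2 := (hb (t - s) _ _ (by linarith) (by linarith) (hφ.1 s hs (by linarith))).smul_le
    (hx s t hs.le hst ht)
  have h3 := h1.add h2
  rw [sub_add_cancel] at h3
  refine h3.mono ?_
  have h4 : Real.exp (l * s) ≤ Real.exp (l * t) * (w * (t - s) ^ (-κ)) := by
    have := hexp (t - s) hts0 (by linarith)
    calc Real.exp (l * s) = Real.exp (l * t) * Real.exp (-(l * (t - s))) := by
          rw [← Real.exp_add]; ring_nf
      _ ≤ _ := by gcongr
  -- Here t ≤ 2s means t-s ≤ s. This is where the singularity at 0 is traded for a power of t-s, and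
  -- η-κ-γ ≥ α leaves the required exponent.
  have h5 : s ^ (-γ) ≤ (t - s) ^ (-γ) :=
    Real.rpow_le_rpow_of_nonpos hts0 (by linarith) (by linarith)
  have h6 : s ^ (-γ) * (t - s) ^ (η - κ) ≤ (t - s) ^ α := by
    calc s ^ (-γ) * (t - s) ^ (η - κ) ≤ (t - s) ^ (-γ) * (t - s) ^ (η - κ) := by gcongr
      _ = (t - s) ^ (-γ + (η - κ)) := by rw [Real.rpow_add hts0]
      _ ≤ (t - s) ^ α := Real.rpow_le_rpow_of_exponent_ge hts0 (by linarith) (by linarith)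
  have h7 : (t - s) ^ η * (t - s) ^ (-κ) = (t - s) ^ (η - κ) := by
    rw [← Real.rpow_add hts0]; ring_nf
  have h8 : η + α - α - κ = η - κ := by ring
  rw [h8]
  calc C₁ * w * P * Real.exp (l * t) * s ^ (-γ) * (t - s) ^ (η - κ) +
        H * (t - s) ^ η * (L * (P * Real.exp (l * s) * s ^ (-γ)))
      ≤ C₁ * w * P * Real.exp (l * t) * s ^ (-γ) * (t - s) ^ (η - κ) +
        H * (t - s) ^ η * (L * (P * (Real.exp (l * t) * (w * (t - s) ^ (-κ))) * s ^ (-γ))) := by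
        gcongr
    _ = C₁ * w * P * Real.exp (l * t) * s ^ (-γ) * (t - s) ^ (η - κ) +
        H * L * w * P * Real.exp (l * t) * s ^ (-γ) * ((t - s) ^ η * (t - s) ^ (-κ)) := by ring
    _ = (C₁ + H * L) * w * P * Real.exp (l * t) * (s ^ (-γ) * (t - s) ^ (η - κ)) := by
        rw [h7]; ring
    _ ≤ (C₁ + H * L) * w * P * Real.exp (l * t) * (t - s) ^ α := by gcongr

lemma hatDelta₁_zero_left {z : ℝ → X} (h0 : z 0 = 0) (t : ℝ) : hatDelta₁ S z 0 t = z t := by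
  simp [hatDelta₁, h0]

/-- The convolution integral depends on its integrand with a constant which is small in the
norms with exponential weight. -/
lemma exists_incrBd_of_solvesConv (hS : SemigroupScale A S V) (hη : 0 < η) (hα : 0 < α)
    (hηα : 1 < η + α) (hH : 0 ≤ H)
    (hx : ∀ u v, 0 ≤ u → u ≤ v → v ≤ 1 → |x v - x u| ≤ H * (v - u) ^ η)
    {γ κ : ℝ} (hγ : 0 ≤ γ) (hκ : 0 ≤ κ) (hακ : α + κ < 1) (hγκ : α + γ + κ ≤ η) :
    ∃ C, 0 ≤ C ∧ ∀ (l P R : ℝ) (φ z : ℝ → X), 0 < l → 0 ≤ P →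
      IsForcing S (V α) α γ l P φ → SolvesConv S x φ z → z 0 = 0 → IncrBd S (V α) α 0 R z →
      IncrBd S (V α) α l (C * P * l ^ (-κ)) z := by
  obtain ⟨C, hC, hconv⟩ := exists_bd_convolution hS hη hα hηα hH hx hγ hκ hακ hγκ
  obtain ⟨L, hL, hb⟩ := hS.bd_apply hα.le (by linarith : α < 2)
  refine ⟨C, hC, fun l P R φ z hl hP hφ hz hz0 hR => ?_⟩
  -- From y^κ ≤ 1+y ≤ exp(y) at y = lu; the weight constant w = l^(-κ) is the source of smallness.
  have hexp : ∀ u, 0 < u → u ≤ 1 → Real.exp (-(l * u)) ≤ l ^ (-κ) * u ^ (-κ) := by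
    intro u hu _
    rw [← Real.mul_rpow hl.le hu.le, Real.rpow_neg (by positivity), Real.exp_neg]
    have h0 : 0 < l * u := by positivity
    refine inv_anti₀ (by positivity) ?_
    calc (l * u) ^ κ ≤ (1 + l * u) ^ κ := by gcongr; linarith
      _ ≤ (1 + l * u) ^ (1 : ℝ) :=
          Real.rpow_le_rpow_of_exponent_le (by linarith) (by linarith)
      _ ≤ Real.exp (l * u) := by rw [Real.rpow_one]; linarith [Real.add_one_le_exp (l * u)]
  have hpos := hconv l (l ^ (-κ)) P φ (hatDelta₁ S z) hl.le (by positivity) hP hexp hφ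
    (isCocycle_hatDelta₁ hS z) hz
  have e : C * P * l ^ (-κ) = C * l ^ (-κ) * P := by ring
  rw [e]
  intro s t hs hst ht
  rcases hs.eq_or_lt with rfl | hs
  · rw [hatDelta₁_zero_left hz0]
    rcases hst.eq_or_lt with rfl | ht0
    · rw [hz0]; exact (V α).bd_zero (by positivity)
    -- The a priori constant R enters only through L·R·r^α, which vanishes as r → 0; it is needed to
    -- reach s = 0 but leaves no trace in the bound.
    have hle : ∀ r, 0 < r → r ≤ t → (V α).Bd (z t)
        (C * l ^ (-κ) * P * Real.exp (l * t) * (t - r) ^ α + L * (R * r ^ α)) := by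
      intro r hr hrt
      have h1 := hpos r t hr hrt ht
      have h2 := hR 0 r le_rfl hr.le (by linarith)
      rw [hatDelta₁_zero_left hz0, zero_mul, Real.exp_zero, mul_one, sub_zero] at h2
      have h3 := h1.add (hb (t - r) _ _ (by linarith) (by linarith) h2)
      rwa [hatDelta₁, sub_add_cancel] at h3
    refine ⟨(hle t ht0 le_rfl).1, ?_⟩
    have hlim : Tendsto (fun r => C * l ^ (-κ) * P * Real.exp (l * t) * (t - r) ^ α +
        L * (R * r ^ α)) (𝓝[>] 0)
        (𝓝 (C * l ^ (-κ) * P * Real.exp (l * t) * (t - 0) ^ α + L * (R * 0 ^ α))) := by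
      have hc : ContinuousAt (fun r => C * l ^ (-κ) * P * Real.exp (l * t) * (t - r) ^ α +
        L * (R * r ^ α)) 0 := by
        have h1 : ContinuousAt (fun r : ℝ => (t - r) ^ α) 0 :=
          (continuousAt_const.sub continuousAt_id).rpow_const (Or.inr hα.le)
        have h2 : ContinuousAt (fun r : ℝ => r ^ α) 0 :=
          continuousAt_id.rpow_const (Or.inr hα.le)
        fun_prop
      exact hc.tendsto.mono_left nhdsWithin_le_nhds
    rw [Real.zero_rpow hα.ne', mul_zero, mul_zero, add_zero] at hlim
    refine ge_of_tendsto hlim ?_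
    filter_upwards [Ioc_mem_nhdsGT ht0] with r hr
    exact (hle r hr.1 hr.2).2
  · exact hpos s t hs hst ht

/-- Existence of the convolution integral on `(0,1]`. -/
lemma exists_cocycle [CompleteSpace X] (hS : SemigroupScale A S V) (hη : 0 < η) (hα : 0 < α)
    (hηα : 1 < η + α) (hH : 0 ≤ H)
    (hx : ∀ u v, 0 ≤ u → u ≤ v → v ≤ 1 → |x v - x u| ≤ H * (v - u) ^ η)
    {γ P : ℝ} {E : BanachSubspace X} {φ : ℝ → X} (hγ : 0 ≤ γ) (hP : 0 ≤ P)
    (hφ : IsForcing S E α γ 0 P φ) :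
    ∃ J : ℝ → ℝ → X, IsCocycle S J ∧ ∀ s t, 0 < s → s ≤ t → t ≤ 1 →
      Tendsto (fun n => dyadicSum x (fun r => S (t - r) (φ r)) n s t) atTop (𝓝 (J s t)) := by
  obtain ⟨L, hL, hb⟩ := hS.norm_apply_le
  -- Away from 0 the weight s^(-γ) is bounded, so r ↦ S(t-r)φ(r) is α-Hölder in X and α+η > 1
  -- applies.
  have young : ∀ a t, 0 < a → a ≤ t → t ≤ 1 → ∃ I : ℝ → ℝ → X,
      (∀ r s t, r ≤ s → s ≤ t → I r t = I r s + I s t) ∧ ∀ u v, a ≤ u → u ≤ v → v ≤ t →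
        Tendsto (fun n => dyadicSum x (fun r => S (t - r) (φ r)) n u v) atTop (𝓝 (I u v)) := by
    intro a t ha hat ht
    refine exists_additive_of_holderOn (K := L * (P * a ^ (-γ))) hat hα hη (by linarith)
      (by positivity) hH ?_ (fun u v hu huv hv => hx u v (by linarith) huv (by linarith))
    intro u v hu huv hv
    rw [orbit_sub hS φ huv hv]
    refine (hb _ _ (by linarith) (by linarith)).trans ?_
    have h1 := hφ.2 u v (by linarith) huv (by linarith)
    rw [zero_mul, Real.exp_zero, mul_one] at h1
    have h2 : u ^ (-γ) ≤ a ^ (-γ) := Real.rpow_le_rpow_of_nonpos ha hu (by linarith)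
    have h3 : 0 ≤ (v - u) ^ α := Real.rpow_nonneg (by linarith) α
    calc L * ‖hatDelta₁ S φ u v‖ ≤ L * (P * u ^ (-γ) * (v - u) ^ α) := by gcongr
      _ ≤ L * (P * a ^ (-γ) * (v - u) ^ α) := by gcongr
      _ = _ := by ring
  have hlim : ∀ s t, ∃ j : X, 0 < s → s ≤ t → t ≤ 1 →
      Tendsto (fun n => dyadicSum x (fun r => S (t - r) (φ r)) n s t) atTop (𝓝 j) := by
    intro s t
    by_cases hc : 0 < s ∧ s ≤ t ∧ t ≤ 1
    · obtain ⟨I, -, hI⟩ := young s t hc.1 hc.2.1 hc.2.2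
      exact ⟨I s t, fun _ _ _ => hI s t le_rfl hc.2.1 le_rfl⟩
    · exact ⟨0, fun h1 h2 h3 => absurd ⟨h1, h2, h3⟩ hc⟩
  choose J hJ using hlim
  refine ⟨J, ?_, hJ⟩
  intro r s t hr hrs hst ht
  obtain ⟨I, hadd, hI⟩ := young r t hr (hrs.trans hst) ht
  have h1 := tendsto_nhds_unique (hI r t le_rfl (hrs.trans hst) le_rfl)
    (hJ r t hr (hrs.trans hst) ht)
  have h2 := tendsto_nhds_unique (hI s t hrs hst le_rfl) (hJ s t (by linarith) hst ht)
  -- On [r,s] the dyadic sums with terminal time t are S(t-s) applied to those with terminal time s;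
  -- this turns additivity into the cocycle relation.
  have h3 : I r s = S (t - s) (J r s) := by
    refine tendsto_nhds_unique (hI r s le_rfl hrs hst) ?_
    refine (((S (t - s)).continuous.tendsto _).comp (hJ r s hr hrs (by linarith))).congr fun n => ?_
    refine (dyadicSum_map (S (t - s)) (fun u hu => ?_) n r s le_rfl hrs le_rfl).symm
    exact (hS.sub_apply hu.2 hst _).symm
  rw [← h1, ← h2, ← h3, hadd r s t hrs hst, add_comm]

/-- A cocycle on `0 < s ≤ t ≤ 1` with a Hölder bound is of the form `δ̂₁ z`, `z 0 = 0`. -/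
lemma exists_hatDelta₁_eq (hS : SemigroupScale A S V) {m q B : ℝ} (hm₀ : 0 ≤ m) (hm : m < 2)
    (hq : 0 < q) {J : ℝ → ℝ → X} (hJ : IsCocycle S J)
    (hB : ∀ s t, 0 < s → s ≤ t → t ≤ 1 → (V m).Bd (J s t) (B * (t - s) ^ q)) :
    ∃ z : ℝ → X, z 0 = 0 ∧ (∀ s t, 0 < s → s ≤ t → t ≤ 1 → hatDelta₁ S z s t = J s t) ∧
      ∃ R, IncrBd S (V m) q 0 R z := by
  obtain ⟨L, hL, hb⟩ := hS.bd_apply hm₀ hm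
  obtain ⟨K, hK, hemb⟩ := hS.norm_le_of_bd hm₀ hm
  have hB0 : 0 ≤ B := by
    have := (hB (1 / 2) 1 (by norm_num) (by norm_num) le_rfl).nonneg
    have h2 : (0 : ℝ) < (1 - 1 / 2) ^ q := Real.rpow_pos_of_pos (by norm_num) q
    exact nonneg_of_mul_nonneg_left this h2
  set ρ : ℕ → ℝ := fun n => (1 / 2 : ℝ) ^ n with hρ
  have hρpos : ∀ n, 0 < ρ n := fun n => by positivity
  have hρle : ∀ n, ρ n ≤ 1 := fun n => pow_le_one₀ (by norm_num) (by norm_num)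
  have hρanti : ∀ m n, m ≤ n → ρ n ≤ ρ m := fun m n hmn =>
    pow_le_pow_of_le_one (by norm_num) (by norm_num) hmn
  have hρlim : Tendsto ρ atTop (𝓝 0) :=
    tendsto_pow_atTop_nhds_zero_of_lt_one (by norm_num) (by norm_num)
  have hρq : Tendsto (fun n => ρ n ^ q) atTop (𝓝 0) := by
    have := hρlim.rpow_const (p := q) (Or.inr hq.le)
    rwa [Real.zero_rpow hq.ne'] at this
  -- The candidate for z(t) is the limit of J(s,t) along s = 2^(-n)t; consecutive differences are S
  -- applied to J on short intervals near 0, of size (2^(-n)t)^q.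
  have hlim : ∀ t, ∃ v : X, 0 < t → t ≤ 1 →
      ∀ n, (V m).Bd (v - J (ρ n * t) t) (L * B * (ρ n * t) ^ q) := by
    intro t
    by_cases hc : 0 < t ∧ t ≤ 1
    · obtain ⟨ht, ht1⟩ := hc
      have hb0 : Tendsto (fun n => L * B * (ρ n * t) ^ q) atTop (𝓝 0) := by
        have := (hρq.mul_const (t ^ q)).const_mul (L * B)
        rw [zero_mul, mul_zero] at this
        exact this.congr fun n => by rw [Real.mul_rpow (hρpos n).le ht.le]
      obtain ⟨v, hv⟩ := (V m).exists_limit (w := fun n => J (ρ n * t) t) hb0 (by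
        intro k n hkn
        have h1 : ρ n * t ≤ ρ k * t := by gcongr; exact hρanti k n hkn
        have h2 : ρ k * t ≤ t := mul_le_of_le_one_left ht.le (hρle k)
        have h3 : 0 < ρ n * t := mul_pos (hρpos n) ht
        rw [hJ _ _ t h3 h1 h2 ht1, add_sub_cancel_left]
        refine (hb _ _ _ (by linarith) (by linarith) (hB _ _ h3 h1 (by linarith))).mono ?_
        rw [mul_assoc]
        have : (ρ k * t - ρ n * t) ^ q ≤ (ρ k * t) ^ q :=
          Real.rpow_le_rpow (by linarith) (by linarith) hq.le
        gcongr)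
      exact ⟨v, fun _ _ => hv⟩
    · exact ⟨0, fun h1 h2 => absurd ⟨h1, h2⟩ hc⟩
  choose z₀ hz₀ using hlim
  set z : ℝ → X := fun t => if 0 < t then z₀ t else 0 with hz
  have hzt : ∀ t, 0 < t → t ≤ 1 → ∀ n,
      (V m).Bd (z t - J (ρ n * t) t) (L * B * (ρ n * t) ^ q) := by
    intro t ht ht1
    rw [hz]; simp only [if_pos ht]
    exact hz₀ t ht ht1
  have hzt' : ∀ t, 0 < t → t ≤ 1 → ∀ n, (V m).Bd (z t - J (ρ n * t) t) (L * B * ρ n ^ q) := by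
    intro t ht ht1 n
    refine (hzt t ht ht1 n).mono ?_
    have h4 : ρ n * t ≤ ρ n := mul_le_of_le_one_right (hρpos n).le ht1
    have h5 : 0 ≤ ρ n * t := mul_nonneg (hρpos n).le ht.le
    gcongr
  have hz0 : z 0 = 0 := by simp [hz]
  have hδ : ∀ s t, 0 < s → s ≤ t → t ≤ 1 → hatDelta₁ S z s t = J s t := by
    intro s t hs hst ht
    -- Compares two expansions of J(ρₙs,t), one through ρₙt and one through s.
    have key : ∀ n, (V m).Bd (hatDelta₁ S z s t - J s t)
        (L * B * ρ n ^ q + L * (L * B * ρ n ^ q) + L * (B * ρ n ^ q)) := by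
      intro n
      have hpos : 0 < ρ n * s := mul_pos (hρpos n) hs
      have h0 : ρ n * s ≤ s := mul_le_of_le_one_left hs.le (hρle n)
      have h1 : ρ n * s ≤ ρ n * t := by have := hρpos n; gcongr
      have h2 : ρ n * t ≤ t := mul_le_of_le_one_left (by linarith) (hρle n)
      have h3 := hzt' t (by linarith) ht n
      have h4 := hb (t - s) _ _ (by linarith) (by linarith) (hzt' s hs (by linarith) n)
      have h5 := hb (t - ρ n * t) _ _ (by linarith) (by linarith)
        (hB (ρ n * s) (ρ n * t) hpos h1 (by linarith))
      have h5' : (V m).Bd (S (t - ρ n * t) (J (ρ n * s) (ρ n * t))) (L * (B * ρ n ^ q)) := by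
        refine h5.mono ?_
        have h6 : ρ n * t ≤ ρ n := mul_le_of_le_one_right (hρpos n).le ht
        have : (ρ n * t - ρ n * s) ^ q ≤ ρ n ^ q :=
          Real.rpow_le_rpow (by linarith) (by linarith) hq.le
        gcongr
      have e := (h3.sub h4).sub h5'
      convert e using 1
      have c1 := hJ _ _ t hpos h1 h2 ht
      have c2 := hJ _ s t hpos h0 hst ht
      rw [c1] at c2
      have c3 : J (ρ n * t) t = J s t + S (t - s) (J (ρ n * s) s) -
        S (t - ρ n * t) (J (ρ n * s) (ρ n * t)) := eq_sub_of_add_eq c2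
      rw [hatDelta₁, map_sub, c3]
      abel
    have hl : Tendsto (fun n => K * (L * B * ρ n ^ q + L * (L * B * ρ n ^ q) + L * (B * ρ n ^ q)))
        atTop (𝓝 0) := by
      have := (((hρq.const_mul (L * B)).add ((hρq.const_mul (L * B)).const_mul L)).add
        ((hρq.const_mul B).const_mul L)).const_mul K
      simpa using this
    have := ge_of_tendsto' hl (fun n => hemb _ _ (key n))
    rw [norm_le_zero_iff, sub_eq_zero] at this
    exact this
  refine ⟨z, hz0, hδ, (B + L * B), ?_⟩
  intro s t hs hst ht
  rw [zero_mul, Real.exp_zero, mul_one]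
  have hLB : 0 ≤ L * B := by positivity
  have hpow : 0 ≤ (t - s) ^ q := Real.rpow_nonneg (by linarith) q
  rcases hs.eq_or_lt with rfl | hs
  · rw [hatDelta₁_zero_left hz0, sub_zero]
    rcases hst.eq_or_lt with rfl | ht0
    · rw [hz0]; exact (V m).bd_zero (by positivity)
    have h1 := hzt t ht0 ht 0
    have h2 := hB t t ht0 le_rfl ht
    rw [sub_self, Real.zero_rpow hq.ne', mul_zero] at h2
    simp only [hρ, pow_zero, one_mul] at h1
    have h3 := h1.add h2
    rw [sub_add_cancel] at h3
    rw [sub_zero] at hpow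
    exact h3.mono (by nlinarith [mul_nonneg hB0 hpow])
  · rw [hδ s t hs hst ht]
    exact (hB s t hs hst ht).mono (by gcongr; linarith)

end Convolution

/-! ### Increments of the nonlinearity in X -/

section Nonlinearity

variable {X : Type*} [NormedAddCommGroup X] [NormedSpace ℝ X] {σ : X → X} {σ' : X → X →L[ℝ] X}

/-- Gateaux differentiability provides derivatives along lines, which is all that the mean value
inequality on a segment uses. -/
lemma hasDerivAt_comp_line (hσ : ∀ u h : X, HasLineDerivAt ℝ σ (σ' u h) u h) (a h : X) (t : ℝ) :
    HasDerivAt (fun r : ℝ => σ (a + r • h)) (σ' (a + t • h) h) t := by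
  have h1 : HasDerivAt (fun r : ℝ => σ (a + t • h + r • h)) (σ' (a + t • h) h) (t - t) := by
    rw [sub_self]; exact hσ (a + t • h) h
  have h2 := HasDerivAt.comp_sub_const t t h1
  refine h2.congr_of_eventuallyEq (Eventually.of_forall fun r => ?_)
  simp only
  congr 1
  module

lemma norm_sub_le_of_lineDeriv (hσ : ∀ u h : X, HasLineDerivAt ℝ σ (σ' u h) u h) {K : ℝ}
    (hK : ∀ u, ‖σ' u‖ ≤ K) (a b : X) : ‖σ b - σ a‖ ≤ K * ‖b - a‖ := by
  have := norm_image_sub_le_of_norm_deriv_le_segment_01' (f := fun r : ℝ => σ (a + r • (b - a)))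
    (f' := fun r => σ' (a + r • (b - a)) (b - a)) (C := K * ‖b - a‖)
    (fun r _ => (hasDerivAt_comp_line hσ a (b - a) r).hasDerivWithinAt)
    (fun r _ => (σ' _).le_of_opNorm_le (hK _) _)
  simpa using this

lemma norm_segment_le {a b : X} {R r : ℝ} (ha : ‖a‖ ≤ R) (hb : ‖b‖ ≤ R) (hr₀ : 0 ≤ r)
    (hr₁ : r ≤ 1) : ‖a + r • (b - a)‖ ≤ R := by
  have e : a + r • (b - a) = (1 - r) • a + r • b := by module
  rw [e]
  refine (norm_add_le _ _).trans ?_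
  rw [norm_smul, norm_smul, Real.norm_of_nonneg hr₀, Real.norm_of_nonneg (by linarith)]
  have h1 : 0 ≤ 1 - r := by linarith
  calc (1 - r) * ‖a‖ + r * ‖b‖ ≤ (1 - r) * R + r * R := by gcongr
    _ = R := by ring

/-- Second-order increments of a map with locally Lipschitz Gateaux derivative. -/
lemma norm_second_increment_le (hσ : ∀ u h : X, HasLineDerivAt ℝ σ (σ' u h) u h) {K L R : ℝ}
    (hK : ∀ u, ‖σ' u‖ ≤ K) (hL : 0 ≤ L)
    (hlip : ∀ u v, ‖u‖ ≤ R → ‖v‖ ≤ R → ‖σ' u - σ' v‖ ≤ L * ‖u - v‖)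
    {a b c d : X} (ha : ‖a‖ ≤ R) (hb : ‖b‖ ≤ R) (hc : ‖c‖ ≤ R) (hd : ‖d‖ ≤ R) :
    ‖σ b - σ a - (σ d - σ c)‖ ≤
      K * ‖b - a - (d - c)‖ + L * (‖a - c‖ + ‖b - d‖) * ‖d - c‖ := by
  have := norm_image_sub_le_of_norm_deriv_le_segment_01'
    (f := fun r : ℝ => σ (a + r • (b - a)) - σ (c + r • (d - c)))
    (f' := fun r => σ' (a + r • (b - a)) (b - a) - σ' (c + r • (d - c)) (d - c))
    (C := K * ‖b - a - (d - c)‖ + L * (‖a - c‖ + ‖b - d‖) * ‖d - c‖)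
    (fun r _ => ((hasDerivAt_comp_line hσ a (b - a) r).sub
      (hasDerivAt_comp_line hσ c (d - c) r)).hasDerivWithinAt)
    (fun r hr => by
      -- The first term only needs σ' bounded; the local Lipschitz constant enters multiplied by
      -- d-c.
      have e : σ' (a + r • (b - a)) (b - a) - σ' (c + r • (d - c)) (d - c) =
        σ' (a + r • (b - a)) (b - a - (d - c)) +
          (σ' (a + r • (b - a)) - σ' (c + r • (d - c))) (d - c) := by
        simp only [map_sub, sub_apply]; abel
      rw [e]
      refine norm_add_le_of_le ((σ' _).le_of_opNorm_le (hK _) _)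
        (ContinuousLinearMap.le_of_opNorm_le _ ?_ _)
      refine (hlip _ _ (norm_segment_le ha hb hr.1 hr.2.le)
        (norm_segment_le hc hd hr.1 hr.2.le)).trans ?_
      refine mul_le_mul_of_nonneg_left ?_ hL
      have e2 : a + r • (b - a) - (c + r • (d - c)) = (1 - r) • (a - c) + r • (b - d) := by module
      rw [e2]
      refine norm_add_le_of_le ?_ ?_
      · rw [norm_smul, Real.norm_of_nonneg (by linarith [hr.2])]
        exact mul_le_of_le_one_left (norm_nonneg _) (by linarith [hr.1])
      · rw [norm_smul, Real.norm_of_nonneg hr.1]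
        exact mul_le_of_le_one_left (norm_nonneg _) hr.2.le)
  simp only [one_smul, zero_smul, add_zero, add_sub_cancel] at this
  refine le_trans (le_of_eq ?_) this
  congr 1
  abel

end Nonlinearity

/-! ### Composition of the nonlinearity with S(·)ψ + z -/

section Composition

variable {X : Type*} [NormedAddCommGroup X] [NormedSpace ℝ X] {A : X →ₗ.[ℝ] X}
  {S : ℝ → X →L[ℝ] X} {V : ℝ → BanachSubspace X} {α θ : ℝ} {ψ : X}

/-- Since δ̂₁ kills orbits, the singular part S(·)ψ never enters the Hölder condition. -/
lemma hatDelta₁_orbit_add (hS : SemigroupScale A S V) (ψ : X) (z : ℝ → X) {s t : ℝ} (hs : 0 ≤ s)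
    (hst : s ≤ t) : hatDelta₁ S (fun r => S r ψ + z r) s t = hatDelta₁ S z s t := by
  simp only [hatDelta₁, map_add]
  rw [hS.add_apply (by linarith) hs, sub_add_cancel]
  abel

lemma one_le_rpow_neg {s γ : ℝ} (hs : 0 < s) (hs1 : s ≤ 1) (hγ : 0 ≤ γ) : 1 ≤ s ^ (-γ) :=
  Real.one_le_rpow_of_pos_of_le_one_of_nonpos hs hs1 (by linarith)

lemma IncrBd.bd_self {l R : ℝ} {E : BanachSubspace X} {z : ℝ → X} (hα : 0 < α)
    (hz : IncrBd S E α l R z) (h0 : z 0 = 0) {t : ℝ} (ht : 0 ≤ t) (ht1 : t ≤ 1) :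
    E.Bd (z t) (R * Real.exp (l * t)) := by
  have h1 := hz 0 t le_rfl ht ht1
  rw [hatDelta₁_zero_left h0, sub_zero] at h1
  rcases ht.eq_or_lt with rfl | ht
  · have hz1 := (hz 0 1 le_rfl zero_le_one le_rfl).nonneg
    rw [sub_zero, Real.one_rpow, mul_one] at hz1
    have : 0 ≤ R := nonneg_of_mul_nonneg_left hz1 (Real.exp_pos _)
    rw [h0]; exact E.bd_zero (by positivity)
  · refine h1.mono ?_
    have h2 : 0 < t ^ α := Real.rpow_pos_of_pos ht α
    have h3 : 0 ≤ R * Real.exp (l * t) := nonneg_of_mul_nonneg_left h1.nonneg h2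
    exact mul_le_of_le_one_right h3 (Real.rpow_le_one ht.le ht1 hα.le)

/-- Bound of `S(t)ψ + z(t)` in `X_α`. -/
lemma exists_bd_orbit_add (hS : SemigroupScale A S V) (hα : 0 < α) (hα₁ : α < 1) (hθ₀ : 0 ≤ θ)
    (hθα : θ ≤ α) (hψ : ψ ∈ (V θ).carrier) :
    ∃ N, 0 ≤ N ∧ ∀ (l R : ℝ) (z : ℝ → X), 0 ≤ l → 0 ≤ R → z 0 = 0 → IncrBd S (V α) α l R z →
      ∀ t, 0 < t → t ≤ 1 →
      (V α).Bd (S t ψ + z t) ((N + R) * Real.exp (l * t) * t ^ (-(α - θ))) := by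
  obtain ⟨L, hL, hsm⟩ := hS.bd_smoothing hθ₀ hθα (by linarith : α < 2)
  have hN := (V θ).nrm_nonneg ψ hψ
  refine ⟨L * (V θ).nrm ψ, by positivity, fun l R z hl hR h0 hz t ht ht1 => ?_⟩
  refine ((hsm t ψ _ ht ht1 (BanachSubspace.bd_nrm hψ)).add (hz.bd_self hα h0 ht.le ht1)).mono ?_
  have h1 : 1 ≤ Real.exp (l * t) := Real.one_le_exp (by positivity)
  have h2 : 1 ≤ t ^ (-(α - θ)) := one_le_rpow_neg ht ht1 (by linarith)
  have h3 : -α + θ = -(α - θ) := by ring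
  rw [h3]
  have h4 : L * t ^ (-(α - θ)) * (V θ).nrm ψ ≤
      L * t ^ (-(α - θ)) * (V θ).nrm ψ * Real.exp (l * t) :=
    le_mul_of_one_le_right (by positivity) h1
  have h5 : R * Real.exp (l * t) ≤ R * Real.exp (l * t) * t ^ (-(α - θ)) :=
    le_mul_of_one_le_right (by positivity) h2
  linarith

variable {σ : X → X} {K ω Lip L γ : ℝ}

/-- `σ ∘ y` is an admissible integrand, with linear growth of the bound. -/
lemma exists_isForcing_comp (hS : SemigroupScale A S V) (hα : 0 < α) (hα₁ : α < 1) (hθ₀ : 0 ≤ θ)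
    (hθα : θ ≤ α) (hψ : ψ ∈ (V θ).carrier) (hγ : α - θ ≤ γ) (hK : 0 ≤ K)
    (hσ : ∀ a b : X, ‖σ b - σ a‖ ≤ K * ‖b - a‖) (hL : 0 < L)
    (hmaps : ∀ u ∈ (V α).carrier, σ u ∈ (V α).carrier)
    (hgrowth : ∀ u ∈ (V α).carrier, (V α).nrm (σ u) ≤ L * (1 + (V α).nrm u)) :
    ∃ C, 0 ≤ C ∧ ∀ (l R : ℝ) (z : ℝ → X), 0 ≤ l → 0 ≤ R → z 0 = 0 → IncrBd S (V α) α l R z →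
      IsForcing S (V α) α γ l (C * (1 + R)) (σ ∘ fun t => S t ψ + z t) := by
  obtain ⟨N, hN, hbd⟩ := exists_bd_orbit_add hS hα hα₁ hθ₀ hθα hψ
  obtain ⟨Ca, hCa, happ⟩ := hS.norm_apply_sub_le hα hα₁.le
  obtain ⟨Ke, hKe, hemb⟩ := hS.norm_le_of_bd hα.le (by linarith : α < 2)
  refine ⟨(L + K * Ke + K * Ca + Ca * L) * (1 + N), by positivity, fun l R z hl hR h0 hz => ?_⟩
  have hσbd : ∀ s, 0 < s → s ≤ 1 → (V α).Bd (σ (S s ψ + z s))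
      (L * ((1 + N) * (1 + R) * Real.exp (l * s) * s ^ (-γ))) := by
    intro s hs hs1
    have h1 := hbd l R z hl hR h0 hz s hs hs1
    refine ⟨hmaps _ h1.1, (hgrowth _ h1.1).trans (mul_le_mul_of_nonneg_left ?_ hL.le)⟩
    have h2 : 1 ≤ Real.exp (l * s) := Real.one_le_exp (by positivity)
    have h3 : 1 ≤ s ^ (-γ) := one_le_rpow_neg hs hs1 (by linarith)
    have h4 : s ^ (-(α - θ)) ≤ s ^ (-γ) :=
      Real.rpow_le_rpow_of_exponent_ge hs hs1 (by linarith)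
    have h5 : 1 ≤ Real.exp (l * s) * s ^ (-γ) := one_le_mul_of_one_le_of_one_le h2 h3
    calc 1 + (V α).nrm (S s ψ + z s)
        ≤ Real.exp (l * s) * s ^ (-γ) + (N + R) * Real.exp (l * s) * s ^ (-γ) := by
          refine add_le_add h5 (h1.2.trans ?_)
          gcongr
      _ = (1 + N + R) * (Real.exp (l * s) * s ^ (-γ)) := by ring
      _ ≤ ((1 + N) * (1 + R)) * (Real.exp (l * s) * s ^ (-γ)) := by
          gcongr; nlinarith
      _ = _ := by ring
  have hexp : ∀ s, 0 < s → 0 ≤ Real.exp (l * s) * s ^ (-γ) := fun s hs => by positivity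
  refine ⟨fun s hs hs1 => (hσbd s hs hs1).mono ?_, fun s t hs hst ht => ?_⟩
  · have : 0 ≤ (K * Ke + K * Ca + Ca * L) * ((1 + N) * (1 + R) * Real.exp (l * s) * s ^ (-γ)) := by
      positivity
    nlinarith
  · set y : ℝ → X := fun t => S t ψ + z t with hy
    have hts : 0 ≤ t - s := by linarith
    have hs1 : s ≤ 1 := by linarith
    -- The first bracket is controlled by δ̂₁y; in the other two, S(t-s) - I gains (t-s)^α when
    -- passing from X_α to X. Only the global Lipschitz bound in X and the growth bound in X_α are
    -- used, which keeps the estimate linear in 1+R.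
    have e : hatDelta₁ S (σ ∘ y) s t = (σ (y t) - σ (S (t - s) (y s))) +
        (σ (S (t - s) (y s)) - σ (y s)) - (S (t - s) (σ (y s)) - σ (y s)) := by
      simp only [hatDelta₁, Function.comp]; abel
    have h3 : 1 ≤ s ^ (-γ) := one_le_rpow_neg hs hs1 (by linarith)
    have h4 : s ^ (-(α - θ)) ≤ s ^ (-γ) :=
      Real.rpow_le_rpow_of_exponent_ge hs hs1 (by linarith)
    have h5 : Real.exp (l * s) ≤ Real.exp (l * t) := Real.exp_le_exp.2 (by gcongr)
    have hpow : 0 ≤ (t - s) ^ α := Real.rpow_nonneg hts α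
    set Q := (1 + N) * (1 + R) * Real.exp (l * t) * s ^ (-γ) * (t - s) ^ α with hQ
    have b1 : ‖σ (y t) - σ (S (t - s) (y s))‖ ≤ K * Ke * Q := by
      refine (hσ _ _).trans ?_
      rw [mul_assoc]
      refine mul_le_mul_of_nonneg_left ?_ hK
      have h6 := hz s t hs.le hst ht
      rw [← hatDelta₁_orbit_add hS ψ z hs.le hst] at h6
      refine (hemb _ _ h6).trans (mul_le_mul_of_nonneg_left ?_ hKe.le)
      rw [hQ]
      have h7 : R ≤ (1 + N) * (1 + R) := by nlinarith
      calc R * Real.exp (l * t) * (t - s) ^ α ≤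
          (1 + N) * (1 + R) * Real.exp (l * t) * (t - s) ^ α := by gcongr
        _ = (1 + N) * (1 + R) * Real.exp (l * t) * 1 * (t - s) ^ α := by ring
        _ ≤ _ := by gcongr
    have b2 : ‖σ (S (t - s) (y s)) - σ (y s)‖ ≤ K * Ca * Q := by
      refine (hσ _ _).trans ?_
      rw [mul_assoc]
      refine mul_le_mul_of_nonneg_left ?_ hK
      refine (happ _ _ _ hts (by linarith) (hbd l R z hl hR h0 hz s hs hs1)).trans ?_
      have h7 : N + R ≤ (1 + N) * (1 + R) := by nlinarith
      calc Ca * (t - s) ^ α * ((N + R) * Real.exp (l * s) * s ^ (-(α - θ))) ≤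
          Ca * (t - s) ^ α * ((1 + N) * (1 + R) * Real.exp (l * t) * s ^ (-γ)) := by gcongr
        _ = _ := by rw [hQ]; ring
    have b3 : ‖S (t - s) (σ (y s)) - σ (y s)‖ ≤ Ca * L * Q := by
      refine (happ _ _ _ hts (by linarith) (hσbd s hs hs1)).trans ?_
      calc Ca * (t - s) ^ α * (L * ((1 + N) * (1 + R) * Real.exp (l * s) * s ^ (-γ))) ≤
          Ca * (t - s) ^ α * (L * ((1 + N) * (1 + R) * Real.exp (l * t) * s ^ (-γ))) := by gcongr
        _ = _ := by rw [hQ]; ring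
    rw [e]
    refine (norm_sub_le_of_le (norm_add_le_of_le b1 b2) b3).trans ?_
    have hQ0 : 0 ≤ Q := by positivity
    calc K * Ke * Q + K * Ca * Q + Ca * L * Q ≤ (L + K * Ke + K * Ca + Ca * L) * Q := by
          nlinarith [mul_nonneg hL.le hQ0]
      _ = _ := by rw [hQ]; ring

variable {σ' : X → X →L[ℝ] X}

set_option maxHeartbeats 800000 in
/-- Differences of `σ ∘ y` are controlled linearly by differences of `y` on bounded sets. -/
lemma exists_isForcing_comp_sub (hS : SemigroupScale A S V) (hα : 0 < α) (hα₁ : α < 1)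
    (hθ₀ : 0 ≤ θ) (hθα : θ ≤ α) (hψ : ψ ∈ (V θ).carrier) (hω : 0 < ω)
    (hγ : (1 + ω) * (α - θ) ≤ γ) (hK : 0 ≤ K)
    (hσ : ∀ u h : X, HasLineDerivAt ℝ σ (σ' u h) u h) (hσK : ∀ u, ‖σ' u‖ ≤ K)
    (hσ_lip : ∀ R > 0, ∃ L : ℝ, ∀ u v : X, ‖u‖ ≤ R → ‖v‖ ≤ R → ‖σ' u - σ' v‖ ≤ L * ‖u - v‖)
    (hmaps : ∀ u ∈ (V α).carrier, σ u ∈ (V α).carrier) (hLip : 0 < Lip)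
    (hσα_lip : ∀ R > 0, ∀ u ∈ (V α).carrier, ∀ v ∈ (V α).carrier,
      (V α).nrm u ≤ R → (V α).nrm v ≤ R →
      (V α).nrm (σ u - σ v) ≤ Lip * (1 + R) ^ ω * (V α).nrm (u - v)) {R : ℝ} (hR : 0 ≤ R) :
    ∃ C, 0 ≤ C ∧ ∀ (l D : ℝ) (z₁ z₂ : ℝ → X), 0 ≤ l → 0 ≤ D → z₁ 0 = 0 → z₂ 0 = 0 →
      IncrBd S (V α) α 0 R z₁ → IncrBd S (V α) α 0 R z₂ →
      IncrBd S (V α) α l D (fun t => z₁ t - z₂ t) →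
      IsForcing S (V α) α γ l (C * D) (fun t => σ (S t ψ + z₁ t) - σ (S t ψ + z₂ t)) := by
  obtain ⟨N, hN, hbd⟩ := exists_bd_orbit_add hS hα hα₁ hθ₀ hθα hψ
  obtain ⟨Ca, hCa, happ⟩ := hS.norm_apply_sub_le hα hα₁.le
  obtain ⟨Ke, hKe, hemb⟩ := hS.norm_le_of_bd hα.le (by linarith : α < 2)
  obtain ⟨L₀, hL₀, hS0⟩ := hS.norm_apply_le
  -- M bounds y in X, uniformly down to time 0. The larger radius L₀M + 1 also contains the points
  -- S(t-s)y(s), and the 1 makes it positive.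
  set M := L₀ * ‖ψ‖ + Ke * R with hM
  have hM0 : 0 ≤ M := by positivity
  obtain ⟨L', hL'⟩ := hσ_lip (L₀ * M + 1) (by positivity)
  set Lr := max L' 0 with hLr
  have hLr0 : 0 ≤ Lr := le_max_right _ _
  have hlip : ∀ u v : X, ‖u‖ ≤ L₀ * M + 1 → ‖v‖ ≤ L₀ * M + 1 → ‖σ' u - σ' v‖ ≤ Lr * ‖u - v‖ :=
    fun u v hu hv => (hL' u v hu hv).trans (by gcongr; exact le_max_left _ _)
  set G := Lip * (N + R + 2) ^ ω with hG
  have hG0 : 0 ≤ G := by positivity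
  set c₁ := K * Ke + Lr * (L₀ * Ke + Ke) * (Ke * R) with hc₁
  set c₂ := K * Ca + Lr * (Ke + L₀ * Ke) * (Ca * (N + R)) with hc₂
  have hc₁0 : 0 ≤ c₁ := by positivity
  have hc₂0 : 0 ≤ c₂ := by positivity
  have hδ : 0 ≤ α - θ := by linarith
  have hγδ : α - θ ≤ γ := by nlinarith
  have hγω : (α - θ) * ω ≤ γ := by nlinarith
  refine ⟨G + c₁ + c₂ + Ca * G, by positivity, fun l D z₁ z₂ hl hD h₁0 h₂0 h₁ h₂ hd => ?_⟩
  have hbd0 : ∀ z : ℝ → X, z 0 = 0 → IncrBd S (V α) α 0 R z → ∀ t, 0 < t → t ≤ 1 →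
      (V α).Bd (S t ψ + z t) ((N + R) * t ^ (-(α - θ))) := by
    intro z h0 hz t ht ht1
    have := hbd 0 R z le_rfl hR h0 hz t ht ht1
    rwa [zero_mul, Real.exp_zero, mul_one] at this
  have hbdX : ∀ z : ℝ → X, z 0 = 0 → IncrBd S (V α) α 0 R z → ∀ t, 0 < t → t ≤ 1 →
      ‖S t ψ + z t‖ ≤ M := by
    intro z h0 hz t ht ht1
    refine norm_add_le_of_le (hS0 t ψ ht.le ht1) ?_
    have := hemb _ _ (hz.bd_self hα h0 ht.le ht1)
    rwa [zero_mul, Real.exp_zero, mul_one] at this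
  have hbdd : ∀ t, 0 < t → t ≤ 1 → (V α).Bd (S t ψ + z₁ t - (S t ψ + z₂ t))
      (D * Real.exp (l * t)) := by
    intro t ht ht1
    have := hd.bd_self hα (by simp [h₁0, h₂0]) ht.le ht1
    simpa using this
  set y₁ : ℝ → X := fun t => S t ψ + z₁ t with hy₁
  set y₂ : ℝ → X := fun t => S t ψ + z₂ t with hy₂
  have hw : ∀ s, 0 < s → s ≤ 1 →
      (V α).Bd (σ (y₁ s) - σ (y₂ s)) (G * (D * Real.exp (l * s) * s ^ (-γ))) := by
    intro s hs hs1
    have m₁ := hbd0 z₁ h₁0 h₁ s hs hs1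
    have m₂ := hbd0 z₂ h₂0 h₂ s hs hs1
    have hp : 1 ≤ s ^ (-(α - θ)) := one_le_rpow_neg hs hs1 hδ
    have hp0 : 0 ≤ s ^ (-(α - θ)) := by linarith
    refine ⟨(V α).carrier.sub_mem (hmaps _ m₁.1) (hmaps _ m₂.1), ?_⟩
    have h6 := hσα_lip ((N + R + 1) * s ^ (-(α - θ))) (by positivity) _ m₁.1 _ m₂.1
      (m₁.2.trans (mul_le_mul_of_nonneg_right (by linarith) hp0))
      (m₂.2.trans (mul_le_mul_of_nonneg_right (by linarith) hp0))
    refine h6.trans ?_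
    -- y₁ and y₂ live at radius of order s^(-(α-θ)), so the local Lipschitz constant blows up like
    -- s^(-ω(α-θ)); y₁ - y₂ = z₁ - z₂ does not blow up, as the singular orbits cancel.
    have h7 : (1 + (N + R + 1) * s ^ (-(α - θ))) ^ ω ≤ (N + R + 2) ^ ω * s ^ (-γ) := by
      calc (1 + (N + R + 1) * s ^ (-(α - θ))) ^ ω ≤ ((N + R + 2) * s ^ (-(α - θ))) ^ ω := by
            refine Real.rpow_le_rpow (by positivity) ?_ hω.le
            nlinarith
        _ = (N + R + 2) ^ ω * s ^ (-(α - θ) * ω) := by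
            rw [Real.mul_rpow (by positivity) hp0, ← Real.rpow_mul hs.le]
        _ ≤ (N + R + 2) ^ ω * s ^ (-γ) := by
            refine mul_le_mul_of_nonneg_left ?_ (by positivity)
            exact Real.rpow_le_rpow_of_exponent_ge hs hs1 (by linarith)
    have h8 := hbdd s hs hs1
    calc Lip * (1 + (N + R + 1) * s ^ (-(α - θ))) ^ ω *
          (V α).nrm (S s ψ + z₁ s - (S s ψ + z₂ s))
        ≤ Lip * ((N + R + 2) ^ ω * s ^ (-γ)) * (D * Real.exp (l * s)) := by
          refine mul_le_mul (by gcongr) h8.2 ((V α).nrm_nonneg _ h8.1) (by positivity)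
      _ = _ := by rw [hG]; ring
  refine ⟨fun s hs hs1 => (hw s hs hs1).mono ?_, fun s t hs hst ht => ?_⟩
  · have : 0 ≤ (c₁ + c₂ + Ca * G) * (D * Real.exp (l * s) * s ^ (-γ)) := by positivity
    linarith
  have hts : 0 ≤ t - s := by linarith
  have hs1 : s ≤ 1 := by linarith
  have ht0 : 0 < t := by linarith
  have h3 : 1 ≤ s ^ (-γ) := one_le_rpow_neg hs hs1 (by linarith)
  have h4 : s ^ (-(α - θ)) ≤ s ^ (-γ) :=
    Real.rpow_le_rpow_of_exponent_ge hs hs1 (by linarith)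
  have h5 : Real.exp (l * s) ≤ Real.exp (l * t) := Real.exp_le_exp.2 (by gcongr)
  have hpow : 0 ≤ (t - s) ^ α := Real.rpow_nonneg hts α
  have hMM : M ≤ L₀ * M + 1 := by nlinarith
  have n₁s := hbdX z₁ h₁0 h₁ s hs hs1
  have n₂s := hbdX z₂ h₂0 h₂ s hs hs1
  have n₁t := hbdX z₁ h₁0 h₁ t ht0 ht
  have n₂t := hbdX z₂ h₂0 h₂ t ht0 ht
  have nS : ∀ u : X, ‖u‖ ≤ M → ‖S (t - s) u‖ ≤ L₀ * M + 1 := fun u hu =>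
    (hS0 _ u hts (by linarith)).trans (by nlinarith)
  have nds : ‖y₁ s - y₂ s‖ ≤ Ke * (D * Real.exp (l * t)) :=
    (hemb _ _ (hbdd s hs hs1)).trans (by gcongr)
  have ndt : ‖y₁ t - y₂ t‖ ≤ Ke * (D * Real.exp (l * t)) := hemb _ _ (hbdd t ht0 ht)
  have nSds : ‖S (t - s) (y₁ s) - S (t - s) (y₂ s)‖ ≤ L₀ * (Ke * (D * Real.exp (l * t))) := by
    rw [← map_sub]
    exact (hS0 _ _ hts (by linarith)).trans (by gcongr)
  set Q := D * Real.exp (l * t) * s ^ (-γ) * (t - s) ^ α with hQ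
  have hQ0 : 0 ≤ Q := by positivity
  have hQ1 : D * Real.exp (l * t) * (t - s) ^ α ≤ Q := by
    calc D * Real.exp (l * t) * (t - s) ^ α = D * Real.exp (l * t) * 1 * (t - s) ^ α := by ring
      _ ≤ _ := by rw [hQ]; gcongr
  -- The splitting of `exists_isForcing_comp`, now with second-order increments: each product
  -- contains exactly one factor measuring y₁ - y₂, so the bound is linear in D.
  have b1 : ‖σ (y₁ t) - σ (S (t - s) (y₁ s)) - (σ (y₂ t) - σ (S (t - s) (y₂ s)))‖ ≤ c₁ * Q := by
    refine (norm_second_increment_le hσ hσK hLr0 hlip (nS _ n₁s) (n₁t.trans hMM) (nS _ n₂s)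
      (n₂t.trans hMM)).trans ?_
    have i1 : ‖y₁ t - S (t - s) (y₁ s) - (y₂ t - S (t - s) (y₂ s))‖ ≤
        Ke * (D * Real.exp (l * t) * (t - s) ^ α) := by
      have h6 := hemb _ _ (hd s t hs.le hst ht)
      refine le_trans (le_of_eq ?_) h6
      have e1 := hatDelta₁_orbit_add hS ψ z₁ hs.le hst
      have e2 := hatDelta₁_orbit_add hS ψ z₂ hs.le hst
      rw [hatDelta₁] at e1 e2
      simp only [hy₁, hy₂]
      rw [e1, e2]
      simp only [hatDelta₁, map_sub]
      congr 1
      abel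
    have i2 : ‖y₂ t - S (t - s) (y₂ s)‖ ≤ Ke * (R * (t - s) ^ α) := by
      have h6 := hemb _ _ (h₂ s t hs.le hst ht)
      rw [← hatDelta₁_orbit_add hS ψ z₂ hs.le hst, zero_mul, Real.exp_zero, mul_one] at h6
      exact h6
    calc K * ‖y₁ t - S (t - s) (y₁ s) - (y₂ t - S (t - s) (y₂ s))‖ +
          Lr * (‖S (t - s) (y₁ s) - S (t - s) (y₂ s)‖ + ‖y₁ t - y₂ t‖) *
            ‖y₂ t - S (t - s) (y₂ s)‖
        ≤ K * (Ke * (D * Real.exp (l * t) * (t - s) ^ α)) +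
          Lr * (L₀ * (Ke * (D * Real.exp (l * t))) + Ke * (D * Real.exp (l * t))) *
            (Ke * (R * (t - s) ^ α)) := by gcongr
      _ = c₁ * (D * Real.exp (l * t) * (t - s) ^ α) := by rw [hc₁]; ring
      _ ≤ c₁ * Q := by gcongr
  have b2 : ‖σ (S (t - s) (y₁ s)) - σ (y₁ s) - (σ (S (t - s) (y₂ s)) - σ (y₂ s))‖ ≤ c₂ * Q := by
    refine (norm_second_increment_le hσ hσK hLr0 hlip (n₁s.trans hMM) (nS _ n₁s) (n₂s.trans hMM)
      (nS _ n₂s)).trans ?_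
    have i1 : ‖S (t - s) (y₁ s) - y₁ s - (S (t - s) (y₂ s) - y₂ s)‖ ≤
        Ca * (t - s) ^ α * (D * Real.exp (l * t)) := by
      have h6 := happ _ _ _ hts (by linarith) (hbdd s hs hs1)
      have e : S (t - s) (y₁ s) - y₁ s - (S (t - s) (y₂ s) - y₂ s) =
          S (t - s) (y₁ s - y₂ s) - (y₁ s - y₂ s) := by rw [map_sub]; abel
      rw [e]
      exact h6.trans (by gcongr)
    -- The increment of y₂ alone still sees the singular orbit; this requires α-θ ≤ γ.
    have i2 : ‖S (t - s) (y₂ s) - y₂ s‖ ≤ Ca * (t - s) ^ α * ((N + R) * s ^ (-γ)) :=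
      (happ _ _ _ hts (by linarith) (hbd0 z₂ h₂0 h₂ s hs hs1)).trans (by gcongr)
    calc K * ‖S (t - s) (y₁ s) - y₁ s - (S (t - s) (y₂ s) - y₂ s)‖ +
          Lr * (‖y₁ s - y₂ s‖ + ‖S (t - s) (y₁ s) - S (t - s) (y₂ s)‖) *
            ‖S (t - s) (y₂ s) - y₂ s‖
        ≤ K * (Ca * (t - s) ^ α * (D * Real.exp (l * t))) +
          Lr * (Ke * (D * Real.exp (l * t)) + L₀ * (Ke * (D * Real.exp (l * t)))) *
            (Ca * (t - s) ^ α * ((N + R) * s ^ (-γ))) := by gcongr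
      _ = K * Ca * (D * Real.exp (l * t) * (t - s) ^ α) +
          Lr * (Ke + L₀ * Ke) * (Ca * (N + R)) * Q := by rw [hQ]; ring
      _ ≤ K * Ca * Q + Lr * (Ke + L₀ * Ke) * (Ca * (N + R)) * Q := by gcongr
      _ = c₂ * Q := by rw [hc₂]; ring
  have b3 : ‖S (t - s) (σ (y₁ s) - σ (y₂ s)) - (σ (y₁ s) - σ (y₂ s))‖ ≤ Ca * G * Q := by
    refine (happ _ _ _ hts (by linarith) (hw s hs hs1)).trans ?_
    calc Ca * (t - s) ^ α * (G * (D * Real.exp (l * s) * s ^ (-γ))) ≤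
        Ca * (t - s) ^ α * (G * (D * Real.exp (l * t) * s ^ (-γ))) := by gcongr
      _ = _ := by rw [hQ]; ring
  have e : hatDelta₁ S (fun t => σ (y₁ t) - σ (y₂ t)) s t =
      (σ (y₁ t) - σ (S (t - s) (y₁ s)) - (σ (y₂ t) - σ (S (t - s) (y₂ s)))) +
      (σ (S (t - s) (y₁ s)) - σ (y₁ s) - (σ (S (t - s) (y₂ s)) - σ (y₂ s))) -
      (S (t - s) (σ (y₁ s) - σ (y₂ s)) - (σ (y₁ s) - σ (y₂ s))) := by
    simp only [hatDelta₁]; abel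
  rw [e]
  refine (norm_sub_le_of_le (norm_add_le_of_le b1 b2) b3).trans ?_
  calc c₁ * Q + c₂ * Q + Ca * G * Q ≤ (G + c₁ + c₂ + Ca * G) * Q := by
        nlinarith [mul_nonneg hG0 hQ0]
    _ = _ := by rw [hQ]; ring

end Composition

/-! ### The fixed point argument in exponentially weighted norms -/

section FixedPoint

variable {X : Type*} [NormedAddCommGroup X] [NormedSpace ℝ X] {A : X →ₗ.[ℝ] X}
  {S : ℝ → X →L[ℝ] X} {V : ℝ → BanachSubspace X} {E : BanachSubspace X} {x : ℝ → ℝ}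
  {φ₁ φ₂ z w : ℝ → X} {H η α θ γ κ K ω Lip L l R R₁ R₂ : ℝ} {ψ : X}
  {σ : X → X} {σ' : X → X →L[ℝ] X}

lemma hatDelta₁_sub (S : ℝ → X →L[ℝ] X) (z w : ℝ → X) (s t : ℝ) :
    hatDelta₁ S (fun r => z r - w r) s t = hatDelta₁ S z s t - hatDelta₁ S w s t := by
  simp only [hatDelta₁, map_sub]; abel

lemma IncrBd.sub (hz : IncrBd S E α l R₁ z) (hw : IncrBd S E α l R₂ w) :
    IncrBd S E α l (R₁ + R₂) (fun r => z r - w r) := by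
  intro s t hs hst ht
  rw [hatDelta₁_sub]
  exact ((hz s t hs hst ht).sub (hw s t hs hst ht)).mono (le_of_eq (by ring))

lemma IncrBd.mono (hz : IncrBd S E α l R₁ z) (h : R₁ ≤ R₂) : IncrBd S E α l R₂ z := by
  intro s t hs hst ht
  have : 0 ≤ (t - s) ^ α := Real.rpow_nonneg (by linarith) α
  exact (hz s t hs hst ht).mono (by gcongr)

lemma IncrBd.weight (hz : IncrBd S E α 0 R z) (hR : 0 ≤ R) (hl : 0 ≤ l) : IncrBd S E α l R z := by
  intro s t hs hst ht
  have : 0 ≤ (t - s) ^ α := Real.rpow_nonneg (by linarith) α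
  refine (hz s t hs hst ht).mono ?_
  have : 0 * t ≤ l * t := by rw [zero_mul]; exact mul_nonneg hl (by linarith)
  gcongr

lemma IncrBd.unweight (hz : IncrBd S E α l R z) (hR : 0 ≤ R) (hl : 0 ≤ l) :
    IncrBd S E α 0 (R * Real.exp l) z := by
  intro s t hs hst ht
  have : 0 ≤ (t - s) ^ α := Real.rpow_nonneg (by linarith) α
  refine (hz s t hs hst ht).mono ?_
  rw [zero_mul, Real.exp_zero, mul_one]
  have : l * t ≤ l := mul_le_of_le_one_right hl ht
  gcongr

lemma SolvesConv.sub (hz : SolvesConv S x φ₁ z) (hw : SolvesConv S x φ₂ w) :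
    SolvesConv S x (fun r => φ₁ r - φ₂ r) (fun r => z r - w r) := by
  intro s t hs hst ht
  rw [hatDelta₁_sub]
  refine ((hz s t hs hst ht).sub (hw s t hs hst ht)).congr fun n => ?_
  rw [← dyadicSum_sub]
  simp only [map_sub]

lemma tendsto_rpow_neg_const_mul (hκ : 0 < κ) (C : ℝ) :
    Tendsto (fun l : ℝ => C * l ^ (-κ)) atTop (𝓝 0) := by
  simpa using (tendsto_rpow_neg_atTop hκ).const_mul C

/-- Existence of the convolution integral of an admissible integrand. -/
lemma exists_solvesConv [CompleteSpace X] (hS : SemigroupScale A S V) (hη : 0 < η) (hα : 0 < α)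
    (hηα : 1 < η + α) (hH : 0 ≤ H)
    (hx : ∀ u v, 0 ≤ u → u ≤ v → v ≤ 1 → |x v - x u| ≤ H * (v - u) ^ η)
    (hγ : 0 ≤ γ) (hα₁ : α < 1) (hγη : α + γ ≤ η) {P : ℝ} {φ : ℝ → X} (hl : 0 ≤ l) (hP : 0 ≤ P)
    (hφ : IsForcing S (V α) α γ l P φ) :
    ∃ z : ℝ → X, z 0 = 0 ∧ SolvesConv S x φ z ∧ ∃ R, IncrBd S (V α) α 0 R z := by
  have hφ' := hφ.congr_exp hl hP
  obtain ⟨J, hJ, hlim⟩ := exists_cocycle hS hη hα hηα hH hx hγ (by positivity) hφ'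
  obtain ⟨C, hC, hconv⟩ := exists_bd_convolution hS hη hα hηα hH hx hγ le_rfl
    (by linarith) (by linarith)
  have hb := hconv 0 1 (P * Real.exp l) φ J le_rfl zero_le_one (by positivity)
    (fun u _ _ => by simp) hφ' hJ hlim
  obtain ⟨z, hz0, hz, hR⟩ := exists_hatDelta₁_eq hS hα.le (by linarith : α < 2) hα hJ
    (B := C * 1 * (P * Real.exp l)) (fun s t hs hst ht => by
      have := hb s t hs hst ht
      rwa [zero_mul, Real.exp_zero, mul_one] at this)
  refine ⟨z, hz0, fun s t hs hst ht => ?_, hR⟩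
  rw [hz s t hs hst ht]
  exact hlim s t hs hst ht

/-- Linearity in D of the forcing bound and the factor l^(-κ) give the ratio 1/2 for large l. The
weight depends on R but not on D, so the estimate can be iterated. -/
lemma exists_contraction (hS : SemigroupScale A S V) (hη : 0 < η) (hα : 0 < α) (hα₁ : α < 1)
    (hηα : 1 < η + α) (hH : 0 ≤ H)
    (hx : ∀ u v, 0 ≤ u → u ≤ v → v ≤ 1 → |x v - x u| ≤ H * (v - u) ^ η)
    (hθ₀ : 0 ≤ θ) (hθα : θ ≤ α) (hψ : ψ ∈ (V θ).carrier) (hω : 0 < ω)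
    (hγ : (1 + ω) * (α - θ) ≤ γ) (hκ : 0 < κ) (hακ : α + κ < 1) (hγκ : α + γ + κ ≤ η) (hK : 0 ≤ K)
    (hσ : ∀ u h : X, HasLineDerivAt ℝ σ (σ' u h) u h) (hσK : ∀ u, ‖σ' u‖ ≤ K)
    (hσ_lip : ∀ R > 0, ∃ L : ℝ, ∀ u v : X, ‖u‖ ≤ R → ‖v‖ ≤ R → ‖σ' u - σ' v‖ ≤ L * ‖u - v‖)
    (hmaps : ∀ u ∈ (V α).carrier, σ u ∈ (V α).carrier) (hLip : 0 < Lip)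
    (hσα_lip : ∀ R > 0, ∀ u ∈ (V α).carrier, ∀ v ∈ (V α).carrier,
      (V α).nrm u ≤ R → (V α).nrm v ≤ R →
      (V α).nrm (σ u - σ v) ≤ Lip * (1 + R) ^ ω * (V α).nrm (u - v)) (hR : 0 ≤ R) :
    ∃ l, 0 < l ∧ ∀ (D : ℝ) (z₁ z₂ w₁ w₂ : ℝ → X), 0 ≤ D → z₁ 0 = 0 → z₂ 0 = 0 →
      IncrBd S (V α) α 0 R z₁ → IncrBd S (V α) α 0 R z₂ →
      IncrBd S (V α) α l D (fun t => z₁ t - z₂ t) → w₁ 0 = 0 → w₂ 0 = 0 →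
      IncrBd S (V α) α 0 R w₁ → IncrBd S (V α) α 0 R w₂ →
      SolvesConv S x (σ ∘ fun t => S t ψ + z₁ t) w₁ →
      SolvesConv S x (σ ∘ fun t => S t ψ + z₂ t) w₂ →
      IncrBd S (V α) α l (D / 2) (fun t => w₁ t - w₂ t) := by
  have hγ₀ : 0 ≤ γ := le_trans (mul_nonneg (by linarith) (by linarith)) hγ
  obtain ⟨C₁, hC₁, hF⟩ := exists_isForcing_comp_sub hS hα hα₁ hθ₀ hθα hψ hω hγ hK hσ hσK hσ_lip
    hmaps hLip hσα_lip hR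
  obtain ⟨C₂, hC₂, hE⟩ := exists_incrBd_of_solvesConv hS hη hα hηα hH hx hγ₀ hκ.le hακ hγκ
  obtain ⟨l, hl, hl0⟩ := (((tendsto_rpow_neg_const_mul hκ (C₂ * C₁)).eventually
    (gt_mem_nhds (by norm_num : (0 : ℝ) < 1 / 2))).and (eventually_gt_atTop 0)).exists
  refine ⟨l, hl0, fun D z₁ z₂ w₁ w₂ hD h₁ h₂ hz₁ hz₂ hd k₁ k₂ hw₁ hw₂ hs₁ hs₂ => ?_⟩
  have := hE l (C₁ * D) (R + R) _ _ hl0 (by positivity)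
    (hF l D z₁ z₂ hl0.le hD h₁ h₂ hz₁ hz₂ hd) (hs₁.sub hs₂) (by simp [k₁, k₂]) (hw₁.sub hw₂)
  refine this.mono ?_
  calc C₂ * (C₁ * D) * l ^ (-κ) = C₂ * C₁ * l ^ (-κ) * D := by ring
    _ ≤ 1 / 2 * D := by gcongr
    _ = D / 2 := by ring

/-- Linear growth sends the weighted ball of radius 1 into radius C₂C₁(1+1)l^(-κ), which is below 1
for large l; superlinear growth would spoil a choice of l valid on all of [0,1]. -/
lemma exists_invariant [CompleteSpace X] (hS : SemigroupScale A S V) (hη : 0 < η) (hα : 0 < α)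
    (hα₁ : α < 1) (hηα : 1 < η + α) (hH : 0 ≤ H)
    (hx : ∀ u v, 0 ≤ u → u ≤ v → v ≤ 1 → |x v - x u| ≤ H * (v - u) ^ η)
    (hθ₀ : 0 ≤ θ) (hθα : θ ≤ α) (hψ : ψ ∈ (V θ).carrier)
    (hγ : α - θ ≤ γ) (hκ : 0 < κ) (hακ : α + κ < 1) (hγκ : α + γ + κ ≤ η) (hK : 0 ≤ K)
    (hσ : ∀ a b : X, ‖σ b - σ a‖ ≤ K * ‖b - a‖) (hL : 0 < L)
    (hmaps : ∀ u ∈ (V α).carrier, σ u ∈ (V α).carrier)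
    (hgrowth : ∀ u ∈ (V α).carrier, (V α).nrm (σ u) ≤ L * (1 + (V α).nrm u)) :
    ∃ l, 0 < l ∧ ∀ z : ℝ → X, z 0 = 0 ∧ IncrBd S (V α) α l 1 z →
      ∃ w : ℝ → X, (w 0 = 0 ∧ IncrBd S (V α) α l 1 w) ∧
        SolvesConv S x (σ ∘ fun t => S t ψ + z t) w := by
  have hγ₀ : 0 ≤ γ := by linarith
  obtain ⟨C₁, hC₁, hF⟩ := exists_isForcing_comp hS hα hα₁ hθ₀ hθα hψ hγ hK hσ hL hmaps hgrowth
  obtain ⟨C₂, hC₂, hE⟩ := exists_incrBd_of_solvesConv hS hη hα hηα hH hx hγ₀ hκ.le hακ hγκ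
  obtain ⟨l, hl, hl0⟩ := (((tendsto_rpow_neg_const_mul hκ (C₂ * (C₁ * (1 + 1)))).eventually
    (gt_mem_nhds (by norm_num : (0 : ℝ) < 1))).and (eventually_gt_atTop 0)).exists
  refine ⟨l, hl0, fun z hz => ?_⟩
  have hφ := hF l 1 z hl0.le zero_le_one hz.1 hz.2
  obtain ⟨w, hw0, hw, R, hR⟩ := exists_solvesConv hS hη hα hηα hH hx hγ₀ hα₁ (by linarith) hl0.le
    (by positivity) hφ
  exact ⟨w, ⟨hw0, (hE l _ R _ w hl0 (by positivity) hφ hw hw0 hR).mono hl.le⟩, hw⟩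

lemma BanachSubspace.Bd.of_tendsto {v : X} {u : ℕ → X} {b : ℕ → ℝ} {c : ℝ}
    (hb : Tendsto b atTop (𝓝 0)) (hv : ∀ n, E.Bd (v - u n) (b n)) (hu : ∀ n, E.Bd (u n) c) :
    E.Bd v c := by
  have h : ∀ n, E.Bd v (b n + c) := fun n => by simpa using (hv n).add (hu n)
  have hl : Tendsto (fun n => b n + c) atTop (𝓝 c) := by simpa using hb.add_const c
  exact ⟨(h 0).1, ge_of_tendsto' hl fun n => (h n).2⟩

lemma eq_zero_of_incrBd_geometric (hS : SemigroupScale A S V) (hα : 0 < α) (hα₁ : α < 1)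
    {D : ℝ} (h0 : z 0 = 0) (h : ∀ n : ℕ, IncrBd S (V α) α l (D * (1 / 2) ^ n) z) {t : ℝ}
    (ht : 0 ≤ t) (ht1 : t ≤ 1) : z t = 0 := by
  obtain ⟨K, hK, hemb⟩ := hS.norm_le_of_bd hα.le (by linarith : α < 2)
  have hl : Tendsto (fun n : ℕ => K * (D * (1 / 2) ^ n * Real.exp (l * t))) atTop (𝓝 0) := by
    have := (((tendsto_pow_atTop_nhds_zero_of_lt_one (by norm_num : (0 : ℝ) ≤ 1 / 2)
      (by norm_num)).const_mul D).mul_const (Real.exp (l * t))).const_mul K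
    simpa only [mul_zero, zero_mul] using this
  have := ge_of_tendsto' hl fun n => hemb _ _ ((h n).bd_self hα h0 ht ht1)
  exact norm_le_zero_iff.1 this

/-- Uniqueness of the fixed point. -/
lemma fixedPoint_unique (hS : SemigroupScale A S V) (hη : 0 < η) (hα : 0 < α) (hα₁ : α < 1)
    (hηα : 1 < η + α) (hH : 0 ≤ H)
    (hx : ∀ u v, 0 ≤ u → u ≤ v → v ≤ 1 → |x v - x u| ≤ H * (v - u) ^ η)
    (hθ₀ : 0 ≤ θ) (hθα : θ ≤ α) (hψ : ψ ∈ (V θ).carrier) (hω : 0 < ω)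
    (hγ : (1 + ω) * (α - θ) ≤ γ) (hκ : 0 < κ) (hακ : α + κ < 1) (hγκ : α + γ + κ ≤ η) (hK : 0 ≤ K)
    (hσ : ∀ u h : X, HasLineDerivAt ℝ σ (σ' u h) u h) (hσK : ∀ u, ‖σ' u‖ ≤ K)
    (hσ_lip : ∀ R > 0, ∃ L : ℝ, ∀ u v : X, ‖u‖ ≤ R → ‖v‖ ≤ R → ‖σ' u - σ' v‖ ≤ L * ‖u - v‖)
    (hmaps : ∀ u ∈ (V α).carrier, σ u ∈ (V α).carrier) (hLip : 0 < Lip)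
    (hσα_lip : ∀ R > 0, ∀ u ∈ (V α).carrier, ∀ v ∈ (V α).carrier,
      (V α).nrm u ≤ R → (V α).nrm v ≤ R →
      (V α).nrm (σ u - σ v) ≤ Lip * (1 + R) ^ ω * (V α).nrm (u - v)) {z₁ z₂ : ℝ → X}
    (h₁ : z₁ 0 = 0) (h₂ : z₂ 0 = 0) (hR : 0 ≤ R) (hz₁ : IncrBd S (V α) α 0 R z₁)
    (hz₂ : IncrBd S (V α) α 0 R z₂) (hs₁ : SolvesConv S x (σ ∘ fun t => S t ψ + z₁ t) z₁)
    (hs₂ : SolvesConv S x (σ ∘ fun t => S t ψ + z₂ t) z₂) {t : ℝ} (ht : 0 ≤ t) (ht1 : t ≤ 1) :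
    z₁ t = z₂ t := by
  obtain ⟨l, hl, hc⟩ := exists_contraction hS hη hα hα₁ hηα hH hx hθ₀ hθα hψ hω hγ hκ hακ hγκ hK hσ
    hσK hσ_lip hmaps hLip hσα_lip hR
  -- Both functions reproduce themselves under the solution map, so the contraction halves the same
  -- bound indefinitely.
  have hn : ∀ n : ℕ, IncrBd S (V α) α l ((R + R) * (1 / 2) ^ n) (fun t => z₁ t - z₂ t) := by
    intro n
    induction n with
    | zero => simpa using (hz₁.sub hz₂).weight (by linarith) hl.le
    | succ n ih =>
      refine (hc _ z₁ z₂ z₁ z₂ (by positivity) h₁ h₂ hz₁ hz₂ ih h₁ h₂ hz₁ hz₂ hs₁ hs₂).mono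
        (le_of_eq ?_)
      rw [pow_succ]; ring
  have := eq_zero_of_incrBd_geometric hS hα hα₁ (by simp [h₁, h₂]) hn ht ht1
  exact sub_eq_zero.1 this

/-- Existence of the fixed point. -/
lemma exists_fixedPoint [CompleteSpace X] (hS : SemigroupScale A S V) (hη : 0 < η) (hα : 0 < α)
    (hα₁ : α < 1) (hηα : 1 < η + α) (hH : 0 ≤ H)
    (hx : ∀ u v, 0 ≤ u → u ≤ v → v ≤ 1 → |x v - x u| ≤ H * (v - u) ^ η)
    (hθ₀ : 0 ≤ θ) (hθα : θ ≤ α) (hψ : ψ ∈ (V θ).carrier) (hω : 0 < ω)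
    (hγ : (1 + ω) * (α - θ) ≤ γ) (hκ : 0 < κ) (hακ : α + κ < 1) (hγκ : α + γ + κ ≤ η) (hK : 0 ≤ K)
    (hσ : ∀ u h : X, HasLineDerivAt ℝ σ (σ' u h) u h) (hσK : ∀ u, ‖σ' u‖ ≤ K)
    (hσ_lip : ∀ R > 0, ∃ L : ℝ, ∀ u v : X, ‖u‖ ≤ R → ‖v‖ ≤ R → ‖σ' u - σ' v‖ ≤ L * ‖u - v‖)
    (hmaps : ∀ u ∈ (V α).carrier, σ u ∈ (V α).carrier) (hLip : 0 < Lip)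
    (hσα_lip : ∀ R > 0, ∀ u ∈ (V α).carrier, ∀ v ∈ (V α).carrier,
      (V α).nrm u ≤ R → (V α).nrm v ≤ R →
      (V α).nrm (σ u - σ v) ≤ Lip * (1 + R) ^ ω * (V α).nrm (u - v)) (hL : 0 < L)
    (hgrowth : ∀ u ∈ (V α).carrier, (V α).nrm (σ u) ≤ L * (1 + (V α).nrm u)) :
    ∃ z : ℝ → X, z 0 = 0 ∧ (∃ R, 0 ≤ R ∧ IncrBd S (V α) α 0 R z) ∧
      SolvesConv S x (σ ∘ fun t => S t ψ + z t) z := by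
  have hδγ : α - θ ≤ γ := by nlinarith
  obtain ⟨l₀, hl₀, hinv⟩ := exists_invariant hS hη hα hα₁ hηα hH hx hθ₀ hθα hψ hδγ hκ hακ hγκ hK
    (norm_sub_le_of_lineDeriv hσ hσK) hL hmaps hgrowth
  obtain ⟨l, hl, hc⟩ := exists_contraction hS hη hα hα₁ hηα hH hx hθ₀ hθα hψ hω hγ hκ hακ hγκ hK hσ
    hσK hσ_lip hmaps hLip hσα_lip (R := 1 * Real.exp l₀) (by positivity)
  obtain ⟨Ke, hKe, hemb⟩ := hS.norm_le_of_bd hα.le (by linarith : α < 2)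
  -- There are two weights: l₀ makes the unit ball invariant, R is the resulting unweighted bound on
  -- that ball, and l is then chosen to contract among functions bounded by R.
  set R := 1 * Real.exp l₀ with hR
  have hR0 : 0 ≤ R := by positivity
  set Good : (ℝ → X) → Prop := fun z => z 0 = 0 ∧ IncrBd S (V α) α l₀ 1 z with hGood
  choose! Γ hΓ hΓs using hinv
  have hzero : Good (fun _ => 0) := by
    refine ⟨rfl, fun s t _ hst _ => ?_⟩
    have : 0 ≤ (t - s) ^ α := Real.rpow_nonneg (by linarith) α
    rw [hatDelta₁, map_zero, sub_zero]
    exact (V α).bd_zero (by positivity)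
  set ζ : ℕ → ℝ → X := fun n => Γ^[n] (fun _ => 0) with hζ
  have hζs : ∀ n, ζ (n + 1) = Γ (ζ n) := fun n => Function.iterate_succ_apply' Γ n _
  have hgood : ∀ n, Good (ζ n) := by
    intro n
    induction n with
    | zero => exact hzero
    | succ n ih => rw [hζs]; exact hΓ _ ih
  have hbdR : ∀ z, Good z → IncrBd S (V α) α 0 R z := fun z hz =>
    hz.2.unweight zero_le_one hl₀.le
  have hsolve : ∀ n, SolvesConv S x (σ ∘ fun t => S t ψ + ζ n t) (ζ (n + 1)) := fun n => by
    rw [hζs]; exact hΓs _ (hgood n)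
  have hdiff : ∀ n : ℕ, IncrBd S (V α) α l ((R + R) * (1 / 2) ^ n)
      (fun t => ζ (n + 1) t - ζ n t) := by
    intro n
    induction n with
    | zero =>
      simpa using ((hbdR _ (hgood 1)).sub (hbdR _ (hgood 0))).weight (by linarith) hl.le
    | succ n ih =>
      refine (hc _ (ζ (n + 1)) (ζ n) (ζ (n + 2)) (ζ (n + 1)) (by positivity) (hgood _).1 (hgood _).1
        (hbdR _ (hgood _)) (hbdR _ (hgood _)) ih (hgood _).1 (hgood _).1 (hbdR _ (hgood _))
        (hbdR _ (hgood _)) (hsolve _) (hsolve _)).mono (le_of_eq ?_)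
      rw [pow_succ]; ring
  have hq₀ : (0 : ℝ) ≤ 1 / 2 := by norm_num
  have hq₁ : (1 / 2 : ℝ) < 1 := by norm_num
  have hgeo : ∀ c : ℝ, Tendsto (fun n : ℕ => c * (1 / 2) ^ n) atTop (𝓝 0) := fun c => by
    have := (tendsto_pow_atTop_nhds_zero_of_lt_one hq₀ hq₁).const_mul c
    rwa [mul_zero] at this
  have hlim : ∀ t, ∃ v : X, 0 ≤ t → t ≤ 1 → Tendsto (fun n => ζ n t) atTop (𝓝 v) := by
    intro t
    by_cases ht : 0 ≤ t ∧ t ≤ 1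
    · have hinc : ∀ n, (V α).Bd (ζ (n + 1) t - ζ n t)
          ((R + R) * Real.exp (l * t) * (1 / 2) ^ n) := fun n =>
        ((hdiff n).bd_self hα (by simp [(hgood _).1]) ht.1 ht.2).mono (le_of_eq (by ring))
      obtain ⟨v, hv⟩ := (V α).exists_limit (w := fun n => ζ n t) (hgeo _)
        (BanachSubspace.bd_sub_of_geometric hq₀ hq₁ hinc)
      refine ⟨v, fun _ _ => ?_⟩
      rw [tendsto_iff_norm_sub_tendsto_zero]
      have := (hgeo ((R + R) * Real.exp (l * t) / (1 - 1 / 2))).const_mul Ke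
      rw [mul_zero] at this
      exact squeeze_zero (fun _ => norm_nonneg _) (fun n => hemb _ _ (hv n).sub_comm) this
    · exact ⟨0, fun h1 h2 => absurd ⟨h1, h2⟩ ht⟩
  choose z hz using hlim
  have hz0 : z 0 = 0 := by
    refine tendsto_nhds_unique (hz 0 le_rfl zero_le_one) ?_
    simp only [(hgood _).1, tendsto_const_nhds]
  have hδlim : ∀ s t, 0 ≤ s → s ≤ t → t ≤ 1 →
      Tendsto (fun n => hatDelta₁ S (ζ n) s t) atTop (𝓝 (hatDelta₁ S z s t)) := fun s t hs hst ht =>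
    (hz t (by linarith) ht).sub (((S (t - s)).continuous.tendsto _).comp (hz s hs (by linarith)))
  have hδbd : ∀ s t, 0 ≤ s → s ≤ t → t ≤ 1 → ∀ n,
      (V α).Bd (hatDelta₁ S z s t - hatDelta₁ S (ζ n) s t)
        ((R + R) * Real.exp (l * t) * (t - s) ^ α / (1 - 1 / 2) * (1 / 2) ^ n) := by
    intro s t hs hst ht
    refine BanachSubspace.bd_of_tendsto_geometric hemb hq₀ hq₁ (fun n => ?_) (hδlim s t hs hst ht)
    have := hdiff n s t hs hst ht
    rw [hatDelta₁_sub] at this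
    exact this.mono (le_of_eq (by ring))
  have hzgood : Good z := ⟨hz0, fun s t hs hst ht =>
    BanachSubspace.Bd.of_tendsto (hgeo _) (hδbd s t hs hst ht) (fun n => (hgood n).2 s t hs hst ht)⟩
  have hzdiff : ∀ n : ℕ, IncrBd S (V α) α l ((R + R) * 2 * (1 / 2) ^ n)
      (fun t => z t - ζ n t) := by
    intro n s t hs hst ht
    rw [hatDelta₁_sub]
    exact (hδbd s t hs hst ht n).mono (le_of_eq (by ring))
  -- Both Γz and z are close to the iterate ζ(n+1), the former by contraction and the latter by
  -- convergence; the factor 4 is generous.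
  have hΓdiff : ∀ n : ℕ, IncrBd S (V α) α l ((R + R) * 4 * (1 / 2) ^ n)
      (fun t => Γ z t - z t) := by
    intro n
    have h1 := hc _ z (ζ n) (Γ z) (ζ (n + 1)) (by positivity) hz0 (hgood n).1 (hbdR _ hzgood)
      (hbdR _ (hgood n)) (hzdiff n) (hΓ z hzgood).1 (hgood _).1 (hbdR _ (hΓ z hzgood))
      (hbdR _ (hgood _)) (hΓs z hzgood) (hsolve n)
    have h2 := (h1.sub (hzdiff (n + 1))).mono (R₂ := (R + R) * 4 * (1 / 2) ^ n) (by
      rw [pow_succ]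
      have : 0 ≤ (R + R) * (1 / 2) ^ n := by positivity
      nlinarith)
    intro s t hs hst ht
    convert h2 s t hs hst ht using 1
    simp only [hatDelta₁, map_sub]
    abel
  have heq : ∀ t, 0 ≤ t → t ≤ 1 → Γ z t = z t := fun t ht ht1 =>
    sub_eq_zero.1 (eq_zero_of_incrBd_geometric hS hα hα₁
      (z := fun t => Γ z t - z t) (by simp [(hΓ z hzgood).1, hz0]) hΓdiff ht ht1)
  refine ⟨z, hz0, ⟨R, hR0, hbdR z hzgood⟩, fun s t hs hst ht => ?_⟩
  have := hΓs z hzgood s t hs hst ht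
  rwa [hatDelta₁, heq t (by linarith) ht, heq s hs.le (by linarith)] at this

end FixedPoint

/-! ### Calculus of continuity in a subspace norm -/

namespace BanachSubspace

variable {X : Type*} [NormedAddCommGroup X] [NormedSpace ℝ X] {E F : BanachSubspace X}

lemma tendsto_nrm_of_bd {ι : Type*} {l : Filter ι} {g : ι → X}
    (h : ∀ ε > 0, ∀ᶠ i in l, E.Bd (g i) ε) : Tendsto (fun i => E.nrm (g i)) l (𝓝 0) := by
  rw [Metric.tendsto_nhds]
  intro ε hε
  filter_upwards [h (ε / 2) (by positivity)] with i hi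
  rw [Real.dist_eq, sub_zero, abs_of_nonneg (E.nrm_nonneg _ hi.1)]
  linarith [hi.2]

lemma bd_of_tendsto_nrm {ι : Type*} {l : Filter ι} {g : ι → X}
    (hm : ∀ᶠ i in l, g i ∈ E.carrier) (h : Tendsto (fun i => E.nrm (g i)) l (𝓝 0)) {ε : ℝ}
    (hε : 0 < ε) : ∀ᶠ i in l, E.Bd (g i) ε := by
  filter_upwards [hm, h.eventually (gt_mem_nhds hε)] with i h1 h2
  exact ⟨h1, h2.le⟩

variable {Q : Type*} [TopologicalSpace Q] {f g : Q → X} {D D' : Set Q}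

lemma ContOn.of_bd (h : ∀ p ∈ D, f p ∈ E.carrier)
    (h' : ∀ p ∈ D, ∀ ε > 0, ∀ᶠ q in 𝓝[D] p, E.Bd (f q - f p) ε) : E.ContOn f D :=
  ⟨h, fun p hp => tendsto_nrm_of_bd (h' p hp)⟩

lemma ContOn.bd (h : E.ContOn f D) {p : Q} (hp : p ∈ D) {ε : ℝ} (hε : 0 < ε) :
    ∀ᶠ q in 𝓝[D] p, E.Bd (f q - f p) ε :=
  bd_of_tendsto_nrm (by
    filter_upwards [self_mem_nhdsWithin] with q hq
    exact E.carrier.sub_mem (h.1 q hq) (h.1 p hp)) (h.2 p hp) hε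

lemma ContOn.add (hf : E.ContOn f D) (hg : E.ContOn g D) : E.ContOn (fun q => f q + g q) D := by
  refine ContOn.of_bd (fun p hp => E.carrier.add_mem (hf.1 p hp) (hg.1 p hp)) fun p hp ε hε => ?_
  filter_upwards [hf.bd hp (half_pos hε), hg.bd hp (half_pos hε)] with q h1 h2
  rw [add_sub_add_comm]
  exact (h1.add h2).mono (by linarith)

lemma ContOn.sub (hf : E.ContOn f D) (hg : E.ContOn g D) : E.ContOn (fun q => f q - g q) D := by
  refine ContOn.of_bd (fun p hp => E.carrier.sub_mem (hf.1 p hp) (hg.1 p hp)) fun p hp ε hε => ?_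
  filter_upwards [hf.bd hp (half_pos hε), hg.bd hp (half_pos hε)] with q h1 h2
  rw [sub_sub_sub_comm]
  exact (h1.sub h2).mono (by linarith)

lemma ContOn.congr (hf : E.ContOn f D) (h : ∀ q ∈ D, g q = f q) : E.ContOn g D := by
  refine ContOn.of_bd (fun p hp => by rw [h p hp]; exact hf.1 p hp) fun p hp ε hε => ?_
  filter_upwards [hf.bd hp hε, self_mem_nhdsWithin] with q h1 hq
  rwa [h q hq, h p hp]

lemma ContOn.embed (hf : E.ContOn f D) {K : ℝ} (hK : 0 < K)
    (h : ∀ u c, E.Bd u c → F.Bd u (K * c)) : F.ContOn f D := by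
  refine ContOn.of_bd (fun p hp => (h _ _ (bd_nrm (hf.1 p hp))).1) fun p hp ε hε => ?_
  filter_upwards [hf.bd hp (div_pos hε hK)] with q h1
  have := h _ _ h1
  rwa [mul_div_cancel₀ _ hK.ne'] at this

lemma ContOn.comp {P : Type*} [TopologicalSpace P] {C : Set P} {u : P → Q} (hf : E.ContOn f D)
    (hu : Continuous u) (hCD : MapsTo u C D) : E.ContOn (fun p => f (u p)) C := by
  refine ⟨fun p hp => hf.1 _ (hCD hp), fun p hp => ?_⟩
  exact (hf.2 _ (hCD hp)).comp (hu.continuousWithinAt.tendsto_nhdsWithin hCD)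

/-- Continuity on a union of relatively open pieces. -/
lemma ContOn.of_local (h : ∀ p ∈ D, ∃ U ∈ 𝓝 p, E.ContOn f (D ∩ U)) : E.ContOn f D := by
  refine ⟨fun p hp => ?_, fun p hp => ?_⟩
  · obtain ⟨U, hU, hf⟩ := h p hp
    exact hf.1 p ⟨hp, mem_of_mem_nhds hU⟩
  · obtain ⟨U, hU, hf⟩ := h p hp
    have := hf.2 p ⟨hp, mem_of_mem_nhds hU⟩
    rwa [nhdsWithin_inter_of_mem' (mem_nhdsWithin_of_mem_nhds hU)] at this

lemma ContOn.mono (hf : E.ContOn f D) (h : D' ⊆ D) : E.ContOn f D' :=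
  ⟨fun p hp => hf.1 p (h hp), fun p hp => (hf.2 p (h hp)).mono_left (nhdsWithin_mono p h)⟩

end BanachSubspace

/-! ### Joint continuity of δ̂₁z and of the germ -/

section Regularity

variable {X : Type*} [NormedAddCommGroup X] [NormedSpace ℝ X] {A : X →ₗ.[ℝ] X}
  {S : ℝ → X →L[ℝ] X} {V : ℝ → BanachSubspace X} {x : ℝ → ℝ}

lemma hatDelta₁_self (hS : SemigroupScale A S V) (z : ℝ → X) (s : ℝ) : hatDelta₁ S z s s = 0 := by
  simp [hatDelta₁, hS.zero_apply]

lemma hatDelta₁_cocycle (hS : SemigroupScale A S V) (z : ℝ → X) {r s t : ℝ} (hrs : r ≤ s)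
    (hst : s ≤ t) : hatDelta₁ S z r t = hatDelta₁ S z s t + S (t - s) (hatDelta₁ S z r s) := by
  simp only [hatDelta₁, map_sub]
  rw [hS.sub_apply hrs hst]
  abel

lemma tendsto_const_mul_rpow {ι : Type*} {F : Filter ι} {f : ι → ℝ} {κ : ℝ} (hκ : 0 < κ)
    (hf : Tendsto f F (𝓝 0)) (C : ℝ) : Tendsto (fun i => C * f i ^ κ) F (𝓝 0) := by
  have := (hf.rpow_const (p := κ) (Or.inr hκ.le)).const_mul C
  rwa [Real.zero_rpow hκ.ne', mul_zero] at this

/-- A Hölder bound for `δ̂₁ z` implies its joint continuity. -/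
lemma contOn_hatDelta₁ (hS : SemigroupScale A S V) {l κ C a : ℝ} (hl₀ : 0 ≤ l) (hl : l < 1)
    (hκ : 0 < κ) (ha : 0 ≤ a) {z : ℝ → X}
    (hz : ∀ s t, a ≤ s → s ≤ t → t ≤ 1 → (V l).Bd (hatDelta₁ S z s t) (C * (t - s) ^ κ)) :
    (V l).ContOn (fun p : ℝ × ℝ => hatDelta₁ S z p.1 p.2)
      {p | a ≤ p.1 ∧ p.1 ≤ p.2 ∧ p.2 ≤ 1} := by
  refine BanachSubspace.ContOn.of_bd (fun p hp => (hz _ _ hp.1 hp.2.1 hp.2.2).1) ?_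
  rintro ⟨s, t⟩ ⟨hs, hst, ht⟩ ε hε
  simp only at hs hst ht
  have hD : ∀ᶠ q : ℝ × ℝ in 𝓝[{p | a ≤ p.1 ∧ p.1 ≤ p.2 ∧ p.2 ≤ 1}] (s, t),
      a ≤ q.1 ∧ q.1 ≤ q.2 ∧ q.2 ≤ 1 := self_mem_nhdsWithin
  rcases hst.eq_or_lt with rfl | hst
  · have h1 : Tendsto (fun q : ℝ × ℝ => C * (q.2 - q.1) ^ κ)
        (𝓝[{p | a ≤ p.1 ∧ p.1 ≤ p.2 ∧ p.2 ≤ 1}] (s, s)) (𝓝 0) := by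
      refine tendsto_const_mul_rpow hκ ?_ C
      have : Continuous fun q : ℝ × ℝ => q.2 - q.1 := by fun_prop
      have h2 := this.tendsto (s, s)
      simp only [sub_self] at h2
      exact h2.mono_left nhdsWithin_le_nhds
    filter_upwards [hD, h1.eventually (gt_mem_nhds hε)] with q hq h2
    simp only [hatDelta₁_self hS, sub_zero]
    exact (hz _ _ hq.1 hq.2.1 hq.2.2).mono h2.le
  -- Off the diagonal, pick c just below t and split δ̂₁z at c: the piece from c to t is small by
  -- the Hölder bound, and in the other one S acts for a positive time, so continuity of δ̂₁z(·,c)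
  -- in X is enough. No continuity of z is assumed.
  · obtain ⟨L₀, hL₀, hS0⟩ := hS.norm_apply_le
    obtain ⟨K, hK, hemb⟩ := hS.norm_le_of_bd hl₀ (by linarith)
    obtain ⟨c, hc, hcst⟩ : ∃ c, C * (t - c) ^ κ < ε / 4 ∧ c ∈ Ioo s t := by
      have h1 : Tendsto (fun c => C * (t - c) ^ κ) (𝓝[<] t) (𝓝 0) := by
        refine tendsto_const_mul_rpow hκ ?_ C
        have : Continuous fun c : ℝ => t - c := by fun_prop
        have h2 := this.tendsto t
        rw [sub_self] at h2
        exact h2.mono_left nhdsWithin_le_nhds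
      exact ((h1.eventually (gt_mem_nhds (by positivity))).and (Ioo_mem_nhdsLT hst)).exists
    have hfst : Tendsto (fun q : ℝ × ℝ => q.1) (𝓝[{p | a ≤ p.1 ∧ p.1 ≤ p.2 ∧ p.2 ≤ 1}] (s, t))
        (𝓝 s) := (continuous_fst.tendsto (s, t)).mono_left nhdsWithin_le_nhds
    have hsnd : Tendsto (fun q : ℝ × ℝ => q.2) (𝓝[{p | a ≤ p.1 ∧ p.1 ≤ p.2 ∧ p.2 ≤ 1}] (s, t))
        (𝓝 t) := (continuous_snd.tendsto (s, t)).mono_left nhdsWithin_le_nhds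
    have hc1 := hfst.eventually (gt_mem_nhds hcst.1)
    have hc2 := hsnd.eventually (lt_mem_nhds hcst.2)
    have hc3 : ∀ᶠ q : ℝ × ℝ in 𝓝[{p | a ≤ p.1 ∧ p.1 ≤ p.2 ∧ p.2 ≤ 1}] (s, t),
        C * (q.2 - c) ^ κ < ε / 4 := by
      have : Tendsto (fun r : ℝ => C * (r - c) ^ κ) (𝓝 t) (𝓝 (C * (t - c) ^ κ)) :=
        ((tendsto_id.sub_const c).rpow_const (Or.inr hκ.le)).const_mul C
      exact (this.comp hsnd).eventually (gt_mem_nhds hc)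
    have hf : Tendsto (fun q : ℝ × ℝ => hatDelta₁ S z q.1 c)
        (𝓝[{p | a ≤ p.1 ∧ p.1 ≤ p.2 ∧ p.2 ≤ 1}] (s, t)) (𝓝 (hatDelta₁ S z s c)) := by
      rw [tendsto_iff_norm_sub_tendsto_zero]
      have h1 : Tendsto (fun q : ℝ × ℝ => L₀ * (K * C) * |q.1 - s| ^ κ)
          (𝓝[{p | a ≤ p.1 ∧ p.1 ≤ p.2 ∧ p.2 ≤ 1}] (s, t)) (𝓝 0) := by
        refine tendsto_const_mul_rpow hκ ?_ _
        have := tendsto_iff_norm_sub_tendsto_zero.1 hfst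
        simpa using this
      refine squeeze_zero' (Eventually.of_forall fun _ => norm_nonneg _) ?_ h1
      have hkey : ∀ r r', a ≤ r → r ≤ r' → r' ≤ c →
          ‖hatDelta₁ S z r c - hatDelta₁ S z r' c‖ ≤ L₀ * (K * C) * (r' - r) ^ κ := by
        intro r r' hr hrr hr'
        rw [hatDelta₁_cocycle hS z hrr hr', add_sub_cancel_left]
        have hc1 : c ≤ 1 := by linarith [hcst.2]
        refine (hS0 _ _ (by linarith) (by linarith)).trans ?_
        have := hemb _ _ (hz r r' hr hrr (by linarith))
        calc L₀ * ‖hatDelta₁ S z r r'‖ ≤ L₀ * (K * (C * (r' - r) ^ κ)) := by gcongr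
          _ = _ := by ring
      filter_upwards [hD, hc1] with q hq hq1
      rcases le_total q.1 s with h | h
      · rw [abs_of_nonpos (by linarith), neg_sub]
        exact hkey _ _ hq.1 h hcst.1.le
      · rw [abs_of_nonneg (by linarith), norm_sub_rev]
        exact hkey _ _ hs h hq1.le
    have hτ : Tendsto (fun q : ℝ × ℝ => q.2 - c)
        (𝓝[{p | a ≤ p.1 ∧ p.1 ≤ p.2 ∧ p.2 ≤ 1}] (s, t)) (𝓝 (t - c)) := hsnd.sub_const c
    have hmain := hS.tendsto_nrm_apply hl₀ hl (by linarith [hcst.2]) (by linarith [hcst.1]) hτ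
      (by filter_upwards [hD] with q hq; linarith [hcst.1, hq.2.2]) hf
    filter_upwards [hD, hc1, hc2, hc3, BanachSubspace.bd_of_tendsto_nrm hmain.1 hmain.2
      (by positivity : 0 < ε / 4)] with q hq h1 h2 h3 h4
    have e : hatDelta₁ S z q.1 q.2 - hatDelta₁ S z s t =
        hatDelta₁ S z c q.2 - hatDelta₁ S z c t +
        (S (q.2 - c) (hatDelta₁ S z q.1 c) - S (t - c) (hatDelta₁ S z s c)) := by
      rw [hatDelta₁_cocycle hS z h1.le h2.le, hatDelta₁_cocycle hS z hcst.1.le hcst.2.le]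
      abel
    rw [e]
    have h5 := (hz c q.2 (by linarith [hcst.1]) h2.le hq.2.2).mono h3.le
    have h6 := (hz c t (by linarith [hcst.1]) hcst.2.le ht).mono hc.le
    exact ((h5.sub h6).add h4).mono (by linarith)

/-- Joint continuity of the germ `S(t-s) (x(t) - x(s)) φ(s)`. -/
lemma contOn_germ (hS : SemigroupScale A S V) {l κ C a : ℝ} (hl₀ : 0 ≤ l) (hl : l < 1)
    (hκ : 0 < κ) (ha : 0 ≤ a) {φ : ℝ → X} (hx : ContinuousOn x (Icc 0 1))
    (hφ : ContinuousOn φ (Icc a 1))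
    (hb : ∀ s t, a ≤ s → s ≤ t → t ≤ 1 →
      (V l).Bd (S (t - s) ((x t - x s) • φ s)) (C * (t - s) ^ κ)) :
    (V l).ContOn (fun p : ℝ × ℝ => S (p.2 - p.1) ((x p.2 - x p.1) • φ p.1))
      {p | a ≤ p.1 ∧ p.1 ≤ p.2 ∧ p.2 ≤ 1} := by
  refine BanachSubspace.ContOn.of_bd (fun p hp => (hb _ _ hp.1 hp.2.1 hp.2.2).1) ?_
  rintro ⟨s, t⟩ ⟨hs, hst, ht⟩ ε hε
  simp only at hs hst ht
  have hD : ∀ᶠ q : ℝ × ℝ in 𝓝[{p | a ≤ p.1 ∧ p.1 ≤ p.2 ∧ p.2 ≤ 1}] (s, t),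
      a ≤ q.1 ∧ q.1 ≤ q.2 ∧ q.2 ≤ 1 := self_mem_nhdsWithin
  rcases hst.eq_or_lt with rfl | hst
  · have h1 : Tendsto (fun q : ℝ × ℝ => C * (q.2 - q.1) ^ κ)
        (𝓝[{p | a ≤ p.1 ∧ p.1 ≤ p.2 ∧ p.2 ≤ 1}] (s, s)) (𝓝 0) := by
      refine tendsto_const_mul_rpow hκ ?_ C
      have : Continuous fun q : ℝ × ℝ => q.2 - q.1 := by fun_prop
      have h2 := this.tendsto (s, s)
      simp only [sub_self] at h2
      exact h2.mono_left nhdsWithin_le_nhds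
    filter_upwards [hD, h1.eventually (gt_mem_nhds hε)] with q hq h2
    simp only [sub_self, zero_smul, map_zero, sub_zero]
    exact (hb _ _ hq.1 hq.2.1 hq.2.2).mono h2.le
  · have hcont : ContinuousOn (fun q : ℝ × ℝ => (x q.2 - x q.1) • φ q.1)
        {p | a ≤ p.1 ∧ p.1 ≤ p.2 ∧ p.2 ≤ 1} := by
      refine ContinuousOn.smul (ContinuousOn.sub ?_ ?_) ?_
      · exact hx.comp continuousOn_snd fun q hq => ⟨by linarith [hq.1, hq.2.1], hq.2.2⟩
      · exact hx.comp continuousOn_fst fun q hq => ⟨by linarith [hq.1], hq.2.1.trans hq.2.2⟩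
      · exact hφ.comp continuousOn_fst fun q hq => ⟨hq.1, hq.2.1.trans hq.2.2⟩
    have hτ : Tendsto (fun q : ℝ × ℝ => q.2 - q.1)
        (𝓝[{p | a ≤ p.1 ∧ p.1 ≤ p.2 ∧ p.2 ≤ 1}] (s, t)) (𝓝 (t - s)) := by
      have : Continuous fun q : ℝ × ℝ => q.2 - q.1 := by fun_prop
      exact (this.tendsto (s, t)).mono_left nhdsWithin_le_nhds
    have hmain := hS.tendsto_nrm_apply hl₀ hl (by linarith) (by linarith) hτ
      (by filter_upwards [hD] with q hq; linarith [hq.1, hq.2.2])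
      (hcont (s, t) ⟨hs, hst.le, ht⟩).tendsto
    exact BanachSubspace.bd_of_tendsto_nrm hmain.1 hmain.2 hε

end Regularity

/-! ### Passage between fixed points and mild solutions -/

section MildSolution

variable {X : Type*} [NormedAddCommGroup X] [NormedSpace ℝ X] {A : X →ₗ.[ℝ] X}
  {S : ℝ → X →L[ℝ] X} {V : ℝ → BanachSubspace X} {x : ℝ → ℝ} {σ : X → X} {ψ : X} {z : ℝ → X}
  {α θ η H R ω Lip γ P : ℝ}

lemma IncrBd.bd_zero_weight {E : BanachSubspace X} (hz : IncrBd S E α 0 R z) {s t : ℝ} (hs : 0 ≤ s)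
    (hst : s ≤ t) (ht : t ≤ 1) : E.Bd (hatDelta₁ S z s t) (R * (t - s) ^ α) := by
  have := hz s t hs hst ht
  rwa [zero_mul, Real.exp_zero, mul_one] at this

/-- Smoothing makes the orbit continuous in X_α for t > 0, without strong continuity at 0; z
inherits continuity from the joint continuity of δ̂₁z because z(t) = δ̂₁z(0,t). -/
lemma contOn_orbit_add (hS : SemigroupScale A S V) (hα : 0 < α) (hα₁ : α < 1) (h0 : z 0 = 0)
    (hz : IncrBd S (V α) α 0 R z) :
    (∀ t ∈ Ioc (0 : ℝ) 1, S t ψ ∈ (V α).carrier) ∧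
    (V α).ContOn (fun t => S t ψ + z t) (Ioc 0 1) := by
  obtain ⟨L, hL, hsm⟩ := hS.bd_smoothing le_rfl hα.le (by linarith : α < 2)
  have hmem : ∀ t ∈ Ioc (0 : ℝ) 1, S t ψ ∈ (V α).carrier := fun t ht =>
    (hsm t ψ ‖ψ‖ ht.1 ht.2 (hS.bd_zero_iff.2 le_rfl)).1
  refine ⟨hmem, BanachSubspace.ContOn.add ⟨hmem, fun t ht => ?_⟩ ?_⟩
  · refine (hS.tendsto_nrm_apply hα.le hα₁ ht.1 ht.2
      (tendsto_id.mono_left nhdsWithin_le_nhds) ?_ tendsto_const_nhds).2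
    filter_upwards [self_mem_nhdsWithin] with q hq
    exact hq.2
  · have h1 := contOn_hatDelta₁ hS hα.le hα₁ hα le_rfl (fun s t => hz.bd_zero_weight)
    have h2 := h1.comp (u := fun t : ℝ => ((0 : ℝ), t)) (C := Ioc 0 1) (by fun_prop)
      (fun t ht => ⟨le_rfl, ht.1.le, ht.2⟩)
    exact h2.congr fun t _ => (hatDelta₁_zero_left h0 t).symm

lemma memY_orbit_add (hS : SemigroupScale A S V) (hα : 0 < α) (hα₁ : α < 1) (hθ₀ : 0 ≤ θ)
    (hθα : θ ≤ α) (hψ : ψ ∈ (V θ).carrier) (h0 : z 0 = 0) (hR : 0 ≤ R)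
    (hz : IncrBd S (V α) α 0 R z) : MemY S V α (α - θ) 1 (fun t => S t ψ + z t) := by
  obtain ⟨N, hN, hbd⟩ := exists_bd_orbit_add hS hα hα₁ hθ₀ hθα hψ
  obtain ⟨L₀, hL₀, hS0⟩ := hS.norm_apply_le
  obtain ⟨K, hK, hemb⟩ := hS.bd_embedding le_rfl hα.le (by linarith : α < 2)
  have hc := (contOn_orbit_add (ψ := ψ) hS hα hα₁ h0 hz).2
  refine ⟨⟨hc, N + R, fun t ht => ?_⟩, ⟨hc.embed hK hemb, L₀ * ‖ψ‖ + K * R,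
    fun t ht => ?_⟩, ?_, ?_, ?_⟩
  · have h1 := (hbd 0 R z le_rfl hR h0 hz t ht.1 ht.2).2
    rw [zero_mul, Real.exp_zero, mul_one] at h1
    rw [sub_zero]
    have h2 : t ^ (α - θ) * t ^ (-(α - θ)) = 1 := by
      rw [← Real.rpow_add ht.1, add_neg_cancel, Real.rpow_zero]
    have h3 : 0 ≤ t ^ (α - θ) := Real.rpow_nonneg ht.1.le _
    calc t ^ (α - θ) * (V α).nrm (S t ψ + z t) ≤ t ^ (α - θ) * ((N + R) * t ^ (-(α - θ))) := by
          gcongr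
      _ = (N + R) * (t ^ (α - θ) * t ^ (-(α - θ))) := by ring
      _ = N + R := by rw [h2, mul_one]
  · rw [Real.rpow_zero, one_mul, hS.nrm_zero]
    refine norm_add_le_of_le (hS0 t ψ ht.1.le ht.2) ?_
    have h1 := hz.bd_self hα h0 ht.1.le ht.2
    rw [zero_mul, Real.exp_zero, mul_one] at h1
    exact hS.bd_zero_iff.1 (hemb _ _ h1)
  · exact (contOn_hatDelta₁ hS hα.le hα₁ hα le_rfl (fun s t => hz.bd_zero_weight)).congr
      fun q hq => hatDelta₁_orbit_add hS ψ z hq.1 hq.2.1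
  · exact fun s _ _ => hatDelta₁_self hS _ s
  · refine ⟨R, fun s t hs hst ht => ?_⟩
    rw [div_le_iff₀ (Real.rpow_pos_of_pos (by linarith) α), hatDelta₁_orbit_add hS ψ z hs hst.le]
    exact (hz.bd_zero_weight hs hst.le ht).2

lemma contOn_comp_of_locallyLipschitz (hLip : 0 < Lip) {y : ℝ → X}
    (hy : (V α).ContOn y (Ioc 0 1)) (hmaps : ∀ u ∈ (V α).carrier, σ u ∈ (V α).carrier)
    (hσα_lip : ∀ R > 0, ∀ u ∈ (V α).carrier, ∀ v ∈ (V α).carrier,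
      (V α).nrm u ≤ R → (V α).nrm v ≤ R →
      (V α).nrm (σ u - σ v) ≤ Lip * (1 + R) ^ ω * (V α).nrm (u - v)) :
    (V α).ContOn (σ ∘ y) (Ioc 0 1) := by
  refine BanachSubspace.ContOn.of_bd (fun t ht => hmaps _ (hy.1 t ht)) fun t ht ε hε => ?_
  set B := (V α).nrm (y t) + 1 with hB
  have hB0 : 0 < B := by linarith [(V α).nrm_nonneg _ (hy.1 t ht)]
  have hG : 0 < Lip * (1 + B) ^ ω := by positivity
  filter_upwards [hy.bd ht one_pos, hy.bd ht (div_pos hε hG), self_mem_nhdsWithin] with q h1 h2 hq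
  have h3 : (V α).Bd (y q) B := by
    have := (BanachSubspace.bd_nrm (hy.1 t ht)).add h1
    rwa [add_sub_cancel] at this
  refine ⟨(V α).carrier.sub_mem (hmaps _ (hy.1 q hq)) (hmaps _ (hy.1 t ht)), ?_⟩
  refine (hσα_lip B hB0 _ (hy.1 q hq) _ (hy.1 t ht) h3.2 (by linarith)).trans ?_
  calc Lip * (1 + B) ^ ω * (V α).nrm (y q - y t)
      ≤ Lip * (1 + B) ^ ω * (ε / (Lip * (1 + B) ^ ω)) := by gcongr; exact h2.2
    _ = ε := mul_div_cancel₀ _ hG.ne'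

lemma IsForcing.bd {φ : ℝ → X} (hφ : IsForcing S (V α) α γ 0 P φ) {s : ℝ} (hs : 0 < s)
    (hs1 : s ≤ 1) : (V α).Bd (φ s) (P * s ^ (-γ)) := by
  have := hφ.1 s hs hs1
  rwa [zero_mul, Real.exp_zero, mul_one] at this

lemma IsForcing.norm_le {φ : ℝ → X} (hφ : IsForcing S (V α) α γ 0 P φ) {s t : ℝ} (hs : 0 < s)
    (hst : s ≤ t) (ht : t ≤ 1) : ‖hatDelta₁ S φ s t‖ ≤ P * s ^ (-γ) * (t - s) ^ α := by
  have := hφ.2 s t hs hst ht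
  rwa [zero_mul, Real.exp_zero, mul_one] at this

lemma memSing_of_isForcing {φ : ℝ → X} (hφ : IsForcing S (V α) α γ 0 P φ)
    (hc : (V α).ContOn φ (Ioc 0 1)) : MemSing (V α) γ 0 1 φ := by
  refine ⟨hc, P, fun t ht => ?_⟩
  have h1 := (hφ.bd ht.1 ht.2).2
  have h2 : t ^ γ * t ^ (-γ) = 1 := by
    rw [← Real.rpow_add ht.1, add_neg_cancel, Real.rpow_zero]
  have h3 : 0 ≤ t ^ γ := Real.rpow_nonneg ht.1.le _
  rw [sub_zero]
  calc t ^ γ * (V α).nrm (φ t) ≤ t ^ γ * (P * t ^ (-γ)) := by gcongr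
    _ = P * (t ^ γ * t ^ (-γ)) := by ring
    _ = P := by rw [h2, mul_one]

lemma memIncrSing_of_isForcing (hS : SemigroupScale A S V) (hα : 0 < α) (hγ : 0 ≤ γ) (hP : 0 ≤ P)
    {φ : ℝ → X} (hφ : IsForcing S (V α) α γ 0 P φ) :
    MemIncrSing (V 0) α γ 0 1 (hatDelta₁ S φ) := by
  refine ⟨BanachSubspace.ContOn.of_local ?_, fun s _ _ => hatDelta₁_self hS φ s, P,
    fun s t hs hst ht => ?_⟩
  · rintro ⟨s, t⟩ ⟨hs, -, -⟩
    simp only at hs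
    -- Near (s,t) the first variable stays above s/2, where the weight is bounded and the
    -- nonsingular continuity result applies.
    refine ⟨{q | s / 2 < q.1}, (isOpen_lt continuous_const continuous_fst).mem_nhds
      (by simpa using hs), ?_⟩
    refine (contOn_hatDelta₁ hS (a := s / 2) (C := P * (s / 2) ^ (-γ)) le_rfl one_pos hα
      (by positivity) (z := φ) fun r t hr hrt ht => ?_).mono
        fun q hq => ⟨(le_of_lt hq.2 : s / 2 ≤ q.1), hq.1.2⟩
    refine hS.bd_zero_iff.2 ((hφ.norm_le (by linarith) hrt ht).trans ?_)
    have h1 : r ^ (-γ) ≤ (s / 2) ^ (-γ) :=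
      Real.rpow_le_rpow_of_nonpos (by positivity) hr (by linarith)
    have : 0 ≤ (t - r) ^ α := Real.rpow_nonneg (by linarith) α
    gcongr
  · have h1 := hφ.norm_le hs hst.le ht
    have h2 : s ^ γ * s ^ (-γ) = 1 := by
      rw [← Real.rpow_add hs, add_neg_cancel, Real.rpow_zero]
    have h3 : 0 < s ^ γ := Real.rpow_pos_of_pos hs _
    have h4 : 0 < (t - s) ^ α := Real.rpow_pos_of_pos (by linarith) α
    rw [sub_zero, hS.nrm_zero]
    calc s ^ γ * (‖hatDelta₁ S φ s t‖ / (t - s) ^ α)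
        ≤ s ^ γ * (P * s ^ (-γ) * (t - s) ^ α / (t - s) ^ α) := by gcongr
      _ = P * (s ^ γ * s ^ (-γ)) := by field_simp
      _ = P := by rw [h2, mul_one]

/-- The remainder of the convolution integral is the sewing function of its germ. -/
lemma isSewing_of_solvesConv (hS : SemigroupScale A S V) (hη : 0 < η) (hα : 0 < α) (hα₁ : α < 1)
    (hηα : 1 < η + α) (hH : 0 ≤ H)
    (hx : ∀ u v, 0 ≤ u → u ≤ v → v ≤ 1 → |x v - x u| ≤ H * (v - u) ^ η) (hγ : 0 ≤ γ) (hP : 0 ≤ P)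
    {φ : ℝ → X} (hφ : IsForcing S (V α) α γ 0 P φ) (hc : (V α).ContOn φ (Ioc 0 1))
    (hz : SolvesConv S x φ z) :
    IsSewing S V (η + α) 0 0 1 (fun s t => (x t - x s) • φ s)
      (fun s t => S (t - s) ((x t - x s) • φ s) - hatDelta₁ S z s t) := by
  have hxc : ContinuousOn x (Icc 0 1) := by
    have := continuous_of_holder (f := fun r => x (max 0 (min r 1))) hη
      (holder_clamp (f := x) zero_le_one hH hη hx)
    refine this.continuousOn.congr fun r hr => ?_
    simp only [min_eq_left hr.2, max_eq_right hr.1]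
  refine ⟨fun τ ε hτ hτ1 hε₀ hε₁ hε₂ => ?_, fun r s t hr hrs hst ht => ?_⟩
  · rw [zero_add] at hε₂
    rw [sub_zero] at hτ1
    rw [zero_add, zero_add]
    set B := P * τ ^ (-γ) with hB
    have hB0 : 0 ≤ B := by positivity
    have hφB : ∀ s, τ ≤ s → s ≤ 1 → (V α).Bd (φ s) B := fun s hs hs1 =>
      (hφ.bd (by linarith) hs1).mono (by
        exact mul_le_mul_of_nonneg_left (Real.rpow_le_rpow_of_nonpos hτ hs (by linarith)) hP)
    have hrem : ∀ e, 0 ≤ e → e < 1 → ∃ C, 0 ≤ C ∧ ∀ s t, τ ≤ s → s ≤ t → t ≤ 1 →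
        (V e).Bd (S (t - s) ((x t - x s) • φ s) - hatDelta₁ S z s t)
          (C * (t - s) ^ (η + α - e)) := by
      intro e he₀ he₁
      obtain ⟨C, hC, h⟩ := exists_bd_remainder hS hη hα hηα hH hx he₀ le_rfl (by linarith)
      refine ⟨C * B, by positivity, fun s t hs hst ht => ?_⟩
      have h1 := h (V α) γ 0 1 P φ hγ zero_le_one hP (fun u _ _ => by simp) hφ s t _ (by linarith)
        hst ht (hz s t (by linarith) hst ht)
      rw [map_smul]
      refine h1.sub_comm.mono ?_
      have h2 : s ^ (-γ) ≤ τ ^ (-γ) := Real.rpow_le_rpow_of_nonpos hτ hs (by linarith)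
      have h3 : 0 ≤ (t - s) ^ (η + α - e) := Real.rpow_nonneg (by linarith) _
      rw [zero_mul, Real.exp_zero, mul_one, mul_one, sub_zero]
      calc C * P * s ^ (-γ) * (t - s) ^ (η + α - e) ≤ C * P * τ ^ (-γ) * (t - s) ^ (η + α - e) := by
            gcongr
        _ = _ := by rw [hB]; ring
    refine ⟨?_, fun s _ _ => by simp [hatDelta₁_self hS], ?_⟩
    -- Continuity is proved in X_e with e ≥ α, so that smoothing can start from φ in X_α, and then
    -- passes to X_ε by embedding.
    · set e := max ε α with he
      have he₀ : 0 ≤ e := hα.le.trans (le_max_right _ _)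
      have he₁ : e < 1 := max_lt hε₁ hα₁
      have hκ : 0 < η + α - e := by linarith
      obtain ⟨C₁, hC₁, h1⟩ := hrem e he₀ he₁
      obtain ⟨L, hL, hsm⟩ := hS.bd_smoothing hα.le (le_max_right ε α) (by linarith : e < 2)
      have hgerm : ∀ s t, τ ≤ s → s ≤ t → t ≤ 1 →
          (V e).Bd (S (t - s) ((x t - x s) • φ s)) (H * L * B * (t - s) ^ (η + α - e)) := by
        intro s t hs hst ht
        rcases hst.eq_or_lt with rfl | hst
        · rw [sub_self (x s), zero_smul, map_zero]
          exact (V e).bd_zero (by simp [Real.zero_rpow hκ.ne'])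
        have hts : 0 < t - s := by linarith
        rw [map_smul]
        refine ((hsm _ _ _ hts (by linarith) (hφB s hs (by linarith))).smul_le
          (hx s t (by linarith) hst.le ht)).mono (le_of_eq ?_)
        have h2 : (t - s) ^ (η + α - e) = (t - s) ^ η * (t - s) ^ (-e + α) := by
          rw [← Real.rpow_add hts]; ring_nf
        rw [h2]; ring
      have hδ : ∀ s t, τ ≤ s → s ≤ t → t ≤ 1 →
          (V e).Bd (hatDelta₁ S z s t) ((H * L * B + C₁) * (t - s) ^ (η + α - e)) := by
        intro s t hs hst ht
        have := (hgerm s t hs hst ht).sub (h1 s t hs hst ht)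
        rw [sub_sub_cancel] at this
        exact this.mono (le_of_eq (by ring))
      obtain ⟨K, hK, hemb⟩ := hS.bd_embedding hε₀ (le_max_left ε α) (by linarith : e < 2)
      obtain ⟨K', hK', hemb'⟩ := hS.norm_le_of_bd hα.le (by linarith : α < 2)
      have hφc : ContinuousOn φ (Icc τ 1) := by
        intro t ht
        have ht' : t ∈ Ioc (0 : ℝ) 1 := ⟨by linarith [ht.1], ht.2⟩
        rw [ContinuousWithinAt, Metric.tendsto_nhds]
        intro r hr
        have h3 := (hc.mono (D' := Icc τ 1) fun q hq => ⟨by linarith [hq.1], hq.2⟩).bd ht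
          (by positivity : 0 < r / (2 * K'))
        filter_upwards [h3] with q hq
        rw [dist_eq_norm]
        refine (hemb' _ _ hq).trans_lt ?_
        have : K' * (r / (2 * K')) = r / 2 := by field_simp
        linarith
      exact ((contOn_germ hS he₀ he₁ hκ hτ.le hxc hφc hgerm).sub
        (contOn_hatDelta₁ hS he₀ he₁ hκ hτ.le hδ)).embed hK hemb
    · obtain ⟨C, hC, h⟩ := hrem ε hε₀ hε₁
      refine ⟨C, fun s t hs hst ht => ?_⟩
      rw [div_le_iff₀ (Real.rpow_pos_of_pos (by linarith) _)]
      exact (h s t hs hst.le ht).2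
  · rw [hatDelta₂, deltaS₂]
    rw [hatDelta₁_cocycle hS z hrs hst]
    simp only [map_sub, map_add, map_neg, map_smul, hS.sub_apply hrs hst]
    module

lemma isMildSolution_orbit_add (hS : SemigroupScale A S V) (hη : 0 < η) (hα : 0 < α) (hα₁ : α < 1)
    (hηα : 1 < η + α) (hH : 0 ≤ H) (hx' : IsHolderPath η 0 1 x)
    (hx : ∀ u v, 0 ≤ u → u ≤ v → v ≤ 1 → |x v - x u| ≤ H * (v - u) ^ η) (hγ : 0 ≤ γ)
    (hγη : γ < η) (hP : 0 ≤ P) (h0 : z 0 = 0) (hz : IncrBd S (V α) α 0 R z)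
    (hφ : IsForcing S (V α) α γ 0 P (σ ∘ fun t => S t ψ + z t))
    (hc : (V α).ContOn (σ ∘ fun t => S t ψ + z t) (Ioc 0 1))
    (hs : SolvesConv S x (σ ∘ fun t => S t ψ + z t) z) :
    IsMildSolution S V η 1 x σ ψ (fun t => S t ψ + z t) := by
  -- With α' = ρ = α and β' = 0, the bound ρ+η+β'-α' equals η, so γ < η is the only condition on γ
  -- from above.
  refine ⟨hatDelta₁ S z, ⟨hx', α, 0, α, γ, le_rfl, hα.le, by linarith, by linarith, by linarith,
    hα₁, hγ, lt_min hγη (by linarith), memSing_of_isForcing hφ hc,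
    memIncrSing_of_isForcing hS hα hγ hP hφ,
    fun s t => S (t - s) ((x t - x s) • (σ ∘ fun t => S t ψ + z t) s) - hatDelta₁ S z s t,
    isSewing_of_solvesConv hS hη hα hα₁ hηα hH hx hγ hP hφ hc hs, ?_, ?_,
    hatDelta₁_self hS z 0⟩, ?_⟩
  · intro s t _ _ _
    rw [sub_sub_cancel]
  · intro t ht ht1
    refine ⟨(hz.bd_zero_weight le_rfl ht.le ht1).1, BanachSubspace.tendsto_nrm_of_bd ?_⟩
    intro ε hε
    obtain ⟨L, hL, hb⟩ := hS.bd_apply hα.le (by linarith : α < 2)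
    have h1 : Tendsto (fun s : ℝ => L * R * s ^ α) (𝓝[>] 0) (𝓝 0) :=
      tendsto_const_mul_rpow hα (tendsto_id.mono_left nhdsWithin_le_nhds) _
    filter_upwards [Ioc_mem_nhdsGT ht, h1.eventually (gt_mem_nhds hε)] with s hs h2
    rw [hatDelta₁_cocycle hS z hs.1.le hs.2, sub_add_cancel_left]
    refine ((hb _ _ _ (by linarith [hs.2]) (by linarith [hs.1])
      (hz.bd_zero_weight le_rfl hs.1.le (hs.2.trans ht1))).neg).mono ?_
    rw [sub_zero, ← mul_assoc]
    exact h2.le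
  · intro t _
    rw [hatDelta₁_zero_left h0]

/-- Every mild solution in the space `Y` solves the fixed point equation. -/
lemma fixedPoint_of_isMildSolution (hS : SemigroupScale A S V) {y : ℝ → X}
    (hy : MemY S V α γ 1 y) (hm : IsMildSolution S V η 1 x σ ψ y) :
    (y 0 - S 0 ψ = 0) ∧ (∃ R, 0 ≤ R ∧ IncrBd S (V α) α 0 R (fun t => y t - S t ψ)) ∧
      SolvesConv S x (σ ∘ fun t => S t ψ + (y t - S t ψ)) (fun t => y t - S t ψ) := by
  obtain ⟨J, ⟨-, α', β', ρ, γ', hβ', hβα', hα', hαβ', hρ, -, -, -, hsing, -,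
    M, hM, hJ, hJ0, hJ00⟩, hyJ⟩ := hm
  have hz : ∀ t, 0 ≤ t → t ≤ 1 → y t - S t ψ = J 0 t := fun t ht ht1 => by
    rw [hyJ t ⟨ht, ht1⟩, add_sub_cancel_left]
  have he : (fun t => S t ψ + (y t - S t ψ)) = y := funext fun t => add_sub_cancel _ _
  have hδ : ∀ s t, 0 ≤ s → s ≤ t →
      hatDelta₁ S (fun t => y t - S t ψ) s t = hatDelta₁ S y s t := fun s t hs hst => by
    rw [← hatDelta₁_orbit_add hS ψ _ hs hst, he]
  refine ⟨by rw [hz 0 le_rfl zero_le_one, hJ00], ?_, ?_⟩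
  · obtain ⟨-, -, hc, h0, C, hC⟩ := hy
    refine ⟨max C 0, le_max_right _ _, fun s t hs hst ht => ?_⟩
    rw [hδ s t hs hst, zero_mul, Real.exp_zero, mul_one]
    refine ⟨hc.1 (s, t) ⟨hs, hst, ht⟩, ?_⟩
    have h1 : 0 ≤ (t - s) ^ α := Real.rpow_nonneg (by linarith) α
    rcases hst.eq_or_lt with rfl | hst
    · rw [hatDelta₁_self hS, BanachSubspace.nrm_zero_eq]; positivity
    · have h2 := hC s t hs hst ht
      rw [div_le_iff₀ (Real.rpow_pos_of_pos (by linarith) α)] at h2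
      exact h2.trans (by gcongr; exact le_max_left _ _)
  rw [he]
  -- The exponents of the given integral are arbitrary and need not match α; the sewing identity
  -- alone makes J a cocycle.
  have hcoc : IsCocycle S J := by
    intro r s t hr hrs hst ht
    have h1 := hM.2 r s t hr hrs hst ht
    rw [hatDelta₂, deltaS₂] at h1
    have h2 : M r t = S (t - s) (-((x t - x s) • (σ ∘ y) s) +
        S (s - r) ((x t - x r) • (σ ∘ y) r - (x s - x r) • (σ ∘ y) r)) + S (t - s) (M r s) +
        M s t := by
      rw [← h1]; abel
    rw [hJ r t hr (hrs.trans hst) ht, hJ s t (by linarith) hst ht, hJ r s hr hrs (by linarith), h2]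
    simp only [map_sub, map_add, map_neg, map_smul, hS.sub_apply hrs hst]
    module
  obtain ⟨L₀, hL₀, hS0⟩ := hS.norm_apply_le
  intro s t hs hst ht
  have hval : hatDelta₁ S (fun t => y t - S t ψ) s t = J s t := by
    obtain ⟨K, hK, hemb⟩ := hS.norm_le_of_bd (hβ'.trans hβα') hα'
    have hlim : ∀ t, 0 < t → t ≤ 1 → Tendsto (fun r => J r t) (𝓝[>] 0) (𝓝 (J 0 t)) := by
      intro t ht ht1
      obtain ⟨h1, h2⟩ := hJ0 t ht ht1
      have hmem : ∀ᶠ r in 𝓝[>] (0 : ℝ), J r t - J 0 t ∈ (V α').carrier := by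
        obtain ⟨L', hL', hb⟩ := hS.bd_apply (hβ'.trans hβα') hα'
        filter_upwards [Ioc_mem_nhdsGT ht] with r hr
        refine (V α').carrier.sub_mem ?_ h1
        rw [hJ r t hr.1 hr.2 ht1]
        refine (V α').carrier.sub_mem ?_ ?_
        · exact (hb _ _ _ (by linarith [hr.2]) (by linarith [hr.1]) (BanachSubspace.bd_nrm
            ((V α').carrier.smul_mem _ (hsing.1.1 r ⟨hr.1, hr.2.trans ht1⟩)))).1
        -- ε = α' - β' < 1 places M in X_α', the space in which J has its limit at 0.
        · have h3 := (hM.1 (r / 2) (α' - β') (by linarith [hr.1]) (by linarith [hr.1, hr.2])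
            (by linarith) hαβ' (by linarith)).1.1 (r, t) ⟨by simp only; linarith [hr.1], hr.2, ht1⟩
          rwa [add_sub_cancel] at h3
      rw [tendsto_iff_norm_sub_tendsto_zero]
      have h3 := h2.const_mul K
      rw [mul_zero] at h3
      exact squeeze_zero' (Eventually.of_forall fun _ => norm_nonneg _)
        (hmem.mono fun r hr => hemb _ _ (BanachSubspace.bd_nrm hr)) h3
    have h1 := hlim t (by linarith) ht
    have h2 := hlim s hs (by linarith)
    have h3 : J 0 t = J s t + S (t - s) (J 0 s) := by
      refine tendsto_nhds_unique h1 ?_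
      refine (tendsto_const_nhds.add (((S (t - s)).continuous.tendsto _).comp h2)).congr' ?_
      filter_upwards [Ioc_mem_nhdsGT hs] with r hr
      exact (hcoc r s t hr.1 hr.2 hst ht).symm
    rw [hatDelta₁, hz t (by linarith) ht, hz s hs.le (by linarith), h3, add_sub_cancel_right]
  rw [hval]
  obtain ⟨K, hK, hemb⟩ := hS.norm_le_of_bd hβ' (by linarith)
  obtain ⟨hMc, hM0, C, hC⟩ := hM.1 (s / 2) 0 (by linarith) (by linarith) le_rfl one_pos (by linarith)
  rw [zero_add, add_zero, sub_zero] at *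
  have hMb : ∀ u v, s ≤ u → u ≤ v → v ≤ 1 → ‖M u v‖ ≤ K * (max C 0 * (v - u) ^ (η + ρ)) := by
    intro u v hu huv hv
    refine hemb _ _ ⟨hMc.1 (u, v) ⟨by simp only; linarith, huv, hv⟩, ?_⟩
    have h1 : 0 ≤ (v - u) ^ (η + ρ) := Real.rpow_nonneg (by linarith) _
    rcases huv.eq_or_lt with rfl | huv
    · rw [hM0 u (by linarith) hv, BanachSubspace.nrm_zero_eq]; positivity
    · have h2 := hC u v (by linarith) huv hv
      rw [div_le_iff₀ (Real.rpow_pos_of_pos (by linarith) _)] at h2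
      exact h2.trans (by gcongr; exact le_max_left _ _)
  -- Transporting J to the fixed time t by S(t-v) turns the cocycle into an additive functional,
  -- whose error from the germ is S(t-v)M(u,v), of order η+ρ > 1. Such a functional is the limit of
  -- the dyadic sums, which pins down J without uniqueness of the sewing function.
  have hfin := tendsto_dyadicSum_of_additive (x := x) (h := fun r => S (t - r) ((σ ∘ y) r))
    (I := fun u v => S (t - v) (J u v)) (a := s) (b := t) (C := L₀ * (K * max C 0)) (μ := η + ρ)
    (by linarith) (by
      intro r m v hr hrm hmv hv
      rw [hcoc r m v (by linarith) hrm hmv (by linarith), map_add, hS.sub_apply hmv hv, add_comm])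
    (by
      intro u v hu huv hv
      rw [hJ u v (by linarith) huv (by linarith), map_sub, hS.sub_apply huv hv, map_smul,
        sub_sub_cancel_left, norm_neg]
      refine (hS0 _ _ (by linarith) (by linarith)).trans ?_
      calc L₀ * ‖M u v‖ ≤ L₀ * (K * (max C 0 * (v - u) ^ (η + ρ))) := by
            gcongr; exact hMb u v hu huv (by linarith)
        _ = _ := by ring) le_rfl hst le_rfl
  simpa [hS.zero_apply] using hfin

end MildSolution

/-! ### Existence and uniqueness -/

theorem theorem3p11 {X : Type*} [NormedAddCommGroup X] [NormedSpace ℝ X] [CompleteSpace X]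
    (A : X →ₗ.[ℝ] X) (S : ℝ → X →L[ℝ] X) (V : ℝ → BanachSubspace X)
    (hAS : SemigroupScale A S V)
    -- the driving path
    (η : ℝ) (hη₀ : 1 / 2 < η) (hη₁ : η < 1) (x : ℝ → ℝ) (hx : IsHolderPath η 0 1 x)
    -- the nonlinearity on X: bounded, locally Lipschitz Gateaux derivative
    (σ : X → X) (σ' : X → X →L[ℝ] X)
    (hσ_deriv : ∀ u h : X, HasLineDerivAt ℝ σ (σ' u h) u h)
    (hσ_bdd : ∃ C : ℝ, ∀ u : X, ‖σ' u‖ ≤ C)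
    (hσ_lip : ∀ R > 0, ∃ L : ℝ, ∀ u v : X, ‖u‖ ≤ R → ‖v‖ ≤ R → ‖σ' u - σ' v‖ ≤ L * ‖u - v‖)
    -- the nonlinearity on the smaller space
    (α : ℝ) (hα₀ : 0 < α) (hα₁ : α < 1) (hηα : 1 < η + α)
    (hσα_maps : ∀ u ∈ (V α).carrier, σ u ∈ (V α).carrier)
    (ω Lip L : ℝ) (hω : 0 < ω) (hLip : 0 < Lip) (hL : 0 < L)
    (hσα_lip : ∀ R > 0, ∀ u ∈ (V α).carrier, ∀ v ∈ (V α).carrier,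
      (V α).nrm u ≤ R → (V α).nrm v ≤ R →
      (V α).nrm (σ u - σ v) ≤ Lip * (1 + R) ^ ω * (V α).nrm (u - v))
    (hσα_growth : ∀ u ∈ (V α).carrier, (V α).nrm (σ u) ≤ L * (1 + (V α).nrm u))
    -- the initial datum
    (θ : ℝ) (hθ₀ : 0 ≤ θ) (hθα : θ ≤ α) (hηθ : α + (1 + ω) * (α - θ) < η)
    (ψ : X) (hψ : ψ ∈ (V θ).carrier) :
    (∃ y : ℝ → X, MemY S V α (α - θ) 1 y ∧ IsMildSolution S V η 1 x σ ψ y) ∧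
    (∀ y₁ y₂ : ℝ → X,
      MemY S V α (α - θ) 1 y₁ → IsMildSolution S V η 1 x σ ψ y₁ →
      MemY S V α (α - θ) 1 y₂ → IsMildSolution S V η 1 x σ ψ y₂ →
      EqOn y₁ y₂ (Icc 0 1)) := by
  obtain ⟨K, hK⟩ := hσ_bdd
  have hK₀ : 0 ≤ K := (norm_nonneg _).trans (hK 0)
  have hη : 0 < η := by linarith
  -- This γ dominates both α-θ, the blow-up of y in X_α, and ω(α-θ), that of the Lipschitz constant
  -- of σ. The hypothesis on η says exactly that κ = η-α-γ is positive.
  set γ := (1 + ω) * (α - θ) with hγ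
  have hδ₀ : 0 ≤ α - θ := by linarith
  have hδγ : α - θ ≤ γ := by nlinarith
  set κ := η - α - γ with hκ
  have hκ₀ : 0 < κ := by linarith
  obtain ⟨C, hC⟩ := hx
  have hxH : ∀ u v, 0 ≤ u → u ≤ v → v ≤ 1 → |x v - x u| ≤ max C 0 * (v - u) ^ η := by
    intro u v hu huv hv
    refine (hC u ⟨hu, huv.trans hv⟩ v ⟨hu.trans huv, hv⟩).trans ?_
    rw [abs_of_nonneg (sub_nonneg.2 huv)]
    exact mul_le_mul_of_nonneg_right (le_max_left _ _) (Real.rpow_nonneg (sub_nonneg.2 huv) η)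
  have hH : 0 ≤ max C 0 := le_max_right _ _
  constructor
  · obtain ⟨z, hz0, ⟨R, hR, hz⟩, hs⟩ := exists_fixedPoint hAS hη hα₀ hα₁ hηα hH hxH hθ₀ hθα hψ hω
      le_rfl hκ₀ (by linarith) (by linarith) hK₀ hσ_deriv hK hσ_lip hσα_maps hLip hσα_lip hL
      hσα_growth
    -- For the integral of a single solution to be well defined, the smaller weight α-θ suffices.
    obtain ⟨C', hC', hF⟩ := exists_isForcing_comp hAS hα₀ hα₁ hθ₀ hθα hψ le_rfl hK₀
      (norm_sub_le_of_lineDeriv hσ_deriv hK) hL hσα_maps hσα_growth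
    exact ⟨fun t => S t ψ + z t, memY_orbit_add hAS hα₀ hα₁ hθ₀ hθα hψ hz0 hR hz,
      isMildSolution_orbit_add hAS hη hα₀ hα₁ hηα hH ⟨C, hC⟩ hxH hδ₀ (by linarith)
        (by positivity) hz0 hz (hF 0 R z le_rfl hR hz0 hz)
        (contOn_comp_of_locallyLipschitz hLip (contOn_orbit_add hAS hα₀ hα₁ hz0 hz).2 hσα_maps
          hσα_lip) hs⟩
  · intro y₁ y₂ hy₁ hm₁ hy₂ hm₂ t ht
    obtain ⟨h₁, ⟨R₁, hR₁, hz₁⟩, hs₁⟩ := fixedPoint_of_isMildSolution hAS hy₁ hm₁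
    obtain ⟨h₂, ⟨R₂, hR₂, hz₂⟩, hs₂⟩ := fixedPoint_of_isMildSolution hAS hy₂ hm₂
    have := fixedPoint_unique hAS hη hα₀ hα₁ hηα hH hxH hθ₀ hθα hψ hω le_rfl hκ₀ (by linarith)
      (by linarith) hK₀ hσ_deriv hK hσ_lip hσα_maps hLip hσα_lip h₁ h₂ (le_max_of_le_left hR₁)
      (hz₁.mono (le_max_left R₁ R₂)) (hz₂.mono (le_max_right R₁ R₂)) hs₁ hs₂ ht.1 ht.2
    exact sub_left_injective this
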